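/- Let $X$ be a complex manifold with almost complex structure $J$, and let $\pi$ be a holomorphic Poisson structure on $X$: a holomorphic section $\pi$ of $\wedge^2T^{1,0}X$ such that $\{f,g\}=\pi(df,dg)$ satisfies the Jacobi identity on local holomorphic functions. Write $\langle\eta,\pi^\sharp\xi\rangle=\pi(\xi,\eta)$ and $\pi=\pi_R+i\pi_I$ with $\pi_R,\pi_I$ real bivector fields, and let $L_Z$ denote the Lie derivative. Let $T^{0,1}X$ be the complex Lie algebroid with the Lie bracket of complex vector fields and the inclusion into $T_{\mathbb C}X$ as anchor. Let $(T^{1,0}X)^*_\pi$ be the complex Lie algebroid $(T^{1,0}X)^*$ with anchor $\pi^\sharp$ and bracket $$[\xi,\eta]=L_{\pi^\sharp\xi}\eta-L_{\pi^\sharp\eta}\xi-d\big(\pi(\xi,\eta)\big);$$ it satisfies $[df,dg]=d\{f,g\}$ for local holomorphic functions $f,g$. The Lie algebroid $T^{0,1}X$ is represented on $(T^{1,0}X)^*$ by $\nabla_Z\xi=\iota_Z\bar\partial\xi$ (so that $\nabla_Z(df)=0$ for holomorphic $f$), and $(T^{1,0}X)^*_\pi$ is represented on $T^{0,1}X$ by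 $\nabla_\xi Z=\mathrm{pr}^{0,1}[\pi^\sharp\xi,Z]$. With these representations $(T^{0,1}X,(T^{1,0}X)^*_\pi)$ is a matched pair of complex Lie algebroids. Let $T^{0,1}X\bowtie(T^{1,0}X)^*_\pi$ be the resulting complex Lie algebroid on $T^{0,1}X\oplus(T^{1,0}X)^*$, with anchor $(Z,\xi)\mapsto Z+\pi^\sharp\xi$ and bracket $$[(Z,\xi),(W,\eta)]=\big([Z,W]+\nabla_\xi W-\nabla_\eta Z,\ [\xi,\eta]+\nabla_Z\eta-\nabla_W\xi\big).$$ The endomorphism $\mathcal J_{4\pi}=\begin{pmatrix}J&4\pi_I^\sharp\\0&-J^*\end{pmatrix}$ of $TX\oplus T^*X$ is a generalized complex structure. Its $-i$-eigenbundle $L_{4\pi}\subset T_{\mathbb C}X\oplus T^*_{\mathbb C}X$ is a Dirac structure, hence a complex Lie algebroid with the projection to $T_{\mathbb C}X$ as anchor and the Courant bracket $$[X+\xi,Y+\eta]=[X,Y]+L_X\eta-L_Y\xi+\tfrac12d\big(\xi(Y)-\eta(X)\big).$$ The map $$T^{0,1}X\bowtie(T^{1,0}X)^*_\pi\to L_{4\pi},\qquad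 (Z,\xi)\mapsto(Z+\pi^\sharp\xi,\ \xi)$$ is an isomorphism of complex Lie algebroids over the identity of $X$. -/

import Mathlib

open scoped Manifold ContDiff
open Set

noncomputable section

namespace HolPoisson

/-! ## Complexification of a real vector space -/

/-- The complexification `V ⊗ ℂ = V ⊕ i V` of a real vector space; `⟨v, w⟩` stands for `v + i w`. -/
@[ext]
structure Cplx (V : Type*) where
  re : V
  im : V

namespace Cplx

variable {V : Type*} [AddCommGroup V]

instance : Zero (Cplx V) := ⟨⟨0, 0⟩⟩
instance : Add (Cplx V) := ⟨fun z w => ⟨z.re + w.re, z.im + w.im⟩⟩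
instance : Neg (Cplx V) := ⟨fun z => ⟨-z.re, -z.im⟩⟩

@[simp] theorem zero_re : (0 : Cplx V).re = 0 := rfl
@[simp] theorem zero_im : (0 : Cplx V).im = 0 := rfl
@[simp] theorem add_re (z w : Cplx V) : (z + w).re = z.re + w.re := rfl
@[simp] theorem add_im (z w : Cplx V) : (z + w).im = z.im + w.im := rfl
@[simp] theorem neg_re (z : Cplx V) : (-z).re = -z.re := rfl
@[simp] theorem neg_im (z : Cplx V) : (-z).im = -z.im := rfl

instance : AddCommGroup (Cplx V) where
  add_assoc a b c := by ext <;> simp [add_assoc]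
  zero_add a := by ext <;> simp
  add_zero a := by ext <;> simp
  add_comm a b := by ext <;> simp [add_comm]
  neg_add_cancel a := by ext <;> simp
  nsmul := nsmulRec
  zsmul := zsmulRec

variable [Module ℝ V]

instance : SMul ℂ (Cplx V) :=
  ⟨fun c z => ⟨c.re • z.re - c.im • z.im, c.re • z.im + c.im • z.re⟩⟩

@[simp] theorem smul_re (c : ℂ) (z : Cplx V) : (c • z).re = c.re • z.re - c.im • z.im := rfl
@[simp] theorem smul_im (c : ℂ) (z : Cplx V) : (c • z).im = c.re • z.im + c.im • z.re := rfl

instance : Module ℂ (Cplx V) where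
  one_smul z := by ext <;> simp
  mul_smul c d z := by
    ext
    · simp only [smul_re, smul_im, Complex.mul_re, Complex.mul_im]; module
    · simp only [smul_re, smul_im, Complex.mul_re, Complex.mul_im]; module
  smul_zero c := by ext <;> simp
  smul_add c z w := by
    ext
    · simp only [smul_re, add_re, add_im]; module
    · simp only [smul_im, add_re, add_im]; module
  add_smul c d z := by
    ext
    · simp only [smul_re, add_re, Complex.add_re, Complex.add_im]; module
    · simp only [smul_im, add_im, Complex.add_re, Complex.add_im]; module
  zero_smul z := by ext <;> simp

end Cplx

/-! ## The smooth manifold underlying a complex manifold -/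

/-- A complex manifold is a smooth (even real analytic) manifold. -/
instance isManifold_real {E : Type*} [NormedAddCommGroup E] [NormedSpace ℂ E]
    {X : Type*} [TopologicalSpace X] [ChartedSpace E X] [IsManifold 𝓘(ℂ, E) ω X] (n : ℕ∞ω) :
    IsManifold 𝓘(ℝ, E) n X := by
  have h : IsManifold 𝓘(ℝ, E) ω X := by
    apply isManifold_of_contDiffOn
    intro e e' he he'
    have h1 := (contDiffGroupoid ω 𝓘(ℂ, E)).compatible he he'
    rw [contDiffGroupoid, mem_groupoid_of_pregroupoid] at h1
    exact ContDiffOn.restrict_scalars ℝ h1.1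
  exact IsManifold.of_le (n := ω) le_top

section Calculus

variable (E : Type*) [NormedAddCommGroup E] [NormedSpace ℂ E]
variable {X : Type*} [TopologicalSpace X] [ChartedSpace E X]

/-- The fibre at `x` of the complexified tangent bundle `T_ℂ X = TX ⊗ ℂ`. -/
abbrev TC (x : X) := Cplx (TangentSpace 𝓘(ℝ, E) x)

/-- The fibre at `x` of the complexified cotangent bundle: real linear maps `T_x X → ℂ`. -/
abbrev CoTC (x : X) := TangentSpace 𝓘(ℝ, E) x →L[ℝ] ℂ

/-- The fibre at `x` of `T_ℂ X ⊕ T_ℂ^* X`. -/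
abbrev GTC (x : X) := TC E x × CoTC E x

/-- The fibre at `x` of `TX ⊕ T^*X`. -/
abbrev GT (x : X) := TangentSpace 𝓘(ℝ, E) x × (TangentSpace 𝓘(ℝ, E) x →L[ℝ] ℝ)

variable {E}

/-- Smooth complex valued functions on `U`. -/
def SmoothFun (f : X → ℂ) (U : Set X) : Prop := ContMDiffOn 𝓘(ℝ, E) 𝓘(ℝ, ℂ) ∞ f U

/-- Holomorphic, i.e. complex analytic, functions on an open set `U`. -/
def HolFun (f : X → ℂ) (U : Set X) : Prop := ContMDiffOn 𝓘(ℂ, E) 𝓘(ℂ, ℂ) ω f U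

/-- The complex bilinear pairing of `T_ℂ^* X` with `T_ℂ X`. -/
def pair {x : X} (ξ : CoTC E x) (Z : TC E x) : ℂ := ξ Z.re + Complex.I * ξ Z.im

/-- The almost complex structure `J` on `TX`. The tangent space at `x` is identified with `E` by
the preferred chart at `x`, whose differential is complex linear. -/
def J (x : X) : TangentSpace 𝓘(ℝ, E) x →L[ℝ] TangentSpace 𝓘(ℝ, E) x :=
  (Complex.I • ContinuousLinearMap.id ℝ E : E →L[ℝ] E)

/-- The complex linear extension of `J` to `T_ℂ X`. -/
def JC (x : X) : TC E x →ₗ[ℂ] TC E x where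
  toFun Z := ⟨J x Z.re, J x Z.im⟩
  map_add' Z W := by ext <;> simp
  map_smul' c Z := by ext <;> simp

/-- The dual map `J^* ξ = ξ ∘ J` on `T_ℂ^* X`. -/
def JCdual (x : X) : CoTC E x →ₗ[ℂ] CoTC E x where
  toFun ξ := ξ.comp (J x)
  map_add' ξ η := by ext; simp
  map_smul' c ξ := by ext; simp

/-- `T^{1,0}X`. -/
def T10 (x : X) : Submodule ℂ (TC E x) := Module.End.eigenspace (JC x) Complex.I

/-- `T^{0,1}X`. -/
def T01 (x : X) : Submodule ℂ (TC E x) := Module.End.eigenspace (JC x) (-Complex.I)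

/-- `(T^{1,0}X)^*`, the forms of type `(1,0)`. -/
def T10dual (x : X) : Submodule ℂ (CoTC E x) := Module.End.eigenspace (JCdual x) Complex.I

/-- The projection `T_ℂ X → T^{0,1}X` along `T^{1,0}X`. -/
def pr01 {x : X} (Z : TC E x) : TC E x := (1 / 2 : ℂ) • (Z + Complex.I • JC x Z)

/-- The differential of a complex valued function, as a complex 1-form. -/
def dfun (f : X → ℂ) (x : X) : CoTC E x := mfderiv 𝓘(ℝ, E) 𝓘(ℝ, ℂ) f x

/-- The local expression, in the preferred chart at `x`, of a complex 1-form. -/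
def inChart (ξ : ∀ x : X, CoTC E x) (x : X) (y : E) : E →L[ℝ] ℂ :=
  (ξ ((extChartAt 𝓘(ℝ, E) x).symm y)).comp
    (mfderiv 𝓘(ℝ, E) 𝓘(ℝ, E) (extChartAt 𝓘(ℝ, E) x).symm y)

/-- The exterior derivative of a complex 1-form: if `a` is the local expression of `ξ` in the
preferred chart at `x`, then `dξ(v, w) = (D_v a)(w) - (D_w a)(v)`. -/
def extD (ξ : ∀ x : X, CoTC E x) (x : X) :
    TangentSpace 𝓘(ℝ, E) x →L[ℝ] TangentSpace 𝓘(ℝ, E) x →L[ℝ] ℂ :=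
  let D : E →L[ℝ] E →L[ℝ] ℂ := fderiv ℝ (inChart ξ x) (extChartAt 𝓘(ℝ, E) x x)
  D - D.flip

/-- The contraction `ι_Z dξ`. -/
def iotaD (Z : ∀ x : X, TC E x) (ξ : ∀ x : X, CoTC E x) (x : X) : CoTC E x :=
  extD ξ x (Z x).re + Complex.I • extD ξ x (Z x).im

/-- The Lie derivative of a complex 1-form along a complex vector field,
`L_Z ξ = ι_Z dξ + d(ξ(Z))`. -/
def lieD (Z : ∀ x : X, TC E x) (ξ : ∀ x : X, CoTC E x) (x : X) : CoTC E x :=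
  iotaD Z ξ x + dfun (fun y => pair (ξ y) (Z y)) x

/-- The complex bilinear extension to complex vector fields of the Lie bracket of vector fields. -/
def lieBr (Z W : ∀ x : X, TC E x) (x : X) : TC E x :=
  ⟨VectorField.mlieBracket 𝓘(ℝ, E) (fun y => (Z y).re) (fun y => (W y).re) x
      - VectorField.mlieBracket 𝓘(ℝ, E) (fun y => (Z y).im) (fun y => (W y).im) x,
    VectorField.mlieBracket 𝓘(ℝ, E) (fun y => (Z y).re) (fun y => (W y).im) x
      + VectorField.mlieBracket 𝓘(ℝ, E) (fun y => (Z y).im) (fun y => (W y).re) x⟩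

/-- The Courant bracket
`[X + ξ, Y + η] = [X, Y] + L_X η - L_Y ξ + ½ d(ξ(Y) - η(X))` on sections of `T_ℂ X ⊕ T_ℂ^* X`. -/
def courant (A B : ∀ x : X, GTC E x) (x : X) : GTC E x :=
  (lieBr (fun y => (A y).1) (fun y => (B y).1) x,
    lieD (fun y => (A y).1) (fun y => (B y).2) x - lieD (fun y => (B y).1) (fun y => (A y).2) x
      + (1 / 2 : ℂ) • dfun (fun y => pair (A y).2 (B y).1 - pair (B y).2 (A y).1) x)

/-- The symmetric pairing `⟨X + ξ, Y + η⟩ = ½ (ξ(Y) + η(X))` on `T_ℂ X ⊕ T_ℂ^* X`. -/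
def symPair {x : X} (A B : GTC E x) : ℂ := (1 / 2 : ℂ) * (pair A.2 B.1 + pair B.2 A.1)

section Smoothness

variable [IsManifold 𝓘(ℂ, E) ω X]

/-- Smooth sections of `T_ℂ X` over `U`: real and imaginary parts are smooth vector fields. -/
def SmoothVF (Z : ∀ x : X, TC E x) (U : Set X) : Prop :=
  ContMDiffOn 𝓘(ℝ, E) 𝓘(ℝ, E).tangent ∞
      (fun x => (⟨x, (Z x).re⟩ : TangentBundle 𝓘(ℝ, E) X)) U ∧
    ContMDiffOn 𝓘(ℝ, E) 𝓘(ℝ, E).tangent ∞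
      (fun x => (⟨x, (Z x).im⟩ : TangentBundle 𝓘(ℝ, E) X)) U

/-- Smooth sections of `T_ℂ^* X` over `U`. -/
def SmoothForm (ξ : ∀ x : X, CoTC E x) (U : Set X) : Prop :=
  ContMDiffOn 𝓘(ℝ, E) (𝓘(ℝ, E).prod 𝓘(ℝ, E →L[ℝ] ℂ)) ∞
    (fun x => Bundle.TotalSpace.mk' (E →L[ℝ] ℂ)
      (E := fun x : X => TangentSpace 𝓘(ℝ, E) x →L[ℝ] Bundle.Trivial X ℂ x) x (ξ x)) U

/-- Smooth sections of `T_ℂ X ⊕ T_ℂ^* X` over `U`. -/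
def SmoothGTC (A : ∀ x : X, GTC E x) (U : Set X) : Prop :=
  SmoothVF (fun x => (A x).1) U ∧ SmoothForm (fun x => (A x).2) U

end Smoothness

end Calculus

/-! ## Complex Lie algebroids, matched pairs -/

section LieAlgebroids

variable (E : Type*) [NormedAddCommGroup E] [NormedSpace ℂ E]
variable (X : Type*) [TopologicalSpace X] [ChartedSpace E X]

/-- The data of a complex Lie algebroid over `X`: a family of subspaces `A x` of complex vector
spaces `V x`, a notion of smooth section, an anchor and a bracket. Only sections with values in `A`
matter; the axioms are in `IsLieAlgebroid`. -/
structure LieAlgebroidData where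
  V : X → Type*
  [addCommGroup : ∀ x, AddCommGroup (V x)]
  [module : ∀ x, Module ℂ (V x)]
  A : ∀ x, Submodule ℂ (V x)
  SmoothOn : (∀ x, V x) → Set X → Prop
  anchor : ∀ x, V x →ₗ[ℂ] TC E x
  bracket : (∀ x, V x) → (∀ x, V x) → ∀ x, V x

attribute [instance] LieAlgebroidData.addCommGroup LieAlgebroidData.module

variable {E X}

namespace LieAlgebroidData

/-- The smooth sections of `A` over `U`. -/
def IsSection (𝒜 : LieAlgebroidData E X) (s : ∀ x, 𝒜.V x) (U : Set X) : Prop :=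
  𝒜.SmoothOn s U ∧ ∀ x ∈ U, s x ∈ 𝒜.A x

/-- The vector field `a(s)` obtained by applying the anchor to a section. -/
def anchorVF (𝒜 : LieAlgebroidData E X) (s : ∀ x, 𝒜.V x) (x : X) : TC E x := 𝒜.anchor x (s x)

/-- The function `a(s) f`. -/
def act (𝒜 : LieAlgebroidData E X) (s : ∀ x, 𝒜.V x) (f : X → ℂ) (x : X) : ℂ :=
  pair (dfun f x) (𝒜.anchor x (s x))

/-- `A` is a smooth complex vector bundle of finite rank: being a smooth section is a local
property, and there are local frames such that a section is smooth if and only if its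
coefficients are. -/
structure IsVectorBundle (𝒜 : LieAlgebroidData E X) : Prop where
  congr : ∀ {U : Set X} {s t : ∀ x, 𝒜.V x}, IsOpen U → (∀ x ∈ U, s x = t x) →
    𝒜.IsSection s U → 𝒜.IsSection t U
  localProp : ∀ {U : Set X} {s : ∀ x, 𝒜.V x}, IsOpen U →
    (𝒜.IsSection s U ↔ ∀ x ∈ U, ∃ W ⊆ U, IsOpen W ∧ x ∈ W ∧ 𝒜.IsSection s W)
  exists_frame : ∀ x : X, ∃ (U : Set X) (r : ℕ) (e : Fin r → ∀ y, 𝒜.V y), IsOpen U ∧ x ∈ U ∧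
    (∀ y ∈ U, LinearIndependent ℂ (fun i => e i y) ∧
      Submodule.span ℂ (Set.range fun i => e i y) = 𝒜.A y) ∧
    ∀ W ⊆ U, IsOpen W → ∀ c : Fin r → X → ℂ,
      (𝒜.IsSection (fun y => ∑ i, c i y • e i y) W ↔ ∀ i, SmoothFun (E := E) (c i) W)

variable [IsManifold 𝓘(ℂ, E) ω X]

/-- The axioms of a complex Lie algebroid `A → X`, for the smooth sections over all open sets. -/
structure IsLieAlgebroid (𝒜 : LieAlgebroidData E X) : Prop where
  vectorBundle : 𝒜.IsVectorBundle
  anchor_smooth : ∀ {U : Set X} {s}, IsOpen U → 𝒜.IsSection s U → SmoothVF (𝒜.anchorVF s) U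
  bracket_mem : ∀ {U : Set X} {s t}, IsOpen U → 𝒜.IsSection s U → 𝒜.IsSection t U →
    𝒜.IsSection (𝒜.bracket s t) U
  bracket_congr : ∀ {U : Set X} {s s' t t'}, IsOpen U → 𝒜.IsSection s U → 𝒜.IsSection t U →
    (∀ x ∈ U, s x = s' x) → (∀ x ∈ U, t x = t' x) →
    ∀ x ∈ U, 𝒜.bracket s t x = 𝒜.bracket s' t' x
  bracket_add : ∀ {U : Set X} {s t u}, IsOpen U → 𝒜.IsSection s U → 𝒜.IsSection t U →
    𝒜.IsSection u U → ∀ x ∈ U, 𝒜.bracket s (t + u) x = 𝒜.bracket s t x + 𝒜.bracket s u x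
  bracket_skew : ∀ {U : Set X} {s t}, IsOpen U → 𝒜.IsSection s U → 𝒜.IsSection t U →
    ∀ x ∈ U, 𝒜.bracket s t x = -𝒜.bracket t s x
  leibniz : ∀ {U : Set X} {s t} {f : X → ℂ}, IsOpen U → 𝒜.IsSection s U → 𝒜.IsSection t U →
    SmoothFun (E := E) f U → ∀ x ∈ U,
      𝒜.bracket s (fun y => f y • t y) x = 𝒜.act s f x • t x + f x • 𝒜.bracket s t x
  jacobi : ∀ {U : Set X} {s t u}, IsOpen U → 𝒜.IsSection s U → 𝒜.IsSection t U →
    𝒜.IsSection u U → ∀ x ∈ U,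
      𝒜.bracket s (𝒜.bracket t u) x + 𝒜.bracket t (𝒜.bracket u s) x
        + 𝒜.bracket u (𝒜.bracket s t) x = 0
  anchor_bracket : ∀ {U : Set X} {s t}, IsOpen U → 𝒜.IsSection s U → 𝒜.IsSection t U →
    ∀ x ∈ U, 𝒜.anchor x (𝒜.bracket s t x) = lieBr (𝒜.anchorVF s) (𝒜.anchorVF t) x

end LieAlgebroidData

open LieAlgebroidData

/-- `∇ : Γ(A) ⊗ Γ(B) → Γ(B)` is a representation of the Lie algebroid `A` on the vector
bundle `B`, i.e. a flat `A`-connection on `B`. -/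
structure IsRepresentation (𝒜 ℬ : LieAlgebroidData E X)
    (nab : (∀ x, 𝒜.V x) → (∀ x, ℬ.V x) → ∀ x, ℬ.V x) : Prop where
  mem : ∀ {U : Set X} {s t}, IsOpen U → 𝒜.IsSection s U → ℬ.IsSection t U →
    ℬ.IsSection (nab s t) U
  congr : ∀ {U : Set X} {s s' t t'}, IsOpen U → 𝒜.IsSection s U → ℬ.IsSection t U →
    (∀ x ∈ U, s x = s' x) → (∀ x ∈ U, t x = t' x) → ∀ x ∈ U, nab s t x = nab s' t' x
  add_left : ∀ {U : Set X} {s s' t}, IsOpen U → 𝒜.IsSection s U → 𝒜.IsSection s' U →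
    ℬ.IsSection t U → ∀ x ∈ U, nab (s + s') t x = nab s t x + nab s' t x
  add_right : ∀ {U : Set X} {s t t'}, IsOpen U → 𝒜.IsSection s U → ℬ.IsSection t U →
    ℬ.IsSection t' U → ∀ x ∈ U, nab s (t + t') x = nab s t x + nab s t' x
  smul_left : ∀ {U : Set X} {s t} {f : X → ℂ}, IsOpen U → 𝒜.IsSection s U → ℬ.IsSection t U →
    SmoothFun (E := E) f U → ∀ x ∈ U, nab (fun y => f y • s y) t x = f x • nab s t x
  leibniz : ∀ {U : Set X} {s t} {f : X → ℂ}, IsOpen U → 𝒜.IsSection s U → ℬ.IsSection t U →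
    SmoothFun (E := E) f U → ∀ x ∈ U,
      nab s (fun y => f y • t y) x = 𝒜.act s f x • t x + f x • nab s t x
  flat : ∀ {U : Set X} {s s' t}, IsOpen U → 𝒜.IsSection s U → 𝒜.IsSection s' U →
    ℬ.IsSection t U → ∀ x ∈ U,
      nab (𝒜.bracket s s') t x = nab s (nab s' t) x - nab s' (nab s t) x

variable [IsManifold 𝓘(ℂ, E) ω X]

/-- `(A, B)` is a matched pair of complex Lie algebroids, with respect to `nabA : Γ(A) ⊗ Γ(B) → Γ(B)`
and `nabB : Γ(B) ⊗ Γ(A) → Γ(A)`. -/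
structure IsMatchedPair (𝒜 ℬ : LieAlgebroidData E X)
    (nabA : (∀ x, 𝒜.V x) → (∀ x, ℬ.V x) → ∀ x, ℬ.V x)
    (nabB : (∀ x, ℬ.V x) → (∀ x, 𝒜.V x) → ∀ x, 𝒜.V x) : Prop where
  left : 𝒜.IsLieAlgebroid
  right : ℬ.IsLieAlgebroid
  repA : IsRepresentation 𝒜 ℬ nabA
  repB : IsRepresentation ℬ 𝒜 nabB
  anchor_compat : ∀ {U : Set X} {s t}, IsOpen U → 𝒜.IsSection s U → ℬ.IsSection t U → ∀ x ∈ U,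
    lieBr (𝒜.anchorVF s) (ℬ.anchorVF t) x
      = -𝒜.anchor x (nabB t s x) + ℬ.anchor x (nabA s t x)
  bracketB_compat : ∀ {U : Set X} {s t t'}, IsOpen U → 𝒜.IsSection s U → ℬ.IsSection t U →
    ℬ.IsSection t' U → ∀ x ∈ U,
      nabA s (ℬ.bracket t t') x = ℬ.bracket (nabA s t) t' x + ℬ.bracket t (nabA s t') x
        + nabA (nabB t' s) t x - nabA (nabB t s) t' x
  bracketA_compat : ∀ {U : Set X} {s s' t}, IsOpen U → 𝒜.IsSection s U → 𝒜.IsSection s' U →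
    ℬ.IsSection t U → ∀ x ∈ U,
      nabB t (𝒜.bracket s s') x = 𝒜.bracket (nabB t s) s' x + 𝒜.bracket s (nabB t s') x
        + nabB (nabA s' t) s x - nabB (nabA s t) s' x

/-- The Lie algebroid `A ⋈ B` on `A ⊕ B` of a matched pair. -/
def bowtie (𝒜 ℬ : LieAlgebroidData E X)
    (nabA : (∀ x, 𝒜.V x) → (∀ x, ℬ.V x) → ∀ x, ℬ.V x)
    (nabB : (∀ x, ℬ.V x) → (∀ x, 𝒜.V x) → ∀ x, 𝒜.V x) : LieAlgebroidData E X where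
  V x := 𝒜.V x × ℬ.V x
  A x := (𝒜.A x).prod (ℬ.A x)
  SmoothOn s U := 𝒜.SmoothOn (fun x => (s x).1) U ∧ ℬ.SmoothOn (fun x => (s x).2) U
  anchor x := (𝒜.anchor x).coprod (ℬ.anchor x)
  bracket s t :=
    let s₁ := fun x => (s x).1
    let s₂ := fun x => (s x).2
    let t₁ := fun x => (t x).1
    let t₂ := fun x => (t x).2
    fun x => (𝒜.bracket s₁ t₁ x + nabB s₂ t₁ x - nabB t₂ s₁ x,
      ℬ.bracket s₂ t₂ x + nabA s₁ t₂ x - nabA t₁ s₂ x)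

/-- The fibrewise linear maps `φ x` define an isomorphism of complex Lie algebroids `A → B` over the
identity of `X`. -/
structure IsLieAlgebroidIso (𝒜 ℬ : LieAlgebroidData E X) (φ : ∀ x, 𝒜.V x →ₗ[ℂ] ℬ.V x) :
    Prop where
  bijOn : ∀ x, Set.BijOn (φ x) (𝒜.A x) (ℬ.A x)
  smooth_iff : ∀ {U : Set X} {s : ∀ x, 𝒜.V x}, IsOpen U → (∀ x ∈ U, s x ∈ 𝒜.A x) →
    (𝒜.SmoothOn s U ↔ ℬ.SmoothOn (fun x => φ x (s x)) U)
  anchor_comp : ∀ x, ∀ v ∈ 𝒜.A x, ℬ.anchor x (φ x v) = 𝒜.anchor x v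
  map_bracket : ∀ {U : Set X} {s t : ∀ x, 𝒜.V x}, IsOpen U → 𝒜.IsSection s U →
    𝒜.IsSection t U → ∀ x ∈ U,
      φ x (𝒜.bracket s t x) = ℬ.bracket (fun y => φ y (s y)) (fun y => φ y (t y)) x

end LieAlgebroids

/-! ## Generalized complex structures and Dirac structures -/

section Generalized

variable {E : Type*} [NormedAddCommGroup E] [NormedSpace ℂ E]
variable {X : Type*} [TopologicalSpace X] [ChartedSpace E X]

/-- The covector `α`, considered as a complex one. -/
def ofRealForm {x : X} (α : TangentSpace 𝓘(ℝ, E) x →L[ℝ] ℝ) : CoTC E x := Complex.ofRealCLM.comp α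

/-- The real part of a complex covector. -/
def reForm {x : X} (ξ : CoTC E x) : TangentSpace 𝓘(ℝ, E) x →L[ℝ] ℝ := Complex.reCLM.comp ξ

/-- The imaginary part of a complex covector. -/
def imForm {x : X} (ξ : CoTC E x) : TangentSpace 𝓘(ℝ, E) x →L[ℝ] ℝ := Complex.imCLM.comp ξ

/-- The complex linear extension to `T_ℂ X ⊕ T_ℂ^* X` of an endomorphism of `TX ⊕ T^*X`. -/
def complexify {x : X} (K : GT E x →ₗ[ℝ] GT E x) : GTC E x →ₗ[ℂ] GTC E x where
  toFun A :=
    let a := K (A.1.re, reForm A.2)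
    let b := K (A.1.im, imForm A.2)
    (⟨a.1, b.1⟩, ofRealForm a.2 + Complex.I • ofRealForm b.2)
  map_add' A B := by
    have h1 : ((A + B).1.re, reForm (A + B).2) = (A.1.re, reForm A.2) + (B.1.re, reForm B.2) := by
      ext <;> simp [reForm]
    have h2 : ((A + B).1.im, imForm (A + B).2) = (A.1.im, imForm A.2) + (B.1.im, imForm B.2) := by
      ext <;> simp [imForm]
    simp only [h1, h2, map_add]
    ext
    · simp
    · simp
    · simp [ofRealForm]; ring
  map_smul' c A := by
    have h1 : ((c • A).1.re, reForm (c • A).2)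
        = c.re • (A.1.re, reForm A.2) - c.im • (A.1.im, imForm A.2) := by
      ext <;> simp [reForm, imForm]
    have h2 : ((c • A).1.im, imForm (c • A).2)
        = c.re • (A.1.im, imForm A.2) + c.im • (A.1.re, reForm A.2) := by
      ext <;> simp [reForm, imForm]
    simp only [h1, h2, map_add, map_sub, map_smul]
    ext
    · simp
    · simp
    · simp [ofRealForm, Complex.ext_iff]
      constructor <;> ring

/-- The `-i`-eigenbundle of an endomorphism of `TX ⊕ T^*X`. -/
def eigenbundle (K : ∀ x : X, GT E x →ₗ[ℝ] GT E x) (x : X) : Submodule ℂ (GTC E x) :=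
  Module.End.eigenspace (complexify (K x)) (-Complex.I)

variable [IsManifold 𝓘(ℂ, E) ω X]

/-- A subbundle `L` of `T_ℂ X ⊕ T_ℂ^* X`, with the projection to `T_ℂ X` as anchor and the Courant
bracket. -/
def courantData (L : ∀ x : X, Submodule ℂ (GTC E x)) : LieAlgebroidData E X where
  V x := GTC E x
  A := L
  SmoothOn := SmoothGTC
  anchor x := LinearMap.fst ℂ (TC E x) (CoTC E x)
  bracket := courant

/-- A (complex) Dirac structure: a smooth subbundle `L` of `T_ℂ X ⊕ T_ℂ^* X` that is maximal
isotropic, `L = L^⊥`, and whose sections are closed under the Courant bracket. -/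
structure IsDirac (L : ∀ x : X, Submodule ℂ (GTC E x)) : Prop where
  vectorBundle : (courantData L).IsVectorBundle
  maximal_isotropic : ∀ x, ∀ A : GTC E x, A ∈ L x ↔ ∀ B ∈ L x, symPair A B = 0
  involutive : ∀ {U : Set X} {A B : ∀ x : X, GTC E x}, IsOpen U → SmoothGTC A U → SmoothGTC B U →
    (∀ x ∈ U, A x ∈ L x) → (∀ x ∈ U, B x ∈ L x) → ∀ x ∈ U, courant A B x ∈ L x

/-- A generalized complex structure: a smooth endomorphism `K` of `TX ⊕ T^*X` with `K² = -1` that is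
orthogonal for the symmetric pairing and integrable, i.e. the sections of its `-i`-eigenbundle
are closed under the Courant bracket. -/
structure IsGenComplex (K : ∀ x : X, GT E x →ₗ[ℝ] GT E x) : Prop where
  smooth : ∀ {U : Set X} {A : ∀ x : X, GTC E x}, IsOpen U → SmoothGTC A U →
    SmoothGTC (fun x => complexify (K x) (A x)) U
  sq_eq : ∀ x, ∀ a : GT E x, K x (K x a) = -a
  orthogonal : ∀ x, ∀ a b : GT E x,
    (K x a).2 (K x b).1 + (K x b).2 (K x a).1 = a.2 b.1 + b.2 a.1
  integrable : ∀ {U : Set X} {A B : ∀ x : X, GTC E x}, IsOpen U → SmoothGTC A U → SmoothGTC B U →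
    (∀ x ∈ U, A x ∈ eigenbundle K x) → (∀ x ∈ U, B x ∈ eigenbundle K x) →
    ∀ x ∈ U, courant A B x ∈ eigenbundle K x

end Generalized

/-! ## Holomorphic Poisson manifolds -/

section Poisson

variable (E : Type*) [NormedAddCommGroup E] [NormedSpace ℂ E]
variable (X : Type*) [TopologicalSpace X] [ChartedSpace E X] [IsManifold 𝓘(ℂ, E) ω X]

/-- A holomorphic Poisson structure on the complex manifold `X`: a smooth section `π` of
`∧² T^{1,0} X`, given by the skew map `π^♯ : T_ℂ^* X → T_ℂ X`, `η(π^♯ ξ) = π(ξ, η)`, which is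
holomorphic and for which `{f, g} = π(df, dg)` makes the holomorphic functions a sheaf of Poisson
algebras. -/
structure HolPoissonStructure where
  sharp : ∀ x : X, CoTC E x →ₗ[ℂ] TC E x
  skew : ∀ x, ∀ ξ η : CoTC E x, pair η (sharp x ξ) = -pair ξ (sharp x η)
  type20 : ∀ x, ∀ ξ : CoTC E x, sharp x ξ ∈ T10 x
  smooth : ∀ {U : Set X} {ξ : ∀ x : X, CoTC E x}, IsOpen U → SmoothForm ξ U →
    SmoothVF (fun x => sharp x (ξ x)) U
  holomorphic : ∀ {U : Set X} {f g : X → ℂ}, IsOpen U → HolFun (E := E) f U →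
    HolFun (E := E) g U → HolFun (E := E) (fun x => pair (dfun g x) (sharp x (dfun f x))) U
  jacobi : ∀ {U : Set X} {f g h : X → ℂ}, IsOpen U → HolFun (E := E) f U →
    HolFun (E := E) g U → HolFun (E := E) h U →
    let br : (X → ℂ) → (X → ℂ) → X → ℂ := fun u v x => pair (dfun v x) (sharp x (dfun u x))
    ∀ x ∈ U, br f (br g h) x + br g (br h f) x + br h (br f g) x = 0

variable {E X}

/-- The complex Lie algebroid `T^{0,1}X`: the inclusion into `T_ℂ X` is the anchor. -/
def tangent01 : LieAlgebroidData E X where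
  V x := TC E x
  A := T01
  SmoothOn := SmoothVF
  anchor _ := LinearMap.id
  bracket := lieBr

namespace HolPoissonStructure

variable (π : HolPoissonStructure E X)

/-- `π(ξ, η)`. -/
def biv (ξ η : ∀ x : X, CoTC E x) (x : X) : ℂ := pair (η x) (π.sharp x (ξ x))

/-- The Poisson bracket `{f, g} = π(df, dg)`. -/
def poisson (f g : X → ℂ) (x : X) : ℂ := π.biv (dfun f) (dfun g) x

/-- The vector field `π^♯ ξ`. -/
def sharpVF (ξ : ∀ x : X, CoTC E x) (x : X) : TC E x := π.sharp x (ξ x)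

/-- The complex Lie algebroid `(T^{1,0}X)^*_π`, with anchor `π^♯` and bracket
`[ξ, η] = L_{π^♯ ξ} η - L_{π^♯ η} ξ - d(π(ξ, η))`. -/
def cotangent10 : LieAlgebroidData E X where
  V x := CoTC E x
  A := T10dual
  SmoothOn := SmoothForm
  anchor := π.sharp
  bracket ξ η := fun x =>
    lieD (π.sharpVF ξ) η x - lieD (π.sharpVF η) ξ x - dfun (π.biv ξ η) x

/-- The representation of `T^{0,1}X` on `(T^{1,0}X)^*` given by the holomorphic structure of the
bundle, `∇_Z ξ = ι_Z ∂̄ξ`; note that `ι_Z ∂̄ξ = ι_Z dξ` for `Z` of type `(0,1)` and `ξ` of type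
`(1,0)`. -/
def nab01 (Z : ∀ x : X, TC E x) (ξ : ∀ x : X, CoTC E x) : ∀ x : X, CoTC E x := iotaD Z ξ

/-- The representation of `(T^{1,0}X)^*_π` on `T^{0,1}X`, `∇_ξ Z = pr^{0,1} [π^♯ ξ, Z]`. -/
def nab10 (ξ : ∀ x : X, CoTC E x) (Z : ∀ x : X, TC E x) (x : X) : TC E x :=
  pr01 (lieBr (π.sharpVF ξ) Z x)

/-- `T^{0,1}X ⋈ (T^{1,0}X)^*_π`. -/
def bowtie01 : LieAlgebroidData E X := bowtie tangent01 π.cotangent10 nab01 π.nab10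

/-- For a section `P^♯` of `∧² T_ℂ X` with imaginary part `P_I`, the endomorphism
`(v, α) ↦ (J v + P_I^♯ α, -J^* α)` of `TX ⊕ T^*X`. -/
def genEndo (P : ∀ x : X, CoTC E x →ₗ[ℂ] TC E x) (x : X) : GT E x →ₗ[ℝ] GT E x where
  toFun a := (J x a.1 + (P x (ofRealForm a.2)).im, -(a.2.comp (J x)))
  map_add' a b := by
    have h : ofRealForm (a + b).2 = ofRealForm a.2 + ofRealForm b.2 := by
      ext; simp [ofRealForm]
    rw [h]
    ext
    · simp only [Prod.fst_add, map_add, Cplx.add_im]; abel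
    · simp; ring
  map_smul' c a := by
    have h : ofRealForm (c • a).2 = (c : ℂ) • ofRealForm a.2 := by
      ext; simp [ofRealForm]
    rw [h, map_smul]
    ext
    · simp only [Prod.smul_fst, map_smul, Cplx.smul_im, Complex.ofReal_re, Complex.ofReal_im,
        zero_smul, add_zero, smul_add, RingHom.id_apply]
    · simp

/-- The endomorphism `𝒥_{4π}`, with upper right entry `4 π_I^♯ = (4π)_I^♯`. -/
def J4 : ∀ x : X, GT E x →ₗ[ℝ] GT E x := genEndo fun x => (4 : ℂ) • π.sharp x

/-- `L_{4π}`, the `-i`-eigenbundle of `𝒥_{4π}`. -/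
def L4 : ∀ x : X, Submodule ℂ (GTC E x) := eigenbundle π.J4

/-- The map `(Z, ξ) ↦ (Z + π^♯ ξ, ξ)`. -/
def phi (x : X) : TC E x × CoTC E x →ₗ[ℂ] GTC E x :=
  ((LinearMap.fst ℂ (TC E x) (CoTC E x)) + (π.sharp x).comp (LinearMap.snd ℂ _ _)).prod
    (LinearMap.snd ℂ (TC E x) (CoTC E x))

end HolPoissonStructure

end Poisson

end HolPoisson

end

/-! Everything is deduced from the Dirac structure `L4`; none of the Lie algebroid axioms is checked
by hand on the direct sum.

On forms of type (1,0) the complexified `π_I^♯` is `(1/2i) π^♯`, because the conjugate bivector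
annihilates them. The factor 4 then turns the eigenvector equation into `L4 = {(Z + π^♯ ξ, ξ)}` with
`Z` of type (0,1) and `ξ` of type (1,0) (`mem_L4_iff`), so that `phi` is a fibrewise isomorphism
onto `L4`. Maximal isotropy is linear algebra: it uses the skewness of `π` and the fact that
(1,0)-forms vanish on `T^{0,1}X`.

Involutivity is where the Poisson condition enters. `L4` has a local frame of sections `(Z, df)`
with `f` holomorphic and `Z - π^♯ df` of type (0,1). The Courant bracket of two of them has covector
part `d{f, g}`. On a holomorphic function `h` its vector part acts as `{f, {g, h}} - {g, {f, h}}`,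
which is `{{f, g}, h}` by the Jacobi identity (`courant_mem_of_holFun`). On an isotropic subbundle
the Courant bracket obeys the Leibniz rule, so closure on a frame gives closure on all sections
(`L4_involutive`). Isotropy and involutivity together remove the Jacobi anomaly of the Courant
bracket (`courantForm_jacobi`), so `L4` is a Lie algebroid.

`phi` respects brackets (`phi_bracket`): the covector part is a direct computation, and the vector
part follows from involutivity by projecting to `T^{0,1}X`. The axioms of `T^{0,1}X ⋈
(T^{1,0}X)^*_π` are therefore pulled back from `L4` (`IsLieAlgebroidIso.isLieAlgebroid`). The
matched pair conditions are the components of these axioms on the sections `(s, 0)` and `(0, t)`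
(`ZeroCompat.isMatchedPair`). -/

noncomputable section

namespace HolPoisson

/-! ### Smoothness of vector fields and 1-forms read in a chart. -/

section RealCalculus

open VectorField Bundle Filter Topology

variable {E : Type*} [NormedAddCommGroup E] [NormedSpace ℂ E]
variable {X : Type*} [TopologicalSpace X] [ChartedSpace E X]

/-- The differential at `y` of the preferred chart at `x₀`. -/
def chartDeriv (x₀ y : X) : TangentSpace 𝓘(ℝ, E) y →L[ℝ] E :=
  mfderiv 𝓘(ℝ, E) 𝓘(ℝ, E) (extChartAt 𝓘(ℝ, E) x₀) y

/-- In finite dimension a linear map is a sum of fixed coordinate forms multiplied by its values on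
a basis, so smoothness of these finitely many values suffices. -/
theorem contMDiffAt_clm_of_apply [FiniteDimensional ℂ E] {g : X → E →L[ℝ] ℂ} {x : X}
    (h : ∀ v, ContMDiffAt 𝓘(ℝ, E) 𝓘(ℝ, ℂ) ∞ (fun y => g y v) x) :
    ContMDiffAt 𝓘(ℝ, E) 𝓘(ℝ, E →L[ℝ] ℂ) ∞ g x := by
  have : FiniteDimensional ℝ E := FiniteDimensional.complexToReal E
  let b := Module.finBasis ℝ E
  let P : ∀ i, E →L[ℝ] ℝ := fun i => LinearMap.toContinuousLinearMap (b.coord i)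
  have hg : g = fun y => ∑ i, (P i).smulRight (g y (b i)) := by
    funext y
    ext v
    conv_lhs => rw [← b.sum_repr v, map_sum]
    rw [sum_apply]
    refine Finset.sum_congr rfl fun i _ => ?_
    rw [map_smul, ContinuousLinearMap.smulRight_apply]
    rfl
  rw [hg]
  refine ContMDiffAt.sum fun i _ => ?_
  have hL : ContMDiff 𝓘(ℝ, ℂ) 𝓘(ℝ, E →L[ℝ] ℂ) ∞ fun c : ℂ => (P i).smulRight c :=
    ((ContinuousLinearMap.smulRightL ℝ E ℂ (P i)).contDiff).contMDiff
  exact hL.contMDiffAt.comp x (h (b i))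

variable [IsManifold 𝓘(ℂ, E) ω X]

/-- The inverse of the differential at `y` of the preferred chart at `x₀`. -/
def chartDerivInv (x₀ y : X) : E →L[ℝ] TangentSpace 𝓘(ℝ, E) y :=
  (trivializationAt E (TangentSpace 𝓘(ℝ, E)) x₀).symmL ℝ y

theorem chartDerivInv_eq {x₀ y : X} (hy : y ∈ (chartAt E x₀).source) (v : E) :
    chartDerivInv x₀ y v
      = mfderiv 𝓘(ℝ, E) 𝓘(ℝ, E) (extChartAt 𝓘(ℝ, E) x₀).symm (extChartAt 𝓘(ℝ, E) x₀ y) v := by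
  have h := TangentBundle.symmL_trivializationAt (𝕜 := ℝ) (I := 𝓘(ℝ, E)) hy
  rw [chartDerivInv, h]
  simp only [modelWithCornersSelf_coe, range_id, mfderivWithin_univ]
  rfl

theorem chartDeriv_chartDerivInv {x₀ y : X} (hy : y ∈ (chartAt E x₀).source) (v : E) :
    chartDeriv x₀ y (chartDerivInv x₀ y v) = v := by
  have h := TangentBundle.continuousLinearMapAt_trivializationAt (𝕜 := ℝ) (I := 𝓘(ℝ, E)) hy
  rw [chartDeriv, ← h, chartDerivInv]
  exact Trivialization.continuousLinearMapAt_symmL _ (by simpa using hy) v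

theorem chartDerivInv_chartDeriv {x₀ y : X} (hy : y ∈ (chartAt E x₀).source)
    (v : TangentSpace 𝓘(ℝ, E) y) : chartDerivInv x₀ y (chartDeriv x₀ y v) = v := by
  have h := TangentBundle.continuousLinearMapAt_trivializationAt (𝕜 := ℝ) (I := 𝓘(ℝ, E)) hy
  rw [chartDeriv, ← h, chartDerivInv]
  exact Trivialization.symmL_continuousLinearMapAt _ (by simpa using hy) v

theorem chartDeriv_self (x : X) (v : TangentSpace 𝓘(ℝ, E) x) : chartDeriv x x v = v := by
  rw [chartDeriv, mfderiv_extChartAt_self]; rfl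

theorem chartDerivInv_self (x : X) (v : E) : chartDerivInv x x v = v := by
  have h := chartDerivInv_chartDeriv (mem_chart_source E x) v
  rwa [show chartDeriv x x v = v from chartDeriv_self x v] at h

/-- Smoothness at `x` of a real vector field. -/
def SmoothRVFAt (V : ∀ x : X, TangentSpace 𝓘(ℝ, E) x) (x : X) : Prop :=
  ContMDiffAt 𝓘(ℝ, E) 𝓘(ℝ, E).tangent ∞
      (fun x => (⟨x, V x⟩ : TangentBundle 𝓘(ℝ, E) X)) x

/-- Smoothness at `x` of a complex 1-form. -/
def SmoothFormAt (ξ : ∀ x : X, CoTC E x) (x : X) : Prop :=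
  ContMDiffAt 𝓘(ℝ, E) (𝓘(ℝ, E).prod 𝓘(ℝ, E →L[ℝ] ℂ)) ∞
    (fun x => Bundle.TotalSpace.mk' (E →L[ℝ] ℂ)
      (E := fun x : X => TangentSpace 𝓘(ℝ, E) x →L[ℝ] Bundle.Trivial X ℂ x) x (ξ x)) x

/-- On the chart domain the trivialization of the tangent bundle is `chartDeriv`. Smoothness of a
section becomes smoothness of a map into the fixed space `E`. -/
theorem smoothRVFAt_iff {V : ∀ x : X, TangentSpace 𝓘(ℝ, E) x} {x₀ : X} :
    SmoothRVFAt V x₀ ↔ ContMDiffAt 𝓘(ℝ, E) 𝓘(ℝ, E) ∞ (fun y => chartDeriv x₀ y (V y)) x₀ := by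
  rw [SmoothRVFAt, contMDiffAt_totalSpace]
  have h : (fun y => (trivializationAt E (TangentSpace 𝓘(ℝ, E)) x₀ ⟨y, V y⟩).2)
      =ᶠ[𝓝 x₀] fun y => chartDeriv x₀ y (V y) := by
    filter_upwards [(chartAt E x₀).open_source.mem_nhds (mem_chart_source E x₀)] with y hy
    rw [chartDeriv, ← TangentBundle.continuousLinearMapAt_trivializationAt hy]
    rw [Trivialization.continuousLinearMapAt_apply, Trivialization.coe_linearMapAt_of_mem]
    simpa using hy
  constructor
  · intro hh
    exact hh.2.congr_of_eventuallyEq h.symm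
  · intro hh
    exact ⟨contMDiffAt_id, hh.congr_of_eventuallyEq h⟩

theorem smoothRVFAt_chartDerivInv {x₀ y : X} (hy : y ∈ (chartAt E x₀).source) (v : E) :
    SmoothRVFAt (fun y => chartDerivInv x₀ y v) y := by
  have h := (trivializationAt E (TangentSpace 𝓘(ℝ, E)) x₀).contMDiffAt_symmL (n := ∞)
    (IB := 𝓘(ℝ, E)) (F₁ := E) (x := y) (by simpa using hy)
  have hv : ContMDiffAt 𝓘(ℝ, E) (𝓘(ℝ, E).prod 𝓘(ℝ, E)) ∞
      (fun m : X => TotalSpace.mk' E (E := Bundle.Trivial X E) m v) y :=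
    (contMDiffAt_totalSpace).2 ⟨contMDiffAt_id, contMDiffAt_const⟩
  exact ContMDiffAt.clm_bundle_apply (F₁ := E) (E₁ := Bundle.Trivial X E) h hv

theorem SmoothFormAt.apply {ξ : ∀ x : X, CoTC E x} {V : ∀ x : X, TangentSpace 𝓘(ℝ, E) x} {x : X}
    (hξ : SmoothFormAt ξ x) (hV : SmoothRVFAt V x) :
    ContMDiffAt 𝓘(ℝ, E) 𝓘(ℝ, ℂ) ∞ (fun y => ξ y (V y)) x := by
  have h := ContMDiffAt.clm_bundle_apply (F₁ := E) (E₁ := TangentSpace 𝓘(ℝ, E))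
    (F₂ := ℂ) (E₂ := Bundle.Trivial X ℂ) hξ hV
  exact (contMDiffAt_totalSpace.1 h).2

theorem smoothFormAt_iff_inCoordinates {ξ : ∀ x : X, CoTC E x} {x₀ : X} :
    SmoothFormAt ξ x₀ ↔ ContMDiffAt 𝓘(ℝ, E) 𝓘(ℝ, E →L[ℝ] ℂ) ∞
      (fun y => ((ξ y).comp (chartDerivInv x₀ y) : E →L[ℝ] ℂ)) x₀ := by
  rw [SmoothFormAt, contMDiffAt_hom_bundle]
  have h : (fun y => ContinuousLinearMap.inCoordinates E (TangentSpace 𝓘(ℝ, E)) ℂ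
      (Bundle.Trivial X ℂ) x₀ y x₀ y (ξ y))
      =ᶠ[𝓝 x₀] fun y => ((ξ y).comp (chartDerivInv x₀ y) : E →L[ℝ] ℂ) := by
    filter_upwards with y
    ext v
    simp [ContinuousLinearMap.inCoordinates, chartDerivInv]
  constructor
  · intro hh
    exact hh.2.congr_of_eventuallyEq h.symm
  · intro hh
    exact ⟨contMDiffAt_id, hh.congr_of_eventuallyEq h⟩

theorem smoothFormAt_of_apply [FiniteDimensional ℂ E] {ξ : ∀ x : X, CoTC E x} {x₀ : X}
    (h : ∀ v, ContMDiffAt 𝓘(ℝ, E) 𝓘(ℝ, ℂ) ∞ (fun y => ξ y (chartDerivInv x₀ y v)) x₀) :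
    SmoothFormAt ξ x₀ :=
  smoothFormAt_iff_inCoordinates.2 (contMDiffAt_clm_of_apply h)

theorem smoothFormAt_dfun {f : X → ℂ} {x₀ : X} (hf : ContMDiffAt 𝓘(ℝ, E) 𝓘(ℝ, ℂ) ∞ f x₀) :
    SmoothFormAt (fun y => (dfun f y : CoTC E y)) x₀ := by
  rw [smoothFormAt_iff_inCoordinates]
  have h := hf.mfderiv_const (m := ∞) le_rfl
  refine h.congr_of_eventuallyEq ?_
  filter_upwards with y
  ext v
  simp [inTangentCoordinates, ContinuousLinearMap.inCoordinates, chartDerivInv, dfun]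
  rfl

end RealCalculus

end HolPoisson

end

noncomputable section

namespace HolPoisson

/-! ### Exterior derivative, Lie bracket and Cartan's formula over the reals. -/

section Cartan

open VectorField Bundle Filter Topology

variable {E : Type*} [NormedAddCommGroup E] [NormedSpace ℂ E]
variable {X : Type*} [TopologicalSpace X] [ChartedSpace E X]

/-- The local expression, in the preferred chart at `x`, of a real vector field. -/
def vfInChart (V : ∀ x : X, TangentSpace 𝓘(ℝ, E) x) (x : X) (z : E) : E :=
  mpullback 𝓘(ℝ, E) 𝓘(ℝ, E) (extChartAt 𝓘(ℝ, E) x).symm V z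

theorem extChartAt_target_mem_nhds' (x : X) :
    (extChartAt 𝓘(ℝ, E) x).target ∈ 𝓝 (extChartAt 𝓘(ℝ, E) x x) :=
  (isOpen_extChartAt_target x).mem_nhds (mem_extChartAt_target x)

theorem contDiffAt_comp_chart_symm {F : Type*} [NormedAddCommGroup F] [NormedSpace ℝ F]
    {g : X → F} {x : X} {n : ℕ∞ω} (hg : ContMDiffAt 𝓘(ℝ, E) 𝓘(ℝ, F) n g x) :
    ContDiffAt ℝ n (g ∘ (extChartAt 𝓘(ℝ, E) x).symm) (extChartAt 𝓘(ℝ, E) x x) := by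
  have h := (contMDiffAt_iff.1 hg).2
  simp only [modelWithCornersSelf_coe, range_id, contDiffWithinAt_univ] at h
  exact h

theorem dfun_apply_eq_fderiv {f : X → ℂ} {x : X} (hf : MDifferentiableAt 𝓘(ℝ, E) 𝓘(ℝ, ℂ) f x)
    (v : TangentSpace 𝓘(ℝ, E) x) :
    (dfun f x : CoTC E x) v
      = fderiv ℝ (f ∘ (extChartAt 𝓘(ℝ, E) x).symm) (extChartAt 𝓘(ℝ, E) x x) v := by
  have h : (dfun f x : E →L[ℝ] ℂ)
      = fderivWithin ℝ (f ∘ (extChartAt 𝓘(ℝ, E) x).symm) (range 𝓘(ℝ, E))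
        (extChartAt 𝓘(ℝ, E) x x) := if_pos hf
  rw [modelWithCornersSelf_coe, range_id, fderivWithin_univ] at h
  exact congrArg (fun L : E →L[ℝ] ℂ => L v) h

variable [IsManifold 𝓘(ℂ, E) ω X]

theorem vfInChart_apply {V : ∀ x : X, TangentSpace 𝓘(ℝ, E) x} {x : X} {z : E}
    (hz : z ∈ (extChartAt 𝓘(ℝ, E) x).target) :
    mfderiv 𝓘(ℝ, E) 𝓘(ℝ, E) (extChartAt 𝓘(ℝ, E) x).symm z (vfInChart (E := E) V x z)
      = V ((extChartAt 𝓘(ℝ, E) x).symm z) := by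
  have h := isInvertible_mfderivWithin_extChartAt_symm (I := 𝓘(ℝ, E)) hz
  simp only [modelWithCornersSelf_coe, range_id, mfderivWithin_univ] at h
  exact h.self_apply_inverse _

theorem vfInChart_self (V : ∀ x : X, TangentSpace 𝓘(ℝ, E) x) (x : X) :
    vfInChart V x (extChartAt 𝓘(ℝ, E) x x) = V x := by
  have h := vfInChart_apply (V := V) (mem_extChartAt_target (I := 𝓘(ℝ, E)) x)
  have h2 := mfderivWithin_range_extChartAt_symm (I := 𝓘(ℝ, E)) (x := x)
  simp only [modelWithCornersSelf_coe, range_id, mfderivWithin_univ] at h2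
  have h3 := (congrArg (fun L : E →L[ℝ] E => L (vfInChart V x (extChartAt 𝓘(ℝ, E) x x)))
    h2).symm.trans h
  refine Eq.trans h3 ?_
  -- The base point obtained by applying the chart and its inverse equals `x` only propositionally,
  -- so the two values lie in fibres that have to be compared by `HEq`.
  have key : ∀ y, y = x → HEq (V y) (V x) := by rintro y rfl; rfl
  exact eq_of_heq (key _ (extChartAt_to_inv x))

theorem inChart_vfInChart (ξ : ∀ x : X, CoTC E x) (V : ∀ x : X, TangentSpace 𝓘(ℝ, E) x) {x : X}
    {z : E} (hz : z ∈ (extChartAt 𝓘(ℝ, E) x).target) :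
    inChart ξ x z (vfInChart V x z)
      = ((fun y => ξ y (V y)) ∘ (extChartAt 𝓘(ℝ, E) x).symm) z := by
  exact congrArg (ξ ((extChartAt 𝓘(ℝ, E) x).symm z)) (vfInChart_apply hz)

theorem SmoothRVFAt.differentiableAt [FiniteDimensional ℂ E]
    {V : ∀ x : X, TangentSpace 𝓘(ℝ, E) x} {x : X}
    (hV : SmoothRVFAt V x) : DifferentiableAt ℝ (vfInChart V x) (extChartAt 𝓘(ℝ, E) x x) := by
  have : FiniteDimensional ℝ E := FiniteDimensional.complexToReal E
  have : CompleteSpace E := FiniteDimensional.complete ℝ E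
  have h1 : MDifferentiableWithinAt 𝓘(ℝ, E) 𝓘(ℝ, E).tangent
    (fun x => (V x : TangentBundle 𝓘(ℝ, E) X)) univ x :=
      (hV.mdifferentiableAt (by simp)).mdifferentiableWithinAt
  have h := h1.differentiableWithinAt_mpullbackWithin_vectorField
  simp only [modelWithCornersSelf_coe, range_id, preimage_univ, inter_univ,
    mpullbackWithin_univ] at h
  exact differentiableWithinAt_univ.1 h

theorem SmoothFormAt.contDiffAt {ξ : ∀ x : X, CoTC E x} {x : X} (hξ : SmoothFormAt ξ x) :
    ContDiffAt ℝ ∞ (inChart ξ x) (extChartAt 𝓘(ℝ, E) x x) := by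
  refine (contDiffAt_comp_chart_symm (smoothFormAt_iff_inCoordinates.1 hξ)).congr_of_eventuallyEq ?_
  filter_upwards [extChartAt_target_mem_nhds' x] with z hz
  ext v
  have hy : (extChartAt 𝓘(ℝ, E) x).symm z ∈ (chartAt E x).source := by
    simpa using (extChartAt 𝓘(ℝ, E) x).map_target hz
  simp only [inChart, Function.comp, ContinuousLinearMap.comp_apply]
  rw [chartDerivInv_eq hy, (extChartAt 𝓘(ℝ, E) x).right_inv hz]
  rfl

theorem SmoothFormAt.differentiableAt {ξ : ∀ x : X, CoTC E x} {x : X} (hξ : SmoothFormAt ξ x) :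
    DifferentiableAt ℝ (inChart ξ x) (extChartAt 𝓘(ℝ, E) x x) :=
  hξ.contDiffAt.differentiableAt (by simp)

/-- At its centre the preferred chart has the identity as differential, so the pullback in the
definition of `mlieBracket` disappears. -/
theorem mlieBracket_eq_lieBracket (V W : ∀ x : X, TangentSpace 𝓘(ℝ, E) x) (x : X) :
    mlieBracket 𝓘(ℝ, E) V W x
      = lieBracket ℝ (vfInChart V x) (vfInChart W x) (extChartAt 𝓘(ℝ, E) x x) := by
  rw [← mlieBracketWithin_univ, mlieBracketWithin_apply, mfderiv_extChartAt_self]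
  simp only [modelWithCornersSelf_coe, range_id, preimage_univ, inter_univ, mpullbackWithin_univ]
  refine (congrArg (fun L : E →L[ℝ] E => L _)
    (ContinuousLinearMap.inverse_id (R := ℝ) (M := E))).trans ?_
  exact congrFun (lieBracketWithin_univ (𝕜 := ℝ)) _

theorem dfun_apply_section [FiniteDimensional ℂ E] {ξ : ∀ x : X, CoTC E x}
    {V : ∀ x : X, TangentSpace 𝓘(ℝ, E) x} {x : X}
    (hξ : SmoothFormAt ξ x) (hV : SmoothRVFAt V x) (w : TangentSpace 𝓘(ℝ, E) x) :
    (dfun (fun y => ξ y (V y)) x : CoTC E x) w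
      = fderiv ℝ (inChart ξ x) (extChartAt 𝓘(ℝ, E) x x) w (V x)
        + inChart ξ x (extChartAt 𝓘(ℝ, E) x x)
          (fderiv ℝ (vfInChart V x) (extChartAt 𝓘(ℝ, E) x x) w) := by
  rw [dfun_apply_eq_fderiv ((hξ.apply hV).mdifferentiableAt (by simp))]
  have h : ((fun y => ξ y (V y)) ∘ (extChartAt 𝓘(ℝ, E) x).symm)
      =ᶠ[𝓝 (extChartAt 𝓘(ℝ, E) x x)] fun z => inChart ξ x z (vfInChart V x z) := by
    filter_upwards [extChartAt_target_mem_nhds' x] with z hz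
    rw [inChart_vfInChart ξ V hz]
  rw [h.fderiv_eq]
  have := (hξ.differentiableAt.hasFDerivAt.clm_apply hV.differentiableAt.hasFDerivAt).fderiv
  rw [this, vfInChart_self V x]
  exact add_comm _ _

theorem inChart_self (ξ : ∀ x : X, CoTC E x) (x : X) (v : E) :
    inChart ξ x (extChartAt 𝓘(ℝ, E) x x) v = ξ x v := by
  have h2 := mfderivWithin_range_extChartAt_symm (I := 𝓘(ℝ, E)) (x := x)
  simp only [modelWithCornersSelf_coe, range_id, mfderivWithin_univ] at h2
  rw [inChart, h2]
  have key : ∀ y, y = x → (ξ y : E →L[ℝ] ℂ) v = (ξ x : E →L[ℝ] ℂ) v := by rintro y rfl; rfl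
  exact key _ (extChartAt_to_inv x)

/-- By the product rule `dfun_apply_section`, each differential splits into a derivative of the
coefficients of `ξ` and a derivative of those of the field. The former make up `dξ`, and the latter
make up `ξ` of the coordinate bracket. -/
theorem extD_apply [FiniteDimensional ℂ E] {ξ : ∀ x : X, CoTC E x}
    {V W : ∀ x : X, TangentSpace 𝓘(ℝ, E) x} {x : X}
    (hξ : SmoothFormAt ξ x) (hV : SmoothRVFAt V x) (hW : SmoothRVFAt W x) :
    extD ξ x (V x) (W x)
      = (dfun (fun y => ξ y (W y)) x : CoTC E x) (V x)
        - (dfun (fun y => ξ y (V y)) x : CoTC E x) (W x) - ξ x (mlieBracket 𝓘(ℝ, E) V W x) := by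
  rw [dfun_apply_section hξ hV, dfun_apply_section hξ hW, mlieBracket_eq_lieBracket]
  have hV' := vfInChart_self V x
  have hW' := vfInChart_self W x
  have h := inChart_self ξ x (lieBracket ℝ (vfInChart V x) (vfInChart W x) (extChartAt 𝓘(ℝ, E) x x))
  refine Eq.trans ?_ (congrArg (fun t => _ - t) h)
  rw [lieBracket, hV', hW']
  rw [map_sub]
  have h0 : extD ξ x (V x) (W x) = fderiv ℝ (inChart ξ x) (extChartAt 𝓘(ℝ, E) x x) (V x) (W x)
    - fderiv ℝ (inChart ξ x) (extChartAt 𝓘(ℝ, E) x x) (W x) (V x) := rfl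
  rw [h0]
  ring

/-- In the chart the local expression of `df` is the ordinary derivative of `f`, and `extD`
antisymmetrizes its second derivative, which is symmetric. -/
theorem extD_dfun {f : X → ℂ} {x : X} (hf : ContMDiffAt 𝓘(ℝ, E) 𝓘(ℝ, ℂ) ∞ f x) :
    extD (fun y => (dfun f y : CoTC E y)) x = 0 := by
  have hU : ∀ᶠ y in 𝓝 x, MDifferentiableAt 𝓘(ℝ, E) 𝓘(ℝ, ℂ) f y := by
    have h1 : ContMDiffAt 𝓘(ℝ, E) 𝓘(ℝ, ℂ) 1 f x := hf.of_le (by simp)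
    filter_upwards [(contMDiffAt_iff_contMDiffAt_nhds (by simp)).1 h1] with y hy
    exact hy.mdifferentiableAt (by simp)
  have hc : ContinuousAt (extChartAt 𝓘(ℝ, E) x).symm (extChartAt 𝓘(ℝ, E) x x) :=
    continuousAt_extChartAt_symm x
  have hU' : ∀ᶠ z in 𝓝 (extChartAt 𝓘(ℝ, E) x x),
      MDifferentiableAt 𝓘(ℝ, E) 𝓘(ℝ, ℂ) f ((extChartAt 𝓘(ℝ, E) x).symm z) := by
    have := hc.tendsto
    rw [extChartAt_to_inv] at this
    exact this.eventually hU
  have h : inChart (fun y => (dfun f y : CoTC E y)) x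
      =ᶠ[𝓝 (extChartAt 𝓘(ℝ, E) x x)] fderiv ℝ (f ∘ (extChartAt 𝓘(ℝ, E) x).symm) := by
    filter_upwards [hU', extChartAt_target_mem_nhds' x] with z hz hz'
    have hm : MDifferentiableAt 𝓘(ℝ, E) 𝓘(ℝ, E) (extChartAt 𝓘(ℝ, E) x).symm z := by
      have := mdifferentiableWithinAt_extChartAt_symm (I := 𝓘(ℝ, E)) hz'
      simpa [mdifferentiableWithinAt_univ] using this
    rw [← mfderiv_eq_fderiv, mfderiv_comp z hz hm]
    rfl
  have hsym : IsSymmSndFDerivAt ℝ (f ∘ (extChartAt 𝓘(ℝ, E) x).symm) (extChartAt 𝓘(ℝ, E) x x) :=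
    ((contDiffAt_comp_chart_symm hf).of_le (m := minSmoothness ℝ 2) (by
      rw [minSmoothness_of_isRCLikeNormedField]; exact WithTop.coe_le_coe.2 le_top)).isSymmSndFDerivAt le_rfl
  rw [extD, h.fderiv_eq]
  ext v w
  exact sub_eq_zero.2 (hsym v w)

end Cartan

end HolPoisson

end

noncomputable section

namespace HolPoisson

/-! ### Bilinearity of the pairing of complex covectors and vectors. -/

section Pairing

variable {E : Type*} [NormedAddCommGroup E] [NormedSpace ℂ E]
variable {X : Type*} [TopologicalSpace X] [ChartedSpace E X] {x : X}

theorem pair_add_left (ξ η : CoTC E x) (Z : TC E x) : pair (ξ + η) Z = pair ξ Z + pair η Z := by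
  simp [pair]; ring

theorem pair_sub_left (ξ η : CoTC E x) (Z : TC E x) : pair (ξ - η) Z = pair ξ Z - pair η Z := by
  simp [pair]; ring

theorem pair_neg_left (ξ : CoTC E x) (Z : TC E x) : pair (-ξ) Z = -pair ξ Z := by
  simp [pair]; ring

theorem pair_smul_left (c : ℂ) (ξ : CoTC E x) (Z : TC E x) : pair (c • ξ) Z = c * pair ξ Z := by
  simp [pair]; ring

theorem pair_zero_left (Z : TC E x) : pair (0 : CoTC E x) Z = 0 := by
  simp [pair]

theorem pair_add_right (ξ : CoTC E x) (Z W : TC E x) : pair ξ (Z + W) = pair ξ Z + pair ξ W := by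
  simp [pair]; ring

theorem pair_neg_right (ξ : CoTC E x) (Z : TC E x) : pair ξ (-Z) = -pair ξ Z := by
  simp [pair]; ring

theorem pair_sub_right (ξ : CoTC E x) (Z W : TC E x) : pair ξ (Z - W) = pair ξ Z - pair ξ W := by
  rw [sub_eq_add_neg, pair_add_right, pair_neg_right, sub_eq_add_neg]

theorem pair_smul_right (c : ℂ) (ξ : CoTC E x) (Z : TC E x) : pair ξ (c • Z) = c * pair ξ Z := by
  simp only [pair, Cplx.smul_re, Cplx.smul_im, map_sub, map_add, map_smul, Complex.real_smul]
  have h : c = c.re + c.im * Complex.I := (Complex.re_add_im c).symm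
  conv_rhs => rw [h]
  linear_combination (-(c.im : ℂ) * ξ Z.im) * Complex.I_sq

theorem pair_zero_right (ξ : CoTC E x) : pair ξ (0 : TC E x) = 0 := by
  simp [pair]

/-- The pairing with a fixed covector, as a linear form on `T_ℂ X`. -/
def pairLin (ξ : CoTC E x) : TC E x →ₗ[ℂ] ℂ where
  toFun := pair ξ
  map_add' := pair_add_right ξ
  map_smul' c Z := pair_smul_right c ξ Z

/-- The pairing with a fixed vector, as a linear form on `T_ℂ^* X`. -/
def pairLinLeft (Z : TC E x) : CoTC E x →ₗ[ℂ] ℂ where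
  toFun ξ := pair ξ Z
  map_add' ξ η := pair_add_left ξ η Z
  map_smul' c ξ := pair_smul_left c ξ Z

theorem pair_sum_right {ι : Type*} (s : Finset ι) (ξ : CoTC E x) (Z : ι → TC E x) :
    pair ξ (∑ i ∈ s, Z i) = ∑ i ∈ s, pair ξ (Z i) :=
  map_sum (pairLin ξ) Z s

theorem pair_sum_left {ι : Type*} (s : Finset ι) (ξ : ι → CoTC E x) (Z : TC E x) :
    pair (∑ i ∈ s, ξ i) Z = ∑ i ∈ s, pair (ξ i) Z :=
  map_sum (pairLinLeft Z) ξ s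

theorem pair_real (ξ : CoTC E x) (v : TangentSpace 𝓘(ℝ, E) x) : pair ξ ⟨v, 0⟩ = ξ v := by
  simp [pair]

theorem covector_ext {ξ η : CoTC E x} (h : ∀ Z, pair ξ Z = pair η Z) : ξ = η := by
  ext v
  rw [← pair_real, ← pair_real, h]

end Pairing

/-! ### Smooth complex functions and their differentials. -/

section SmoothFunctions

open Filter Topology

variable {E : Type*} [NormedAddCommGroup E] [NormedSpace ℂ E]
variable {X : Type*} [TopologicalSpace X] [ChartedSpace E X] {U : Set X} {x : X} {f g : X → ℂ}

theorem SmoothFun.contMDiffAt (hf : SmoothFun (E := E) f U) (hU : IsOpen U) (hx : x ∈ U) :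
    ContMDiffAt 𝓘(ℝ, E) 𝓘(ℝ, ℂ) ∞ f x :=
  ContMDiffOn.contMDiffAt hf (hU.mem_nhds hx)

theorem SmoothFun.mono {W : Set X} (hf : SmoothFun (E := E) f U) (h : W ⊆ U) :
    SmoothFun (E := E) f W :=
  ContMDiffOn.mono hf h

theorem smoothFun_congr (hf : SmoothFun (E := E) f U) (h : ∀ x ∈ U, g x = f x) :
    SmoothFun (E := E) g U :=
  ContMDiffOn.congr hf h

theorem smoothFun_const (c : ℂ) : SmoothFun (E := E) (fun _ : X => c) U := contMDiffOn_const

theorem SmoothFun.add (hf : SmoothFun (E := E) f U) (hg : SmoothFun (E := E) g U) :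
    SmoothFun (E := E) (fun x => f x + g x) U := ContMDiffOn.add hf hg

theorem SmoothFun.sub (hf : SmoothFun (E := E) f U) (hg : SmoothFun (E := E) g U) :
    SmoothFun (E := E) (fun x => f x - g x) U := ContMDiffOn.sub hf hg

theorem SmoothFun.neg (hf : SmoothFun (E := E) f U) :
    SmoothFun (E := E) (fun x => -f x) U := ContMDiffOn.neg hf

theorem SmoothFun.mul (hf : SmoothFun (E := E) f U) (hg : SmoothFun (E := E) g U) :
    SmoothFun (E := E) (fun x => f x * g x) U := by
  have h : ContDiff ℝ ∞ fun p : ℂ × ℂ => p.1 * p.2 := contDiff_fst.mul contDiff_snd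
  exact h.contMDiff.comp_contMDiffOn (ContMDiffOn.prodMk_space hf hg)

theorem dfun_congr_nhds (h : f =ᶠ[𝓝 x] g) : (dfun f x : CoTC E x) = dfun g x :=
  h.mfderiv_eq

theorem dfun_congr (hU : IsOpen U) (hx : x ∈ U) (h : ∀ y ∈ U, f y = g y) :
    (dfun f x : CoTC E x) = dfun g x :=
  dfun_congr_nhds (Filter.eventually_of_mem (hU.mem_nhds hx) h)

theorem dfun_const (c : ℂ) : (dfun (fun _ : X => c) x : CoTC E x) = 0 := mfderiv_const

theorem dfun_add (hU : IsOpen U) (hx : x ∈ U) (hf : SmoothFun (E := E) f U)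
    (hg : SmoothFun (E := E) g U) :
    (dfun (fun y => f y + g y) x : CoTC E x) = dfun f x + dfun g x := by
  have hf' := hf.contMDiffAt hU hx
  have hg' := hg.contMDiffAt hU hx
  have hfg := (hf.add hg).contMDiffAt hU hx
  ext v
  rw [add_apply, dfun_apply_eq_fderiv (hf'.mdifferentiableAt (by simp)),
    dfun_apply_eq_fderiv (hg'.mdifferentiableAt (by simp)),
    dfun_apply_eq_fderiv (hfg.mdifferentiableAt (by simp))]
  have h := fderiv_add ((contDiffAt_comp_chart_symm hf').differentiableAt (by simp))
    ((contDiffAt_comp_chart_symm hg').differentiableAt (by simp))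
  exact congrArg (fun L : E →L[ℝ] ℂ => L v) h

theorem dfun_mul (hU : IsOpen U) (hx : x ∈ U) (hf : SmoothFun (E := E) f U)
    (hg : SmoothFun (E := E) g U) :
    (dfun (fun y => f y * g y) x : CoTC E x) = f x • dfun g x + g x • dfun f x := by
  have hf' := hf.contMDiffAt hU hx
  have hg' := hg.contMDiffAt hU hx
  have hfg := (hf.mul hg).contMDiffAt hU hx
  ext v
  rw [add_apply, smul_apply, smul_apply,
    dfun_apply_eq_fderiv (hf'.mdifferentiableAt (by simp)),
    dfun_apply_eq_fderiv (hg'.mdifferentiableAt (by simp)),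
    dfun_apply_eq_fderiv (hfg.mdifferentiableAt (by simp))]
  have h := fderiv_mul ((contDiffAt_comp_chart_symm hf').differentiableAt (by simp))
    ((contDiffAt_comp_chart_symm hg').differentiableAt (by simp))
  have h2 := congrArg (fun L : E →L[ℝ] ℂ => L v) h
  refine h2.trans ?_
  simp only [Function.comp, extChartAt_to_inv]
  rfl

theorem dfun_const_mul (hU : IsOpen U) (hx : x ∈ U) (hf : SmoothFun (E := E) f U) (c : ℂ) :
    (dfun (fun y => c * f y) x : CoTC E x) = c • dfun f x := by
  rw [dfun_mul hU hx (smoothFun_const c) hf, dfun_const]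
  exact (congrArg _ (smul_zero (f x))).trans (add_zero _)

theorem dfun_neg (hU : IsOpen U) (hx : x ∈ U) (hf : SmoothFun (E := E) f U) :
    (dfun (fun y => -f y) x : CoTC E x) = -dfun f x := by
  have h := dfun_const_mul hU hx hf (-1)
  simp only [neg_mul, one_mul] at h
  exact h.trans (neg_one_smul ℂ (dfun f x : CoTC E x))

theorem dfun_sub (hU : IsOpen U) (hx : x ∈ U) (hf : SmoothFun (E := E) f U)
    (hg : SmoothFun (E := E) g U) :
    (dfun (fun y => f y - g y) x : CoTC E x) = dfun f x - dfun g x := by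
  have h := dfun_add hU hx hf hg.neg
  rw [dfun_neg hU hx hg] at h
  simpa [sub_eq_add_neg] using h

end SmoothFunctions

/-! ### Operations on smooth complex vector fields and 1-forms. -/

section SmoothSections

open Filter Topology VectorField

variable {E : Type*} [NormedAddCommGroup E] [NormedSpace ℂ E]
variable {X : Type*} [TopologicalSpace X] [ChartedSpace E X] [IsManifold 𝓘(ℂ, E) ω X]
variable {U : Set X} {x : X} {Z W : ∀ x : X, TC E x} {ξ η : ∀ x : X, CoTC E x} {f g : X → ℂ}

theorem SmoothVF.re_at (hZ : SmoothVF Z U) (hU : IsOpen U) (hx : x ∈ U) :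
    SmoothRVFAt (fun y => (Z y).re) x :=
  hZ.1.contMDiffAt (hU.mem_nhds hx)

theorem SmoothVF.im_at (hZ : SmoothVF Z U) (hU : IsOpen U) (hx : x ∈ U) :
    SmoothRVFAt (fun y => (Z y).im) x :=
  hZ.2.contMDiffAt (hU.mem_nhds hx)

theorem smoothVF_of_at (h : ∀ x ∈ U, SmoothRVFAt (fun y => (Z y).re) x ∧
    SmoothRVFAt (fun y => (Z y).im) x) : SmoothVF Z U :=
  ⟨fun x hx => (h x hx).1.contMDiffWithinAt, fun x hx => (h x hx).2.contMDiffWithinAt⟩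

theorem SmoothForm.at (hξ : SmoothForm ξ U) (hU : IsOpen U) (hx : x ∈ U) : SmoothFormAt ξ x :=
  ContMDiffOn.contMDiffAt hξ (hU.mem_nhds hx)

theorem smoothForm_of_at (h : ∀ x ∈ U, SmoothFormAt ξ x) : SmoothForm ξ U :=
  fun x hx => (h x hx).contMDiffWithinAt

theorem SmoothVF.mono {V : Set X} (hZ : SmoothVF Z U) (h : V ⊆ U) : SmoothVF Z V :=
  ⟨hZ.1.mono h, hZ.2.mono h⟩

theorem SmoothForm.mono {V : Set X} (hξ : SmoothForm ξ U) (h : V ⊆ U) : SmoothForm ξ V :=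
  ContMDiffOn.mono hξ h

theorem SmoothVF.congr (hZ : SmoothVF Z U) (h : ∀ x ∈ U, W x = Z x) : SmoothVF W U :=
  ⟨hZ.1.congr fun x hx => by rw [h x hx], hZ.2.congr fun x hx => by rw [h x hx]⟩

theorem SmoothForm.congr (hξ : SmoothForm ξ U) (h : ∀ x ∈ U, η x = ξ x) : SmoothForm η U :=
  ContMDiffOn.congr hξ fun x hx => by rw [h x hx]

/-- One statement covers the real and imaginary parts both of a sum and of a multiple by a complex
function. -/
theorem SmoothRVFAt.lin {V V' : ∀ x : X, TangentSpace 𝓘(ℝ, E) x} {a b : X → ℝ}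
    (hV : SmoothRVFAt V x) (hV' : SmoothRVFAt V' x)
    (ha : ContMDiffAt 𝓘(ℝ, E) 𝓘(ℝ, ℝ) ∞ a x) (hb : ContMDiffAt 𝓘(ℝ, E) 𝓘(ℝ, ℝ) ∞ b x) :
    SmoothRVFAt (fun y => a y • V y + b y • V' y) x := by
  rw [smoothRVFAt_iff] at *
  refine ((ha.smul hV).add (hb.smul hV')).congr_of_eventuallyEq ?_
  filter_upwards with y
  rw [map_add, map_smul, map_smul]
  rfl

theorem SmoothVF.add (hU : IsOpen U) (hZ : SmoothVF Z U) (hW : SmoothVF W U) :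
    SmoothVF (fun x => Z x + W x) U := by
  refine smoothVF_of_at fun x hx => ⟨?_, ?_⟩
  · simpa using (hZ.re_at hU hx).lin (hW.re_at hU hx) (a := fun _ => 1) (b := fun _ => 1)
      contMDiffAt_const contMDiffAt_const
  · simpa using (hZ.im_at hU hx).lin (hW.im_at hU hx) (a := fun _ => 1) (b := fun _ => 1)
      contMDiffAt_const contMDiffAt_const

theorem SmoothVF.smul (hU : IsOpen U) (hf : SmoothFun (E := E) f U) (hZ : SmoothVF Z U) :
    SmoothVF (fun x => f x • Z x) U := by
  refine smoothVF_of_at fun x hx => ?_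
  have hr : ContMDiffAt 𝓘(ℝ, E) 𝓘(ℝ, ℝ) ∞ (fun y => (f y).re) x :=
    Complex.reCLM.contDiff.contMDiff.contMDiffAt.comp x (hf.contMDiffAt hU hx)
  have hi : ContMDiffAt 𝓘(ℝ, E) 𝓘(ℝ, ℝ) ∞ (fun y => (f y).im) x :=
    Complex.imCLM.contDiff.contMDiff.contMDiffAt.comp x (hf.contMDiffAt hU hx)
  refine ⟨?_, (hZ.im_at hU hx).lin (hZ.re_at hU hx) hr hi⟩
  have h := (hZ.re_at hU hx).lin (hZ.im_at hU hx) hr hi.neg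
  have h2 : (fun y => (f y • Z y).re) = fun y => (f y).re • (Z y).re + (-(f y).im) • (Z y).im := by
    funext y; simp [sub_eq_add_neg]
  rw [h2]; exact h

theorem SmoothVF.const_smul (hU : IsOpen U) (c : ℂ) (hZ : SmoothVF Z U) :
    SmoothVF (fun x => c • Z x) U := hZ.smul hU (smoothFun_const c)

theorem SmoothVF.neg (hU : IsOpen U) (hZ : SmoothVF Z U) : SmoothVF (fun x => -Z x) U := by
  simpa using hZ.const_smul hU (-1)

theorem SmoothVF.sub (hU : IsOpen U) (hZ : SmoothVF Z U) (hW : SmoothVF W U) :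
    SmoothVF (fun x => Z x - W x) U := by
  simpa [sub_eq_add_neg] using hZ.add hU (hW.neg hU)

theorem smoothVF_zero : SmoothVF (fun x : X => (0 : TC E x)) U := by
  refine smoothVF_of_at fun x _ => ?_
  have h : SmoothRVFAt (fun y : X => (0 : TangentSpace 𝓘(ℝ, E) y)) x := by
    rw [smoothRVFAt_iff]
    simp only [map_zero]
    exact contMDiffAt_const
  exact ⟨h, h⟩

theorem SmoothVF.sum (hU : IsOpen U) {ι : Type*} {s : Finset ι} {Z : ι → ∀ x : X, TC E x}
    (hZ : ∀ i ∈ s, SmoothVF (Z i) U) : SmoothVF (fun x => ∑ i ∈ s, Z i x) U := by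
  classical
  induction s using Finset.induction_on with
  | empty => simpa using smoothVF_zero
  | insert a s ha ih =>
    simp only [Finset.sum_insert ha]
    exact (hZ a (by simp)).add hU (ih fun i hi => hZ i (by simp [hi]))

theorem SmoothForm.add (hU : IsOpen U) (hξ : SmoothForm ξ U) (hη : SmoothForm η U) :
    SmoothForm (fun x => ξ x + η x) U := by
  refine smoothForm_of_at fun x hx => ?_
  have h1 := hξ.at hU hx
  have h2 := hη.at hU hx
  rw [smoothFormAt_iff_inCoordinates] at *
  exact h1.add h2

theorem SmoothForm.smul (hU : IsOpen U) (hf : SmoothFun (E := E) f U) (hξ : SmoothForm ξ U) :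
    SmoothForm (fun x => f x • ξ x) U := by
  refine smoothForm_of_at fun x hx => ?_
  have h1 := hξ.at hU hx
  have h2 := hf.contMDiffAt hU hx
  rw [smoothFormAt_iff_inCoordinates] at *
  have h : ContDiff ℝ ∞ fun p : ℂ × (E →L[ℝ] ℂ) => p.1 • p.2 := contDiff_fst.smul contDiff_snd
  exact h.contMDiff.contMDiffAt.comp x (h2.prodMk_space h1)

theorem SmoothForm.const_smul (hU : IsOpen U) (c : ℂ) (hξ : SmoothForm ξ U) :
    SmoothForm (fun x => c • ξ x) U := hξ.smul hU (smoothFun_const c)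

theorem SmoothForm.neg (hU : IsOpen U) (hξ : SmoothForm ξ U) : SmoothForm (fun x => -ξ x) U :=
  (hξ.const_smul hU (-1)).congr fun x _ => (neg_one_smul ℂ (ξ x)).symm

theorem SmoothForm.sub (hU : IsOpen U) (hξ : SmoothForm ξ U) (hη : SmoothForm η U) :
    SmoothForm (fun x => ξ x - η x) U := by
  simpa [sub_eq_add_neg] using hξ.add hU (hη.neg hU)

theorem smoothForm_zero : SmoothForm (fun x : X => (0 : CoTC E x)) U := by
  refine smoothForm_of_at fun x _ => ?_
  rw [smoothFormAt_iff_inCoordinates]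
  simp only [ContinuousLinearMap.zero_comp]
  exact contMDiffAt_const

theorem SmoothForm.sum (hU : IsOpen U) {ι : Type*} {s : Finset ι} {ξ : ι → ∀ x : X, CoTC E x}
    (hξ : ∀ i ∈ s, SmoothForm (ξ i) U) : SmoothForm (fun x => ∑ i ∈ s, ξ i x) U := by
  classical
  induction s using Finset.induction_on with
  | empty => simpa using smoothForm_zero
  | insert a s ha ih =>
    simp only [Finset.sum_insert ha]
    exact (hξ a (by simp)).add hU (ih fun i hi => hξ i (by simp [hi]))

theorem SmoothFun.dfun (hU : IsOpen U) (hf : SmoothFun (E := E) f U) :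
    SmoothForm (fun x => (HolPoisson.dfun f x : CoTC E x)) U :=
  smoothForm_of_at fun _ hx => smoothFormAt_dfun (hf.contMDiffAt hU hx)

theorem SmoothForm.pair (hU : IsOpen U) (hξ : SmoothForm ξ U) (hZ : SmoothVF Z U) :
    SmoothFun (E := E) (fun x => HolPoisson.pair (ξ x) (Z x)) U := by
  have h1 : SmoothFun (E := E) (fun x => ξ x (Z x).re) U := fun x hx =>
    ((hξ.at hU hx).apply (hZ.re_at hU hx)).contMDiffWithinAt
  have h2 : SmoothFun (E := E) (fun x => ξ x (Z x).im) U := fun x hx =>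
    ((hξ.at hU hx).apply (hZ.im_at hU hx)).contMDiffWithinAt
  exact h1.add ((smoothFun_const _).mul h2)

end SmoothSections

end HolPoisson

end

noncomputable section

namespace HolPoisson

/-! ### Complex vector fields as derivations, Cartan calculus and the Lie bracket. -/

section ComplexCartan

open Filter Topology VectorField

variable {E : Type*} [NormedAddCommGroup E] [NormedSpace ℂ E]
variable {X : Type*} [TopologicalSpace X] [ChartedSpace E X]

/-- The derivative `Z f` of a function along a complex vector field. -/
def vfAct (Z : ∀ x : X, TC E x) (f : X → ℂ) (x : X) : ℂ := pair (dfun f x) (Z x)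

variable {U : Set X} {x : X} {Z W V : ∀ x : X, TC E x} {ξ η : ∀ x : X, CoTC E x} {f g : X → ℂ}

theorem vfAct_congr (hU : IsOpen U) (hx : x ∈ U) (h : ∀ y ∈ U, f y = g y) :
    vfAct Z f x = vfAct Z g x := by
  rw [vfAct, dfun_congr hU hx h, vfAct]

theorem vfAct_const (c : ℂ) : vfAct Z (fun _ => c) x = 0 := by
  rw [vfAct, dfun_const]; exact pair_zero_left _

theorem vfAct_add (hU : IsOpen U) (hx : x ∈ U) (hf : SmoothFun (E := E) f U)
    (hg : SmoothFun (E := E) g U) :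
    vfAct Z (fun y => f y + g y) x = vfAct Z f x + vfAct Z g x := by
  rw [vfAct, dfun_add hU hx hf hg, pair_add_left, vfAct, vfAct]

theorem vfAct_sub (hU : IsOpen U) (hx : x ∈ U) (hf : SmoothFun (E := E) f U)
    (hg : SmoothFun (E := E) g U) :
    vfAct Z (fun y => f y - g y) x = vfAct Z f x - vfAct Z g x := by
  rw [vfAct, dfun_sub hU hx hf hg, pair_sub_left, vfAct, vfAct]

theorem vfAct_neg (hU : IsOpen U) (hx : x ∈ U) (hf : SmoothFun (E := E) f U) :
    vfAct Z (fun y => -f y) x = -vfAct Z f x := by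
  rw [vfAct, dfun_neg hU hx hf, pair_neg_left, vfAct]

theorem vfAct_mul (hU : IsOpen U) (hx : x ∈ U) (hf : SmoothFun (E := E) f U)
    (hg : SmoothFun (E := E) g U) :
    vfAct Z (fun y => f y * g y) x = f x * vfAct Z g x + g x * vfAct Z f x := by
  rw [vfAct, dfun_mul hU hx hf hg, pair_add_left, pair_smul_left, pair_smul_left, vfAct, vfAct]

theorem lieBr_congr {Z' W' : ∀ x : X, TC E x} (hU : IsOpen U) (hx : x ∈ U)
    (hZ : ∀ y ∈ U, Z y = Z' y) (hW : ∀ y ∈ U, W y = W' y) : lieBr Z W x = lieBr Z' W' x := by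
  have e1 : ∀ᶠ y in 𝓝 x, y ∈ U := hU.mem_nhds hx
  have a : (fun y => (Z y).re) =ᶠ[𝓝 x] fun y => (Z' y).re :=
    e1.mono fun y hy => congrArg Cplx.re (hZ y hy)
  have b : (fun y => (Z y).im) =ᶠ[𝓝 x] fun y => (Z' y).im :=
    e1.mono fun y hy => congrArg Cplx.im (hZ y hy)
  have c : (fun y => (W y).re) =ᶠ[𝓝 x] fun y => (W' y).re :=
    e1.mono fun y hy => congrArg Cplx.re (hW y hy)
  have d : (fun y => (W y).im) =ᶠ[𝓝 x] fun y => (W' y).im :=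
    e1.mono fun y hy => congrArg Cplx.im (hW y hy)
  rw [lieBr, a.mlieBracket_vectorField_eq c, b.mlieBracket_vectorField_eq d,
    a.mlieBracket_vectorField_eq d, b.mlieBracket_vectorField_eq c, lieBr]

theorem extD_congr (hU : IsOpen U) (hx : x ∈ U) (h : ∀ y ∈ U, ξ y = η y) :
    extD ξ x = extD η x := by
  have hc : ContinuousAt (extChartAt 𝓘(ℝ, E) x).symm (extChartAt 𝓘(ℝ, E) x x) :=
    continuousAt_extChartAt_symm x
  have hU' : ∀ᶠ z in 𝓝 (extChartAt 𝓘(ℝ, E) x x), (extChartAt 𝓘(ℝ, E) x).symm z ∈ U := by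
    have h1 := hc.tendsto
    rw [extChartAt_to_inv] at h1
    exact h1.eventually (hU.mem_nhds hx)
  have h2 : inChart ξ x =ᶠ[𝓝 (extChartAt 𝓘(ℝ, E) x x)] inChart η x :=
    hU'.mono fun z hz => by rw [inChart, h _ hz, inChart]
  rw [extD, h2.fderiv_eq, extD]

theorem iotaD_congr (hU : IsOpen U) (hx : x ∈ U) (hZ : Z x = W x) (h : ∀ y ∈ U, ξ y = η y) :
    iotaD Z ξ x = iotaD W η x := by
  rw [iotaD, extD_congr hU hx h, hZ, iotaD]

theorem lieD_congr (hU : IsOpen U) (hx : x ∈ U) (hZ : ∀ y ∈ U, Z y = W y)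
    (h : ∀ y ∈ U, ξ y = η y) : lieD Z ξ x = lieD W η x := by
  rw [lieD, iotaD_congr hU hx (hZ x hx) h,
    dfun_congr hU hx (g := fun y => pair (η y) (W y)) fun y hy => by rw [h y hy, hZ y hy], lieD]

theorem lieBr_skew (Z W : ∀ x : X, TC E x) (x : X) : lieBr Z W x = -lieBr W Z x := by
  refine Cplx.ext ?_ ?_
  · simp only [lieBr, Cplx.neg_re]
    rw [mlieBracket_swap_apply, mlieBracket_swap_apply (V := fun y => (Z y).im)]
    abel
  · simp only [lieBr, Cplx.neg_im]
    rw [mlieBracket_swap_apply, mlieBracket_swap_apply (V := fun y => (Z y).im)]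
    abel

variable [IsManifold 𝓘(ℂ, E) ω X]

theorem SmoothVF.act (hU : IsOpen U) (hZ : SmoothVF Z U) (hf : SmoothFun (E := E) f U) :
    SmoothFun (E := E) (vfAct Z f) U :=
  (hf.dfun hU).pair hU hZ

theorem pair_dfun_pair (hU : IsOpen U) (hx : x ∈ U) (hξ : SmoothForm ξ U) (hW : SmoothVF W U)
    (v : TangentSpace 𝓘(ℝ, E) x) :
    (dfun (fun y => pair (ξ y) (W y)) x : CoTC E x) v
      = (dfun (fun y => ξ y (W y).re) x : CoTC E x) v
        + Complex.I * (dfun (fun y => ξ y (W y).im) x : CoTC E x) v := by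
  have h1 : SmoothFun (E := E) (fun x => ξ x (W x).re) U := fun x hx =>
    ((hξ.at hU hx).apply (hW.re_at hU hx)).contMDiffWithinAt
  have h2 : SmoothFun (E := E) (fun x => ξ x (W x).im) U := fun x hx =>
    ((hξ.at hU hx).apply (hW.im_at hU hx)).contMDiffWithinAt
  have h3 := dfun_add hU hx h1 ((smoothFun_const (E := E) Complex.I).mul h2)
  rw [dfun_const_mul hU hx h2] at h3
  exact congrArg (fun L : CoTC E x => L v) h3

/-- Cartan's formula for the exterior derivative of a complex 1-form. -/
theorem pair_iotaD [FiniteDimensional ℂ E] (hU : IsOpen U) (hx : x ∈ U) (hξ : SmoothForm ξ U)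
    (hZ : SmoothVF Z U) (hW : SmoothVF W U) :
    pair (iotaD Z ξ x) (W x) = vfAct Z (fun y => pair (ξ y) (W y)) x
      - vfAct W (fun y => pair (ξ y) (Z y)) x - pair (ξ x) (lieBr Z W x) := by
  have h := hξ.at hU hx
  have Zr := hZ.re_at hU hx
  have Zi := hZ.im_at hU hx
  have Wr := hW.re_at hU hx
  have Wi := hW.im_at hU hx
  have e1 := extD_apply h Zr Wr
  have e2 := extD_apply h Zr Wi
  have e3 := extD_apply h Zi Wr
  have e4 := extD_apply h Zi Wi
  have hl : pair (iotaD Z ξ x) (W x) = extD ξ x (Z x).re (W x).re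
      + Complex.I * extD ξ x (Z x).im (W x).re + Complex.I * (extD ξ x (Z x).re (W x).im
      + Complex.I * extD ξ x (Z x).im (W x).im) := rfl
  rw [hl, vfAct, vfAct, pair, pair, pair, pair_dfun_pair hU hx hξ hW, pair_dfun_pair hU hx hξ hW,
    pair_dfun_pair hU hx hξ hZ, pair_dfun_pair hU hx hξ hZ, lieBr, map_sub, map_add, e1, e2, e3, e4]
  linear_combination (-(ξ x) (mlieBracket 𝓘(ℝ, E) (fun y => (Z y).im) (fun y => (W y).im) x))
    * Complex.I_sq

theorem pair_lieD [FiniteDimensional ℂ E] (hU : IsOpen U) (hx : x ∈ U) (hξ : SmoothForm ξ U)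
    (hZ : SmoothVF Z U) (hW : SmoothVF W U) :
    pair (lieD Z ξ x) (W x) = vfAct Z (fun y => pair (ξ y) (W y)) x
      - pair (ξ x) (lieBr Z W x) := by
  rw [lieD, pair_add_left, pair_iotaD hU hx hξ hZ hW]
  simp only [vfAct]
  ring

theorem iotaD_dfun (hU : IsOpen U) (hx : x ∈ U) (hf : SmoothFun (E := E) f U) :
    iotaD Z (fun y => dfun f y) x = 0 := by
  rw [iotaD, extD_dfun (hf.contMDiffAt hU hx)]
  ext v
  simp

/-- This is Cartan's formula for the closed form `df`. It turns every identity between brackets into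
one between commutators of derivations. -/
theorem vfAct_lieBr [FiniteDimensional ℂ E] (hU : IsOpen U) (hx : x ∈ U)
    (hf : SmoothFun (E := E) f U) (hZ : SmoothVF Z U) (hW : SmoothVF W U) :
    vfAct (lieBr Z W) f x = vfAct Z (vfAct W f) x - vfAct W (vfAct Z f) x := by
  have h := pair_iotaD hU hx (hf.dfun hU) hZ hW
  rw [iotaD_dfun hU hx hf, pair_zero_left] at h
  have h2 : vfAct (lieBr Z W) f x = pair (dfun f x) (lieBr Z W x) := rfl
  rw [h2]
  have h3 : ∀ Z W : ∀ x : X, TC E x, vfAct Z (vfAct W f) x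
    = vfAct Z (fun y => pair (dfun f y) (W y)) x := fun _ _ => rfl
  rw [h3, h3]
  linear_combination h

/-- The function on the domain of the chart at `x₀` given by a linear form. -/
def chartLin (x₀ : X) (ℓ : E →L[ℝ] ℂ) (y : X) : ℂ := ℓ (extChartAt 𝓘(ℝ, E) x₀ y)

theorem smoothFun_chartLin (x₀ : X) (ℓ : E →L[ℝ] ℂ) :
    SmoothFun (E := E) (chartLin x₀ ℓ) (chartAt E x₀).source :=
  ℓ.contDiff.contMDiff.comp_contMDiffOn contMDiffOn_extChartAt

theorem dfun_chartLin {x₀ y : X} (ℓ : E →L[ℝ] ℂ) (hy : y ∈ (chartAt E x₀).source) :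
    (dfun (chartLin x₀ ℓ) y : CoTC E y) = ℓ.comp (chartDeriv x₀ y) := by
  have h := mfderiv_comp (I := 𝓘(ℝ, E)) (I' := 𝓘(ℝ, E)) (I'' := 𝓘(ℝ, ℂ)) y (g := ℓ)
    (f := extChartAt 𝓘(ℝ, E) x₀)
    ℓ.differentiableAt.mdifferentiableAt (mdifferentiableAt_extChartAt hy)
  rw [mfderiv_eq_fderiv, ContinuousLinearMap.fderiv] at h
  exact h

theorem pair_dfun_chartLin {x₀ y : X} (ℓ : E →L[ℝ] ℂ) (hy : y ∈ (chartAt E x₀).source)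
    (Z : TC E y) :
    pair (dfun (chartLin x₀ ℓ) y : CoTC E y) Z
      = ℓ (chartDeriv x₀ y Z.re) + Complex.I * ℓ (chartDeriv x₀ y Z.im) := by
  rw [dfun_chartLin ℓ hy]; rfl

theorem chartDeriv_injective {x₀ y : X} (hy : y ∈ (chartAt E x₀).source)
    {v w : TangentSpace 𝓘(ℝ, E) y} (h : chartDeriv x₀ y v = chartDeriv x₀ y w) : v = w := by
  rw [← chartDerivInv_chartDeriv hy v, h, chartDerivInv_chartDeriv hy w]

/-- Real valued `ℓ` are enough: the real and imaginary parts of the pairing are then the values of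
`ℓ` on the two parts of the vector. Continuous linear forms separate points of `E`, and the
differential of the chart is injective. -/
theorem vector_ext_chartLin {x₀ y : X} (hy : y ∈ (chartAt E x₀).source) {Z W : TC E y}
    (h : ∀ ℓ : E →L[ℝ] ℂ, pair (dfun (chartLin x₀ ℓ) y : CoTC E y) Z
      = pair (dfun (chartLin x₀ ℓ) y : CoTC E y) W) : Z = W := by
  have key : ∀ ℓ : E →L[ℝ] ℝ, ℓ (chartDeriv x₀ y Z.re) = ℓ (chartDeriv x₀ y W.re)
      ∧ ℓ (chartDeriv x₀ y Z.im) = ℓ (chartDeriv x₀ y W.im) := by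
    intro ℓ
    have h1 := h (Complex.ofRealCLM.comp ℓ)
    rw [pair_dfun_chartLin _ hy, pair_dfun_chartLin _ hy] at h1
    simpa [Complex.ext_iff] using h1
  have hre : chartDeriv x₀ y Z.re = chartDeriv x₀ y W.re := by
    by_contra hne
    obtain ⟨ℓ, hℓ⟩ := SeparatingDual.exists_separating_of_ne (R := ℝ) hne
    exact hℓ (key ℓ).1
  have him : chartDeriv x₀ y Z.im = chartDeriv x₀ y W.im := by
    by_contra hne
    obtain ⟨ℓ, hℓ⟩ := SeparatingDual.exists_separating_of_ne (R := ℝ) hne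
    exact hℓ (key ℓ).2
  exact Cplx.ext (chartDeriv_injective hy hre) (chartDeriv_injective hy him)

/-- Since brackets and differentials are local, functions defined near `x` are admissible tests and
no cutoff functions are needed. -/
theorem vector_ext_smooth (hU : IsOpen U) (hx : x ∈ U) {Z W : TC E x}
    (h : ∀ V ⊆ U, IsOpen V → x ∈ V → ∀ f, SmoothFun (E := E) f V →
      pair (dfun f x : CoTC E x) Z = pair (dfun f x) W) : Z = W :=
  vector_ext_chartLin (mem_chart_source E x) fun ℓ =>
    h (U ∩ (chartAt E x).source) inter_subset_left (hU.inter (chartAt E x).open_source)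
      ⟨hx, mem_chart_source E x⟩ _ ((smoothFun_chartLin x ℓ).mono inter_subset_right)

/-- The vector field with constant coefficients in the chart at `x₀` and value `w` at `x₀`. -/
def constVF (x₀ : X) (w : Cplx E) (y : X) : TC E y :=
  ⟨chartDerivInv x₀ y w.re, chartDerivInv x₀ y w.im⟩

theorem smoothVF_constVF (x₀ : X) (w : Cplx E) :
    SmoothVF (constVF x₀ w) (chartAt E x₀).source :=
  smoothVF_of_at fun _ hy =>
    ⟨smoothRVFAt_chartDerivInv hy w.re, smoothRVFAt_chartDerivInv hy w.im⟩

theorem constVF_self (x : X) (w : TC E x) : constVF (E := E) x w x = w :=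
  Cplx.ext (chartDerivInv_self (E := E) x w.re) (chartDerivInv_self (E := E) x w.im)

/-- Dual to `vector_ext_smooth`: identities of 1-forms may be tested on locally defined smooth
fields, to which Cartan's formula applies. -/
theorem covector_ext_smooth (hU : IsOpen U) (hx : x ∈ U) {ξ η : CoTC E x}
    (h : ∀ V ⊆ U, IsOpen V → x ∈ V → ∀ Z, SmoothVF Z V → pair ξ (Z x) = pair η (Z x)) : ξ = η := by
  refine covector_ext fun w => ?_
  have h1 := h (U ∩ (chartAt E x).source) inter_subset_left (hU.inter (chartAt E x).open_source)
      ⟨hx, mem_chart_source E x⟩ (constVF (E := E) x w) ((smoothVF_constVF (E := E) x w).mono inter_subset_right)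
  rwa [constVF_self] at h1

theorem smoothForm_of_pair [FiniteDimensional ℂ E] (hU : IsOpen U)
    (h : ∀ V ⊆ U, IsOpen V → ∀ Z, SmoothVF Z V → SmoothFun (E := E) (fun y => pair (ξ y) (Z y)) V) :
    SmoothForm ξ U := by
  refine smoothForm_of_at fun x hx => smoothFormAt_of_apply fun v => ?_
  have hV := hU.inter (chartAt E x).open_source
  have h1 := (h (U ∩ (chartAt E x).source) inter_subset_left hV
    (constVF x ⟨v, 0⟩) ((smoothVF_constVF x _).mono inter_subset_right)).contMDiffAt hV
      ⟨hx, mem_chart_source E x⟩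
  simpa [constVF, pair] using h1

theorem SmoothVF.lieBr [FiniteDimensional ℂ E] (hU : IsOpen U) (hZ : SmoothVF Z U)
    (hW : SmoothVF W U) : SmoothVF (HolPoisson.lieBr Z W) U := by
  have : FiniteDimensional ℝ E := FiniteDimensional.complexToReal E
  have : CompleteSpace E := FiniteDimensional.complete ℝ E
  have key : ∀ {V V' : ∀ x : X, TangentSpace 𝓘(ℝ, E) x} {x : X}, SmoothRVFAt V x →
      SmoothRVFAt V' x → SmoothRVFAt (mlieBracket 𝓘(ℝ, E) V V') x := by
    intro V V' x hV hV'
    refine ContMDiffAt.mlieBracket_vectorField (n := ⊤) (m := ⊤) hV hV' ?_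
    rw [minSmoothness_of_isRCLikeNormedField]
    exact le_rfl
  refine smoothVF_of_at fun x hx => ⟨?_, ?_⟩
  · have h := (key (hZ.re_at hU hx) (hW.re_at hU hx)).lin
      (key (hZ.im_at hU hx) (hW.im_at hU hx)) (a := fun _ => 1) (b := fun _ => -1)
      contMDiffAt_const contMDiffAt_const
    simp only [one_smul, neg_smul, ← sub_eq_add_neg] at h
    exact h
  · simpa using! (key (hZ.re_at hU hx) (hW.im_at hU hx)).lin
      (key (hZ.im_at hU hx) (hW.re_at hU hx)) (a := fun _ => 1) (b := fun _ => 1)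
      contMDiffAt_const contMDiffAt_const

theorem SmoothForm.iotaD [FiniteDimensional ℂ E] (hU : IsOpen U) (hξ : SmoothForm ξ U)
    (hZ : SmoothVF Z U) : SmoothForm (HolPoisson.iotaD Z ξ) U := by
  refine smoothForm_of_pair hU fun V hVU hV W hW => ?_
  have hξ' := hξ.mono hVU
  have hZ' := hZ.mono hVU
  refine smoothFun_congr ?_ fun x hx => pair_iotaD hV hx hξ' hZ' hW
  exact ((hZ'.act hV (hξ'.pair hV hW)).sub (hW.act hV (hξ'.pair hV hZ'))).sub
    (hξ'.pair hV (hZ'.lieBr hV hW))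

theorem SmoothForm.lieD [FiniteDimensional ℂ E] (hU : IsOpen U) (hξ : SmoothForm ξ U)
    (hZ : SmoothVF Z U) : SmoothForm (HolPoisson.lieD Z ξ) U :=
  (hξ.iotaD hU hZ).add hU ((hξ.pair hU hZ).dfun hU)

variable [FiniteDimensional ℂ E]

theorem lieBr_add_right (hU : IsOpen U) (hx : x ∈ U) (hZ : SmoothVF Z U) (hW : SmoothVF W U)
    (hV : SmoothVF V U) :
    lieBr Z (fun y => W y + V y) x = lieBr Z W x + lieBr Z V x := by
  refine vector_ext_smooth hU hx fun U' hU' hO hx' f hf => ?_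
  have hZ' := hZ.mono hU'
  have hW' := hW.mono hU'
  have hV' := hV.mono hU'
  rw [pair_add_right]
  have h1 := vfAct_lieBr hO hx' hf hZ' (hW'.add hO hV')
  have h2 := vfAct_lieBr hO hx' hf hZ' hW'
  have h3 := vfAct_lieBr hO hx' hf hZ' hV'
  have h4 : vfAct (fun y => W y + V y) f = fun y => vfAct W f y + vfAct V f y := by
    funext y; exact pair_add_right _ _ _
  have h5 : vfAct (fun y => W y + V y) (vfAct Z f) x = vfAct W (vfAct Z f) x + vfAct V (vfAct Z f) x :=
    pair_add_right _ _ _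
  rw [h4, h5, vfAct_add hO hx' (hW'.act hO hf) (hV'.act hO hf)] at h1
  simp only [vfAct] at h1 h2 h3 ⊢
  linear_combination h1 - h2 - h3

theorem lieBr_smul_right (hU : IsOpen U) (hx : x ∈ U) (hf : SmoothFun (E := E) f U)
    (hZ : SmoothVF Z U) (hW : SmoothVF W U) :
    lieBr Z (fun y => f y • W y) x = vfAct Z f x • W x + f x • lieBr Z W x := by
  refine vector_ext_smooth hU hx fun U' hU' hO hx' g hg => ?_
  have hZ' := hZ.mono hU'
  have hW' := hW.mono hU'
  have hf' := hf.mono hU'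
  rw [pair_add_right, pair_smul_right, pair_smul_right]
  have h1 := vfAct_lieBr hO hx' hg hZ' (hW'.smul hO hf')
  have h2 := vfAct_lieBr hO hx' hg hZ' hW'
  have h4 : vfAct (fun y => f y • W y) g = fun y => f y * vfAct W g y := by
    funext y; exact pair_smul_right _ _ _
  have h5 : vfAct (fun y => f y • W y) (vfAct Z g) x = f x * vfAct W (vfAct Z g) x :=
    pair_smul_right _ _ _
  rw [h4, h5, vfAct_mul hO hx' hf' (hW'.act hO hg)] at h1
  simp only [vfAct] at h1 h2 ⊢
  linear_combination h1 - f x * h2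

/-- Acting on a function, each double commutator expands into four triple derivatives, and the
twelve terms cancel in pairs. -/
theorem lieBr_jacobi (hU : IsOpen U) (hx : x ∈ U) (hZ : SmoothVF Z U) (hW : SmoothVF W U)
    (hV : SmoothVF V U) :
    lieBr Z (lieBr W V) x + lieBr W (lieBr V Z) x + lieBr V (lieBr Z W) x = 0 := by
  refine vector_ext_smooth hU hx fun U' hU' hO hx' f hf => ?_
  have key : ∀ {A B C : ∀ x : X, TC E x}, SmoothVF A U' → SmoothVF B U' → SmoothVF C U' →
      pair (dfun f x : CoTC E x) (lieBr A (lieBr B C) x) =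
        vfAct A (vfAct B (vfAct C f)) x - vfAct A (vfAct C (vfAct B f)) x
          - vfAct B (vfAct C (vfAct A f)) x + vfAct C (vfAct B (vfAct A f)) x := by
    intro A B C hA hB hC
    have h1 := vfAct_lieBr hO hx' hf hA (hB.lieBr hO hC)
    have h2 := vfAct_lieBr hO hx' (hA.act hO hf) hB hC
    rw [h2, vfAct_congr hO hx' fun y hy => vfAct_lieBr hO hy hf hB hC,
      vfAct_sub hO hx' (hB.act hO (hC.act hO hf)) (hC.act hO (hB.act hO hf))] at h1
    rw [← vfAct, h1]
    ring
  have hZ' := hZ.mono hU'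
  have hW' := hW.mono hU'
  have hV' := hV.mono hU'
  rw [pair_add_right, pair_add_right, key hZ' hW' hV', key hW' hV' hZ', key hV' hZ' hW',
    pair_zero_right]
  ring

end ComplexCartan

end HolPoisson

end

noncomputable section

namespace HolPoisson

/-! ### Vectors of type (1,0) and (0,1), forms of type (1,0). -/

section Types

variable {E : Type*} [NormedAddCommGroup E] [NormedSpace ℂ E]
variable {X : Type*} [TopologicalSpace X] [ChartedSpace E X] {x : X}

theorem J_J (v : TangentSpace 𝓘(ℝ, E) x) : J x (J x v) = -v := by
  have h : Complex.I • (Complex.I • (show E from v)) = -(show E from v) := by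
    rw [smul_smul, Complex.I_mul_I, neg_one_smul]
  exact h

/-- The imaginary part of the eigenvector equation follows from its real part by applying `J`, since
`J² = -1`. -/
theorem mem_T10_iff {Z : TC E x} : Z ∈ T10 x ↔ J x Z.re = -Z.im := by
  rw [T10, Module.End.mem_eigenspace_iff]
  constructor
  · intro h
    have h1 := congrArg Cplx.re h
    simpa [JC] using h1
  · intro h
    refine Cplx.ext ?_ ?_
    · simpa [JC] using h
    · have h2 := J_J Z.re
      rw [h, map_neg, neg_inj] at h2
      simpa [JC] using h2

theorem mem_T01_iff {Z : TC E x} : Z ∈ T01 x ↔ J x Z.re = Z.im := by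
  rw [T01, Module.End.mem_eigenspace_iff]
  constructor
  · intro h
    have h1 := congrArg Cplx.re h
    simpa [JC] using h1
  · intro h
    refine Cplx.ext ?_ ?_
    · simpa [JC] using h
    · have h2 := J_J Z.re
      rw [h] at h2
      simpa [JC] using h2

theorem mem_T10dual_iff {ξ : CoTC E x} : ξ ∈ T10dual x ↔ ∀ v, ξ (J x v) = Complex.I * ξ v := by
  rw [T10dual, Module.End.mem_eigenspace_iff]
  constructor
  · intro h v
    exact congrArg (fun L : CoTC E x => L v) h
  · intro h
    ext v
    exact h v

theorem pair_eq_zero_of_mem {ξ : CoTC E x} {Z : TC E x} (hξ : ξ ∈ T10dual x) (hZ : Z ∈ T01 x) :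
    pair ξ Z = 0 := by
  rw [mem_T10dual_iff] at hξ
  rw [mem_T01_iff] at hZ
  rw [pair, ← hZ, hξ]
  linear_combination ξ Z.re * Complex.I_mul_I

theorem mem_T10dual_of_pair {ξ : CoTC E x} (h : ∀ Z ∈ T01 x, pair ξ Z = 0) : ξ ∈ T10dual x := by
  rw [mem_T10dual_iff]
  intro v
  have h1 := h ⟨v, J x v⟩ (mem_T01_iff.2 rfl)
  rw [pair] at h1
  linear_combination (-Complex.I) * h1 + ξ (J x v) * Complex.I_mul_I

theorem pr01_of_mem_T01 {Z : TC E x} (h : Z ∈ T01 x) : pr01 Z = Z := by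
  rw [T01, Module.End.mem_eigenspace_iff] at h
  rw [pr01, h, smul_smul, mul_neg, Complex.I_mul_I, neg_neg, one_smul, ← two_smul ℂ, smul_smul]
  norm_num

theorem pr01_of_mem_T10 {Z : TC E x} (h : Z ∈ T10 x) : pr01 Z = 0 := by
  rw [T10, Module.End.mem_eigenspace_iff] at h
  rw [pr01, h, smul_smul, Complex.I_mul_I, neg_one_smul, add_neg_cancel, smul_zero]

theorem pr01_add (Z W : TC E x) : pr01 (Z + W) = pr01 Z + pr01 W := by
  simp only [pr01, map_add, smul_add]
  abel

theorem pr01_neg (Z : TC E x) : pr01 (-Z) = -pr01 Z := by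
  simp only [pr01, map_neg, smul_neg, smul_add]
  abel

theorem pr01_sub (Z W : TC E x) : pr01 (Z - W) = pr01 Z - pr01 W := by
  rw [sub_eq_add_neg, pr01_add, pr01_neg, sub_eq_add_neg]

/-- Complex conjugation on `T_ℂ X`. -/
def conjTC (Z : TC E x) : TC E x := ⟨Z.re, -Z.im⟩

theorem conjTC_mem_T01 {Z : TC E x} : conjTC Z ∈ T01 x ↔ Z ∈ T10 x := by
  rw [mem_T01_iff, mem_T10_iff]; rfl

end Types

/-! ### Holomorphic functions and the complex linearity of charts. -/

section Holomorphic

open Filter Topology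

variable {E : Type*} [NormedAddCommGroup E] [NormedSpace ℂ E]
variable {X : Type*} [TopologicalSpace X] [ChartedSpace E X] {U : Set X} {x : X} {f : X → ℂ}

/-- The charts for the real and for the complex model are the same maps, so holomorphy can be read
in the chart used for the real calculus. -/
theorem HolFun.contDiffAt (hf : HolFun (E := E) f U) (hU : IsOpen U) (hx : x ∈ U) :
    ContDiffAt ℂ ω (f ∘ (extChartAt 𝓘(ℝ, E) x).symm) (extChartAt 𝓘(ℝ, E) x x) := by
  have h := (contMDiffAt_iff.1 (ContMDiffOn.contMDiffAt hf (hU.mem_nhds hx))).2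
  simp only [modelWithCornersSelf_coe, range_id, contDiffWithinAt_univ] at h
  exact h

theorem HolFun.smoothFun (hf : HolFun (E := E) f U) (hU : IsOpen U) : SmoothFun (E := E) f U := by
  intro x hx
  refine ContMDiffAt.contMDiffWithinAt (contMDiffAt_iff.2 ⟨?_, ?_⟩)
  · exact (ContMDiffOn.continuousOn hf).continuousAt (hU.mem_nhds hx)
  · simp only [modelWithCornersSelf_coe, range_id, contDiffWithinAt_univ]
    exact ((hf.contDiffAt hU hx).restrict_scalars ℝ).of_le (by simp)

/-- The real derivative of a complex differentiable function is the restriction of its complex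
derivative, so it commutes with multiplication by `i`. -/
theorem HolFun.dfun_mem (hf : HolFun (E := E) f U) (hU : IsOpen U) (hx : x ∈ U) :
    (dfun f x : CoTC E x) ∈ T10dual x := by
  rw [mem_T10dual_iff]
  intro v
  have hm := ((hf.smoothFun hU).contMDiffAt hU hx).mdifferentiableAt (by simp)
  rw [dfun_apply_eq_fderiv hm, dfun_apply_eq_fderiv hm]
  have hd := (hf.contDiffAt hU hx).differentiableAt (by simp)
  rw [hd.fderiv_restrictScalars ℝ]
  exact (fderiv ℂ (f ∘ (extChartAt 𝓘(ℝ, E) x).symm) (extChartAt 𝓘(ℝ, E) x x)).map_smul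
    Complex.I (show E from v)

variable [IsManifold 𝓘(ℂ, E) ω X]

theorem holFun_chartLin (x₀ : X) (ℓ : E →L[ℂ] ℂ) :
    HolFun (E := E) (chartLin x₀ (ℓ.restrictScalars ℝ)) (chartAt E x₀).source :=
  ℓ.contDiff.contMDiff.comp_contMDiffOn (contMDiffOn_extChartAt (I := 𝓘(ℂ, E)) (x := x₀))

/-- `J` at `y` is defined by the preferred chart at `y`, while here the chart is centred at `x₀`.
The agreement is tested on complex linear forms `ℓ`: composed with the chart they are holomorphic,
so their differentials are of type (1,0). -/
theorem chartDeriv_J {x₀ y : X} (hy : y ∈ (chartAt E x₀).source) (v : TangentSpace 𝓘(ℝ, E) y) :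
    chartDeriv x₀ y (J y v) = Complex.I • chartDeriv x₀ y v := by
  by_contra hne
  obtain ⟨ℓ, hℓ⟩ := SeparatingDual.exists_separating_of_ne (R := ℂ) hne
  apply hℓ
  have h := (holFun_chartLin x₀ ℓ).dfun_mem (chartAt E x₀).open_source hy
  rw [mem_T10dual_iff] at h
  have h1 := h v
  rw [dfun_chartLin _ hy] at h1
  rw [map_smul]
  exact h1

theorem chartDerivInv_I {x₀ y : X} (hy : y ∈ (chartAt E x₀).source) (v : E) :
    chartDerivInv x₀ y (Complex.I • v) = J y (chartDerivInv x₀ y v) := by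
  apply chartDeriv_injective hy
  rw [chartDeriv_J hy, chartDeriv_chartDerivInv hy, chartDeriv_chartDerivInv hy]

theorem SmoothVF.JC {Z : ∀ x : X, TC E x} (hU : IsOpen U) (hZ : SmoothVF Z U) :
    SmoothVF (fun x => HolPoisson.JC x (Z x)) U := by
  have key : ∀ {V : ∀ x : X, TangentSpace 𝓘(ℝ, E) x} {x : X}, SmoothRVFAt V x →
      SmoothRVFAt (fun y => J y (V y)) x := by
    intro V x hV
    rw [smoothRVFAt_iff] at hV ⊢
    have hL : ContDiff ℝ ∞ fun v : E => Complex.I • v :=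
      ((Complex.I • ContinuousLinearMap.id ℝ E : E →L[ℝ] E)).contDiff
    refine (hL.contMDiff.contMDiffAt.comp x hV).congr_of_eventuallyEq ?_
    filter_upwards [(chartAt E x).open_source.mem_nhds (mem_chart_source E x)] with y hy
    exact chartDeriv_J hy _
  exact smoothVF_of_at fun x hx => ⟨key (hZ.re_at hU hx), key (hZ.im_at hU hx)⟩

theorem SmoothForm.JCdual [FiniteDimensional ℂ E] {ξ : ∀ x : X, CoTC E x} (hU : IsOpen U)
    (hξ : SmoothForm ξ U) : SmoothForm (fun x => HolPoisson.JCdual x (ξ x)) U := by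
  refine smoothForm_of_pair hU fun V hVU hV Z hZ => ?_
  exact smoothFun_congr ((hξ.mono hVU).pair hV (hZ.JC hV)) fun x _ => rfl

end Holomorphic

/-! ### Local frames of the (0,1)-vectors and the (1,0)-forms. -/

section Frames

variable {E : Type*} [NormedAddCommGroup E] [NormedSpace ℂ E] [FiniteDimensional ℂ E]
variable {X : Type*} [TopologicalSpace X] [ChartedSpace E X] [IsManifold 𝓘(ℂ, E) ω X]

/-- The coordinate functions of a basis of `E`. -/
def coordForm (i : Fin (Module.finrank ℂ E)) : E →L[ℂ] ℂ :=
  LinearMap.toContinuousLinearMap ((Module.finBasis ℂ E).coord i)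

/-- Holomorphic coordinates on the domain of the chart at `x₀`. -/
def hcoord (x₀ : X) (i : Fin (Module.finrank ℂ E)) : X → ℂ :=
  chartLin x₀ ((coordForm i).restrictScalars ℝ)

/-- The complex conjugates of the holomorphic coordinates. -/
def hcoordBar (x₀ : X) (i : Fin (Module.finrank ℂ E)) : X → ℂ :=
  chartLin x₀ (Complex.conjCLE.toContinuousLinearMap.comp ((coordForm i).restrictScalars ℝ))

/-- Twice the coordinate vector fields `∂/∂z̄ᵢ`. -/
def dbar (x₀ : X) (i : Fin (Module.finrank ℂ E)) : ∀ y : X, TC E y :=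
  constVF x₀ ⟨Module.finBasis ℂ E i, Complex.I • Module.finBasis ℂ E i⟩

theorem holFun_hcoord (x₀ : X) (i : Fin (Module.finrank ℂ E)) :
    HolFun (E := E) (hcoord x₀ i) (chartAt E x₀).source := holFun_chartLin x₀ _

theorem smoothVF_dbar (x₀ : X) (i : Fin (Module.finrank ℂ E)) :
    SmoothVF (dbar x₀ i) (chartAt E x₀).source := smoothVF_constVF x₀ _

theorem smoothForm_dhcoord (x₀ : X) (i : Fin (Module.finrank ℂ E)) :
    SmoothForm (fun y => (dfun (hcoord x₀ i) y : CoTC E y)) (chartAt E x₀).source :=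
  ((holFun_hcoord x₀ i).smoothFun (chartAt E x₀).open_source).dfun (chartAt E x₀).open_source

theorem smoothForm_dhcoordBar (x₀ : X) (i : Fin (Module.finrank ℂ E)) :
    SmoothForm (fun y => (dfun (hcoordBar x₀ i) y : CoTC E y)) (chartAt E x₀).source :=
  (smoothFun_chartLin x₀ _).dfun (chartAt E x₀).open_source

variable {x₀ y : X}

theorem dhcoord_mem (hy : y ∈ (chartAt E x₀).source) (i : Fin (Module.finrank ℂ E)) :
    (dfun (hcoord x₀ i) y : CoTC E y) ∈ T10dual y :=
  (holFun_hcoord x₀ i).dfun_mem (chartAt E x₀).open_source hy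

theorem dbar_mem (hy : y ∈ (chartAt E x₀).source) (i : Fin (Module.finrank ℂ E)) :
    (dbar x₀ i y : TC E y) ∈ T01 y := by
  rw [mem_T01_iff]
  exact (chartDerivInv_I hy _).symm

theorem coordForm_basis (i j : Fin (Module.finrank ℂ E)) :
    coordForm i (Module.finBasis ℂ E j) = if j = i then 1 else 0 := by
  have h : coordForm i (Module.finBasis ℂ E j)
    = (Module.finBasis ℂ E).coord i (Module.finBasis ℂ E j) := rfl
  rw [h, Module.Basis.coord_apply, Module.Basis.repr_self, Finsupp.single_apply]

theorem pair_dhcoordBar_dbar (hy : y ∈ (chartAt E x₀).source) (i j : Fin (Module.finrank ℂ E)) :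
    pair (dfun (hcoordBar x₀ i) y : CoTC E y) (dbar x₀ j y) = if j = i then 2 else 0 := by
  rw [hcoordBar, pair_dfun_chartLin _ hy]
  simp only [dbar, constVF]
  rw [chartDeriv_chartDerivInv hy, chartDeriv_chartDerivInv hy]
  simp only [ContinuousLinearMap.comp_apply, ContinuousLinearMap.coe_restrictScalars', map_smul,
    coordForm_basis]
  split_ifs
  · simp; norm_num
  · simp

theorem dhcoord_chartDerivInv (hy : y ∈ (chartAt E x₀).source) (i : Fin (Module.finrank ℂ E))
    (v : E) : (dfun (hcoord x₀ i) y : CoTC E y) (chartDerivInv x₀ y v) = coordForm i v := by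
  rw [hcoord, dfun_chartLin _ hy]
  exact congrArg (coordForm i) (chartDeriv_chartDerivInv hy v)

theorem basis_ext {v w : E} (h : ∀ i, coordForm i v = coordForm i w) : v = w :=
  (Module.finBasis ℂ E).ext_elem h

theorem pair_dhcoord (hy : y ∈ (chartAt E x₀).source) (i : Fin (Module.finrank ℂ E)) (Z : TC E y) :
    pair (dfun (hcoord x₀ i) y : CoTC E y) Z
      = coordForm i (chartDeriv x₀ y Z.re + Complex.I • chartDeriv x₀ y Z.im) := by
  rw [hcoord, pair_dfun_chartLin _ hy, map_add, map_smul]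
  rfl

/-- If `a` and `b` are the images in the chart of the two parts of `Z`, then all `dzᵢ(Z)` vanish
exactly when `a + i b = 0`, which says that `J` takes the real part to the imaginary part. This is
the standard test for type (0,1) below. -/
theorem mem_T01_of_pair_dhcoord (hy : y ∈ (chartAt E x₀).source) {Z : TC E y}
    (h : ∀ i, pair (dfun (hcoord (E := E) x₀ i) y : CoTC E y) Z = 0) : Z ∈ T01 y := by
  have h1 : chartDeriv x₀ y Z.re + Complex.I • chartDeriv x₀ y Z.im = 0 :=
    basis_ext fun i => by rw [← pair_dhcoord hy, h i, map_zero]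
  rw [mem_T01_iff]
  apply chartDeriv_injective hy
  rw [chartDeriv_J hy, eq_neg_of_add_eq_zero_left h1, smul_neg, smul_smul, Complex.I_mul_I,
    neg_one_smul, neg_neg]

/-- A vector of type (0,1) is determined by its real part, and `dz̄ᵢ` reads off twice the conjugate
of the `i`-th complex coordinate of that real part. -/
theorem T01_ext (hy : y ∈ (chartAt E x₀).source) {Z W : TC E y} (hZ : Z ∈ T01 y) (hW : W ∈ T01 y)
    (h : ∀ i, pair (dfun (hcoordBar (E := E) x₀ i) y : CoTC E y) Z
      = pair (dfun (hcoordBar (E := E) x₀ i) y : CoTC E y) W) : Z = W := by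
  have key : ∀ {Z : TC E y}, Z ∈ T01 y → ∀ i, pair (dfun (hcoordBar x₀ i) y : CoTC E y) Z
      = 2 * (starRingEnd ℂ) (coordForm i (chartDeriv x₀ y Z.re)) := by
    intro Z hZ i
    rw [mem_T01_iff] at hZ
    rw [hcoordBar, pair_dfun_chartLin _ hy, ← hZ, chartDeriv_J hy]
    simp only [ContinuousLinearMap.comp_apply, ContinuousLinearMap.coe_restrictScalars', map_smul]
    simp only [smul_eq_mul, ContinuousLinearEquiv.coe_coe, Complex.conjCLE_apply, map_mul,
      Complex.conj_I]
    linear_combination (-(starRingEnd ℂ) (coordForm i (chartDeriv x₀ y Z.re))) * Complex.I_mul_I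
  have hre : Z.re = W.re := by
    apply chartDeriv_injective hy
    refine basis_ext fun i => ?_
    have h1 := h i
    rw [key hZ, key hW] at h1
    exact (starRingEnd ℂ).injective (mul_left_cancel₀ two_ne_zero h1)
  refine Cplx.ext hre ?_
  rw [mem_T01_iff] at hZ hW
  rw [← hZ, ← hW, hre]

/-- The factor `1/2` compensates for `dbar` being twice the coordinate field. -/
theorem T01_eq_sum (hy : y ∈ (chartAt E x₀).source) {Z : TC E y} (hZ : Z ∈ T01 y) :
    Z = ∑ i, ((1 / 2 : ℂ) * pair (dfun (hcoordBar x₀ i) y : CoTC E y) Z) • dbar x₀ i y := by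
  refine T01_ext hy hZ (Submodule.sum_mem _ fun i _ => Submodule.smul_mem _ _ (dbar_mem hy i))
    fun i => ?_
  rw [pair_sum_right]
  simp only [pair_smul_right, pair_dhcoordBar_dbar hy]
  rw [Finset.sum_eq_single i]
  · simp only [if_pos]; ring
  · intro j _ hj; simp [hj]
  · simp

/-- In the chart a (1,0)-form is complex linear, not merely real linear, so its values on a complex
basis determine it. -/
theorem T10dual_ext (hy : y ∈ (chartAt E x₀).source) {ξ η : CoTC E y} (hξ : ξ ∈ T10dual y)
    (hη : η ∈ T10dual y) (h : ∀ i, ξ (chartDerivInv x₀ y (Module.finBasis ℂ E i))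
      = η (chartDerivInv x₀ y (Module.finBasis ℂ E i))) : ξ = η := by
  have key : ∀ {ξ : CoTC E y}, ξ ∈ T10dual y → ∀ v : E, ξ (chartDerivInv x₀ y v)
      = ∑ i, coordForm i v * ξ (chartDerivInv x₀ y (Module.finBasis ℂ E i)) := by
    intro ξ hξ v
    rw [mem_T10dual_iff] at hξ
    have hc : ∀ (c : ℂ) (v : E), ξ (chartDerivInv x₀ y (c • v)) = c * ξ (chartDerivInv x₀ y v) := by
      intro c v
      have h1 : c • v = c.re • v + c.im • (Complex.I • v) := by
        conv_lhs => rw [← Complex.re_add_im c]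
        rw [add_smul, mul_smul]
        rfl
      rw [h1, map_add, map_add, map_smul, map_smul, map_smul, map_smul, chartDerivInv_I hy, hξ]
      conv_rhs => rw [← Complex.re_add_im c]
      simp only [Complex.real_smul]
      ring
    conv_lhs => rw [← (Module.finBasis ℂ E).sum_repr v]
    rw [map_sum, map_sum]
    exact Finset.sum_congr rfl fun i _ => hc _ _
  ext v
  rw [← chartDerivInv_chartDeriv hy v, key hξ, key hη]
  simp only [h]

theorem T10dual_eq_sum (hy : y ∈ (chartAt E x₀).source) {ξ : CoTC E y} (hξ : ξ ∈ T10dual y) :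
    ξ = ∑ i, ξ (chartDerivInv x₀ y (Module.finBasis ℂ E i)) • (dfun (hcoord x₀ i) y : CoTC E y) := by
  refine T10dual_ext hy hξ
    (Submodule.sum_mem _ fun i _ => Submodule.smul_mem _ _ (dhcoord_mem hy i)) fun i => ?_
  rw [sum_apply, Finset.sum_eq_single i]
  · simp [dhcoord_chartDerivInv hy, coordForm_basis]
  · intro j _ hj
    simp [dhcoord_chartDerivInv hy, coordForm_basis, hj.symm]
  · simp

end Frames

end HolPoisson

end

noncomputable section

namespace HolPoisson

/-! ### Vector bundles: change of frame index, transport and direct sums. -/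

section VectorBundles

variable {E : Type*} [NormedAddCommGroup E] [NormedSpace ℂ E]
variable {X : Type*} [TopologicalSpace X] [ChartedSpace E X]

open LieAlgebroidData

/-- This allows the frame of a direct sum to be indexed by a sum type. -/
theorem LieAlgebroidData.exists_frame_of_fintype {𝒜 : LieAlgebroidData E X} {x : X} {ι : Type*}
    [Fintype ι] {U : Set X} (hU : IsOpen U) (hx : x ∈ U) (e : ι → ∀ y, 𝒜.V y)
    (hb : ∀ y ∈ U, LinearIndependent ℂ (fun i => e i y) ∧
      Submodule.span ℂ (Set.range fun i => e i y) = 𝒜.A y)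
    (hs : ∀ W ⊆ U, IsOpen W → ∀ c : ι → X → ℂ,
      (𝒜.IsSection (fun y => ∑ i, c i y • e i y) W ↔ ∀ i, SmoothFun (E := E) (c i) W)) :
    ∃ (U : Set X) (r : ℕ) (e : Fin r → ∀ y, 𝒜.V y), IsOpen U ∧ x ∈ U ∧
    (∀ y ∈ U, LinearIndependent ℂ (fun i => e i y) ∧
      Submodule.span ℂ (Set.range fun i => e i y) = 𝒜.A y) ∧
    ∀ W ⊆ U, IsOpen W → ∀ c : Fin r → X → ℂ,
      (𝒜.IsSection (fun y => ∑ i, c i y • e i y) W ↔ ∀ i, SmoothFun (E := E) (c i) W) := by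
  let q := Fintype.equivFin ι
  refine ⟨U, Fintype.card ι, fun i => e (q.symm i), hU, hx, fun y hy => ⟨?_, ?_⟩,
    fun W hW hO c => ?_⟩
  · exact (hb y hy).1.comp q.symm q.symm.injective
  · rw [← (hb y hy).2]
    congr 1
    exact q.symm.surjective.range_comp fun i => e i y
  · have h := hs W hW hO fun i => c (q i)
    have h2 : (fun y => ∑ i, c i y • e (q.symm i) y) = fun y => ∑ i, c (q i) y • e i y := by
      funext y
      rw [← q.sum_comp]
      simp
    rw [h2, h]
    exact ⟨fun hc i => by simpa using hc (q.symm i), fun hc i => hc (q i)⟩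

/-- Vector bundles can be transported along fibrewise linear equivalences that preserve the
subspaces and the smooth sections. -/
theorem LieAlgebroidData.IsVectorBundle.of_equiv {𝒜 ℬ : LieAlgebroidData E X} (h𝒜 : 𝒜.IsVectorBundle)
    (φ : ∀ x, 𝒜.V x ≃ₗ[ℂ] ℬ.V x) (hA : ∀ x v, φ x v ∈ ℬ.A x ↔ v ∈ 𝒜.A x)
    (hs : ∀ {U : Set X} {s : ∀ x, 𝒜.V x}, IsOpen U → (∀ x ∈ U, s x ∈ 𝒜.A x) →
      (ℬ.SmoothOn (fun x => φ x (s x)) U ↔ 𝒜.SmoothOn s U)) : ℬ.IsVectorBundle := by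
  have key : ∀ {U : Set X}, IsOpen U → ∀ s : ∀ x, 𝒜.V x,
      ℬ.IsSection (fun x => φ x (s x)) U ↔ 𝒜.IsSection s U := by
    intro U hU s
    simp only [IsSection, hA]
    exact and_congr_left fun h => hs hU h
  have key' : ∀ {U : Set X}, IsOpen U → ∀ t : ∀ x, ℬ.V x,
      ℬ.IsSection t U ↔ 𝒜.IsSection (fun x => (φ x).symm (t x)) U := by
    intro U hU t
    rw [← key hU]
    simp
  refine ⟨?_, ?_, ?_⟩
  · intro U s t hU h hsec
    rw [key' hU] at hsec ⊢
    exact h𝒜.congr hU (fun x hx => by rw [h x hx]) hsec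
  · intro U s hU
    rw [key' hU, h𝒜.localProp hU]
    refine forall₂_congr fun x _ => exists_congr fun W => and_congr_right fun _ =>
      and_congr_right fun hW => and_congr_right fun _ => (key' hW s).symm
  · intro x
    obtain ⟨U, r, e, hU, hx, hb, hc⟩ := h𝒜.exists_frame x
    refine ⟨U, r, fun i y => φ y (e i y), hU, hx, fun y hy => ⟨?_, ?_⟩, fun W hW hO c => ?_⟩
    · exact (hb y hy).1.map' (φ y).toLinearMap (φ y).ker
    · have h1 : (range fun i => φ y (e i y)) = (φ y).toLinearMap '' range fun i => e i y := by
        rw [← range_comp]; rfl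
      rw [h1, Submodule.span_image, (hb y hy).2]
      ext v
      rw [Submodule.mem_map]
      constructor
      · rintro ⟨w, hw, rfl⟩
        exact (hA y w).2 hw
      · intro hv
        refine ⟨(φ y).symm v, (hA y _).1 (by simpa using hv), by simp⟩
    · rw [← hc W hW hO c, ← key hO]
      simp only [map_sum, map_smul]

theorem linearIndependent_sum_elim_prod {ι κ M N : Type*} [AddCommGroup M] [AddCommGroup N]
    [Module ℂ M] [Module ℂ N] [Fintype ι] [Fintype κ] {e : ι → M} {e' : κ → N}
    (h : LinearIndependent ℂ e) (h' : LinearIndependent ℂ e') :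
    LinearIndependent ℂ (Sum.elim (fun i => (e i, (0 : N))) (fun i => ((0 : M), e' i))) := by
  rw [Fintype.linearIndependent_iff] at *
  intro g hg
  rw [Fintype.sum_sum_type] at hg
  have h1 := congrArg Prod.fst hg
  have h2 := congrArg Prod.snd hg
  simp only [Sum.elim_inl, Sum.elim_inr, Prod.smul_mk, smul_zero, Prod.fst_add, Prod.snd_add,
    Prod.fst_sum, Prod.snd_sum, Finset.sum_const_zero, add_zero, zero_add, Prod.fst_zero,
    Prod.snd_zero] at h1 h2
  rintro (i | i)
  · exact h _ h1 i
  · exact h' _ h2 i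

theorem span_range_sum_elim_prod {ι κ M N : Type*} [AddCommGroup M] [AddCommGroup N]
    [Module ℂ M] [Module ℂ N] (e : ι → M) (e' : κ → N) :
    Submodule.span ℂ (range (Sum.elim (fun i => (e i, (0 : N))) (fun i => ((0 : M), e' i))))
      = (Submodule.span ℂ (range e)).prod (Submodule.span ℂ (range e')) := by
  have h1 : (range fun i => (e i, (0 : N))) = LinearMap.inl ℂ M N '' range e := by
    rw [← range_comp]; rfl
  have h2 : (range fun i => ((0 : M), e' i)) = LinearMap.inr ℂ M N '' range e' := by
    rw [← range_comp]; rfl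
  rw [Sum.elim_range, Submodule.span_union, h1, h2, Submodule.span_image, Submodule.span_image,
    ← LinearMap.prod_eq_sup_map]

/-- Frames of the summands are juxtaposed. The bracket plays no role, so nothing is required of
`nabA` and `nabB`. -/
theorem isVectorBundle_bowtie {𝒜 ℬ : LieAlgebroidData E X} (h𝒜 : 𝒜.IsVectorBundle)
    (hℬ : ℬ.IsVectorBundle)
    (nabA : (∀ x, 𝒜.V x) → (∀ x, ℬ.V x) → ∀ x, ℬ.V x)
    (nabB : (∀ x, ℬ.V x) → (∀ x, 𝒜.V x) → ∀ x, 𝒜.V x) :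
    (bowtie 𝒜 ℬ nabA nabB).IsVectorBundle := by
  have key : ∀ {U : Set X} {s : ∀ x, 𝒜.V x × ℬ.V x}, (bowtie 𝒜 ℬ nabA nabB).IsSection s U ↔
      𝒜.IsSection (fun x => (s x).1) U ∧ ℬ.IsSection (fun x => (s x).2) U := by
    intro U s
    constructor
    · intro h
      exact ⟨⟨h.1.1, fun x hx => (h.2 x hx).1⟩, ⟨h.1.2, fun x hx => (h.2 x hx).2⟩⟩
    · intro h
      exact ⟨⟨h.1.1, h.2.1⟩, fun x hx => ⟨h.1.2 x hx, h.2.2 x hx⟩⟩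
  refine ⟨?_, ?_, ?_⟩
  · intro U s t hU h hs
    rw [key (s := s)] at hs
    rw [key (s := t)]
    exact ⟨h𝒜.congr hU (fun x hx => congrArg Prod.fst (h x hx)) hs.1,
      hℬ.congr hU (fun x hx => congrArg Prod.snd (h x hx)) hs.2⟩
  · intro U s hU
    constructor
    · intro h x hx
      exact ⟨U, Subset.rfl, hU, hx, h⟩
    · intro h
      rw [key (s := s), h𝒜.localProp hU, hℬ.localProp hU]
      refine ⟨fun x hx => ?_, fun x hx => ?_⟩
      · obtain ⟨W, hW, hO, hxW, hs⟩ := h x hx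
        exact ⟨W, hW, hO, hxW, (key.1 hs).1⟩
      · obtain ⟨W, hW, hO, hxW, hs⟩ := h x hx
        exact ⟨W, hW, hO, hxW, (key.1 hs).2⟩
  · intro x
    obtain ⟨U, r, e, hU, hxU, hb, hc⟩ := h𝒜.exists_frame x
    obtain ⟨U', r', e', hU', hxU', hb', hc'⟩ := hℬ.exists_frame x
    let e'' : Fin r ⊕ Fin r' → ∀ y, 𝒜.V y × ℬ.V y :=
      Sum.elim (fun i y => (e i y, 0)) (fun i y => (0, e' i y))
    have hsum : ∀ (c : Fin r ⊕ Fin r' → X → ℂ) (y : X), ∑ i, c i y • e'' i y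
        = (∑ i, c (Sum.inl i) y • e i y, ∑ i, c (Sum.inr i) y • e' i y) := by
      intro c y
      rw [Fintype.sum_sum_type]
      simp only [e'', Sum.elim_inl, Sum.elim_inr, Prod.smul_mk, smul_zero]
      refine Prod.ext ?_ ?_
      · simp [Prod.fst_sum]
      · simp [Prod.snd_sum]
    have he'' : ∀ y, (fun i => e'' i y)
        = Sum.elim (fun i => (e i y, (0 : ℬ.V y))) (fun i => ((0 : 𝒜.V y), e' i y)) := by
      intro y
      funext i
      cases i <;> rfl
    refine exists_frame_of_fintype (𝒜 := bowtie 𝒜 ℬ nabA nabB) (hU.inter hU') ⟨hxU, hxU'⟩ e''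
      (fun y hy => ⟨?_, ?_⟩) fun W hW hO c => ?_
    · have h := linearIndependent_sum_elim_prod (hb y hy.1).1 (hb' y hy.2).1
      rw [← he'' y] at h
      exact h
    · have h := span_range_sum_elim_prod (fun i => e i y) (fun i => e' i y)
      rw [(hb y hy.1).2, (hb' y hy.2).2, ← he'' y] at h
      exact h
    · have h1 : (fun y => ∑ i, c i y • e'' i y) = fun y =>
          (∑ i, c (Sum.inl i) y • e i y, ∑ i, c (Sum.inr i) y • e' i y) := funext (hsum c)
      erw [h1]
      rw [key, hc W (hW.trans inter_subset_left) hO, hc' W (hW.trans inter_subset_right) hO]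
      exact (Sum.forall (p := fun i => SmoothFun (E := E) (c i) W)).symm

end VectorBundles

end HolPoisson

end

noncomputable section

namespace HolPoisson

/-! ### Lie algebroid axioms: transfer along isomorphisms and first consequences. -/

section Transfer

variable {E : Type*} [NormedAddCommGroup E] [NormedSpace ℂ E]
variable {X : Type*} [TopologicalSpace X] [ChartedSpace E X]
variable [IsManifold 𝓘(ℂ, E) ω X]

open LieAlgebroidData

/-- The Lie algebroid axioms can be pulled back along an isomorphism. -/
theorem IsLieAlgebroidIso.isLieAlgebroid {𝒜 ℬ : LieAlgebroidData E X}
    {φ : ∀ x, 𝒜.V x →ₗ[ℂ] ℬ.V x} (hφ : IsLieAlgebroidIso 𝒜 ℬ φ) (hℬ : ℬ.IsLieAlgebroid)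
    (h𝒜 : 𝒜.IsVectorBundle)
    (hadd : ∀ {U : Set X} {s t}, IsOpen U → 𝒜.IsSection s U → 𝒜.IsSection t U →
      𝒜.IsSection (s + t) U)
    (hsmul : ∀ {U : Set X} {s} {f : X → ℂ}, IsOpen U → SmoothFun (E := E) f U →
      𝒜.IsSection s U → 𝒜.IsSection (fun y => f y • s y) U)
    (hbr : ∀ {U : Set X} {s t}, IsOpen U → 𝒜.IsSection s U → 𝒜.IsSection t U →
      ∀ x ∈ U, 𝒜.bracket s t x ∈ 𝒜.A x) : 𝒜.IsLieAlgebroid := by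
  have sec : ∀ {U : Set X} {s}, IsOpen U → 𝒜.IsSection s U →
      ℬ.IsSection (fun y => φ y (s y)) U := fun hU hs =>
    ⟨(hφ.smooth_iff hU hs.2).1 hs.1, fun x hx => (hφ.bijOn x).mapsTo (hs.2 x hx)⟩
  have mem : ∀ {U : Set X} {s t}, IsOpen U → 𝒜.IsSection s U → 𝒜.IsSection t U →
      𝒜.IsSection (𝒜.bracket s t) U := by
    intro U s t hU hs ht
    -- Smoothness of the bracket is seen on the image, where it is a bracket of sections of `ℬ`.
    refine ⟨(hφ.smooth_iff hU (hbr hU hs ht)).2 ?_, hbr hU hs ht⟩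
    exact (hℬ.vectorBundle.congr hU (fun x hx => (hφ.map_bracket hU hs ht x hx).symm)
      (hℬ.bracket_mem hU (sec hU hs) (sec hU ht))).1
  -- The bracket identities hold between elements of `𝒜.A x`, on which `φ x` is injective, so they
  -- may be checked after applying `φ`.
  have inj : ∀ {x v w}, v ∈ 𝒜.A x → w ∈ 𝒜.A x → φ x v = φ x w → v = w :=
    fun hv hw h => (hφ.bijOn _).injOn hv hw h
  have anc : ∀ {U : Set X} {s}, 𝒜.IsSection s U → ∀ x ∈ U,
      ℬ.anchorVF (fun y => φ y (s y)) x = 𝒜.anchorVF s x :=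
    fun hs x hx => hφ.anchor_comp x _ (hs.2 x hx)
  have add3 : ∀ {x} {a b : 𝒜.V x}, a ∈ 𝒜.A x → b ∈ 𝒜.A x → a + b ∈ 𝒜.A x :=
    fun ha hb => (𝒜.A _).add_mem ha hb
  refine ⟨h𝒜, ?_, mem, ?_, ?_, ?_, ?_, ?_, ?_⟩
  · intro U s hU hs
    exact (hℬ.anchor_smooth hU (sec hU hs)).congr fun x hx => (anc hs x hx).symm
  · intro U s s' t t' hU hs ht hss htt x hx
    have hs' := h𝒜.congr hU hss hs
    have ht' := h𝒜.congr hU htt ht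
    apply inj (hbr hU hs ht x hx) (hbr hU hs' ht' x hx)
    rw [hφ.map_bracket hU hs ht x hx, hφ.map_bracket hU hs' ht' x hx]
    exact hℬ.bracket_congr hU (sec hU hs) (sec hU ht) (fun y hy => by rw [hss y hy])
      (fun y hy => by rw [htt y hy]) x hx
  · intro U s t u hU hs ht hu x hx
    have htu := hadd hU ht hu
    apply inj (hbr hU hs htu x hx) (add3 (hbr hU hs ht x hx) (hbr hU hs hu x hx))
    rw [map_add, hφ.map_bracket hU hs ht x hx, hφ.map_bracket hU hs hu x hx,
      hφ.map_bracket hU hs htu x hx, ← hℬ.bracket_add hU (sec hU hs) (sec hU ht) (sec hU hu) x hx]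
    congr 1
    funext y
    exact map_add _ _ _
  · intro U s t hU hs ht x hx
    apply inj (hbr hU hs ht x hx) ((𝒜.A x).neg_mem (hbr hU ht hs x hx))
    rw [map_neg, hφ.map_bracket hU hs ht x hx, hφ.map_bracket hU ht hs x hx]
    exact hℬ.bracket_skew hU (sec hU hs) (sec hU ht) x hx
  · intro U s t f hU hs ht hf x hx
    have hft := hsmul hU hf ht
    apply inj (hbr hU hs hft x hx) (add3 ((𝒜.A x).smul_mem _ (ht.2 x hx))
      ((𝒜.A x).smul_mem _ (hbr hU hs ht x hx)))
    rw [map_add, map_smul, map_smul, hφ.map_bracket hU hs hft x hx, hφ.map_bracket hU hs ht x hx]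
    have h := hℬ.leibniz hU (sec hU hs) (sec hU ht) hf x hx
    have h1 : ℬ.act (fun y => φ y (s y)) f x = 𝒜.act s f x :=
      congrArg (pair (dfun f x)) (anc hs x hx)
    rw [h1] at h
    rw [← h]
    congr 1
    funext y
    exact map_smul _ _ _
  · intro U s t u hU hs ht hu x hx
    have jac : ∀ {s t u}, 𝒜.IsSection s U → 𝒜.IsSection t U → 𝒜.IsSection u U →
        φ x (𝒜.bracket s (𝒜.bracket t u) x) = ℬ.bracket (fun y => φ y (s y))
          (ℬ.bracket (fun y => φ y (t y)) (fun y => φ y (u y))) x := by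
      intro s t u hs ht hu
      rw [hφ.map_bracket hU hs (mem hU ht hu) x hx]
      exact hℬ.bracket_congr hU (sec hU hs) (sec hU (mem hU ht hu)) (fun _ _ => rfl)
        (hφ.map_bracket hU ht hu) x hx
    apply inj (add3 (add3 (hbr hU hs (mem hU ht hu) x hx) (hbr hU ht (mem hU hu hs) x hx))
      (hbr hU hu (mem hU hs ht) x hx)) (𝒜.A x).zero_mem
    rw [map_add, map_add, map_zero, jac hs ht hu, jac ht hu hs, jac hu hs ht]
    exact hℬ.jacobi hU (sec hU hs) (sec hU ht) (sec hU hu) x hx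
  · intro U s t hU hs ht x hx
    rw [← hφ.anchor_comp x _ (hbr hU hs ht x hx), hφ.map_bracket hU hs ht x hx,
      hℬ.anchor_bracket hU (sec hU hs) (sec hU ht) x hx]
    exact lieBr_congr hU hx (anc hs) (anc ht)

/-- This is the Leibniz rule for the constant function `-1`, which the anchor annihilates. -/
theorem LieAlgebroidData.IsLieAlgebroid.bracket_neg {𝒜 : LieAlgebroidData E X} (h : 𝒜.IsLieAlgebroid) {U : Set X}
    {s t} (hU : IsOpen U) (hs : 𝒜.IsSection s U) (ht : 𝒜.IsSection t U) {x : X} (hx : x ∈ U) :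
    𝒜.bracket s (-t) x = -𝒜.bracket s t x := by
  have h1 := h.leibniz hU hs ht (smoothFun_const (-1)) x hx
  have h2 : 𝒜.act s (fun _ => (-1 : ℂ)) x = 0 := vfAct_const (Z := 𝒜.anchorVF s) (-1)
  rw [h2, zero_smul, zero_add, neg_one_smul] at h1
  rw [← h1]
  congr 1
  funext y
  simp

/-- The derivation form of the Jacobi identity is the one from which flatness and the compatibility
conditions of a matched pair are read off. -/
theorem LieAlgebroidData.IsLieAlgebroid.bracket_leibniz {𝒜 : LieAlgebroidData E X} (h : 𝒜.IsLieAlgebroid)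
    {U : Set X} {s t u} (hU : IsOpen U) (hs : 𝒜.IsSection s U) (ht : 𝒜.IsSection t U)
    (hu : 𝒜.IsSection u U) {x : X} (hx : x ∈ U) :
    𝒜.bracket s (𝒜.bracket t u) x
      = 𝒜.bracket (𝒜.bracket s t) u x + 𝒜.bracket t (𝒜.bracket s u) x := by
  have h1 := h.jacobi hU hs ht hu x hx
  have h2 := h.bracket_skew hU hu (h.bracket_mem hU hs ht) x hx
  have h3 : 𝒜.bracket t (𝒜.bracket u s) x = -𝒜.bracket t (𝒜.bracket s u) x := by
    rw [← h.bracket_neg hU ht (h.bracket_mem hU hs hu) hx]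
    exact h.bracket_congr hU ht (h.bracket_mem hU hu hs) (fun _ _ => rfl)
      (fun y hy => h.bracket_skew hU hu hs y hy) x hx
  rw [h2, h3] at h1
  have h4 := add_eq_zero_iff_eq_neg.1 h1
  rw [neg_neg] at h4
  rw [← h4]
  abel

end Transfer

end HolPoisson

end

noncomputable section

namespace HolPoisson

/-! ### The bracket of `A ⋈ B` on the sections `(s, 0)` and `(0, t)`. -/

section MatchedPairs

variable {E : Type*} [NormedAddCommGroup E] [NormedSpace ℂ E]
variable {X : Type*} [TopologicalSpace X] [ChartedSpace E X]

open LieAlgebroidData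

/-- The section `(s, 0)` of `A ⊕ B`. -/
def inlSec {𝒜 ℬ : LieAlgebroidData E X} (s : ∀ x, 𝒜.V x) (x : X) : 𝒜.V x × ℬ.V x := (s x, 0)

/-- The section `(0, t)` of `A ⊕ B`. -/
def inrSec {𝒜 ℬ : LieAlgebroidData E X} (t : ∀ x, ℬ.V x) (x : X) : 𝒜.V x × ℬ.V x := (0, t x)

/-- The operations of `𝒜` and `ℬ` vanish on the zero section, which is smooth. -/
structure ZeroCompat (𝒜 ℬ : LieAlgebroidData E X)
    (nabA : (∀ x, 𝒜.V x) → (∀ x, ℬ.V x) → ∀ x, ℬ.V x)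
    (nabB : (∀ x, ℬ.V x) → (∀ x, 𝒜.V x) → ∀ x, 𝒜.V x) : Prop where
  smoothA : ∀ {U : Set X}, IsOpen U → 𝒜.SmoothOn (fun _ => 0) U
  smoothB : ∀ {U : Set X}, IsOpen U → ℬ.SmoothOn (fun _ => 0) U
  bracketA_left : ∀ s, 𝒜.bracket (fun _ => 0) s = fun _ => 0
  bracketA_right : ∀ s, 𝒜.bracket s (fun _ => 0) = fun _ => 0
  bracketB_left : ∀ t, ℬ.bracket (fun _ => 0) t = fun _ => 0
  bracketB_right : ∀ t, ℬ.bracket t (fun _ => 0) = fun _ => 0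
  nabA_left : ∀ t, nabA (fun _ => 0) t = fun _ => 0
  nabA_right : ∀ s, nabA s (fun _ => 0) = fun _ => 0
  nabB_left : ∀ s, nabB (fun _ => 0) s = fun _ => 0
  nabB_right : ∀ t, nabB t (fun _ => 0) = fun _ => 0

variable {𝒜 ℬ : LieAlgebroidData E X}
variable {nabA : (∀ x, 𝒜.V x) → (∀ x, ℬ.V x) → ∀ x, ℬ.V x}
variable {nabB : (∀ x, ℬ.V x) → (∀ x, 𝒜.V x) → ∀ x, 𝒜.V x}


namespace ZeroCompat

theorem bracket_inl (h0 : ZeroCompat 𝒜 ℬ nabA nabB) (s : ∀ x, 𝒜.V x) (t : ∀ x, 𝒜.V x × ℬ.V x) :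
    (bowtie 𝒜 ℬ nabA nabB).bracket (inlSec s) t
      = fun x => (𝒜.bracket s (fun y => (t y).1) x - nabB (fun y => (t y).2) s x,
          nabA s (fun y => (t y).2) x) := by
  funext x
  refine Prod.ext ?_ ?_
  · change 𝒜.bracket s (fun y => (t y).1) x + nabB (fun _ => 0) (fun y => (t y).1) x
      - nabB (fun y => (t y).2) s x = _
    rw [h0.nabB_left, add_zero]
  · change ℬ.bracket (fun _ => 0) (fun y => (t y).2) x + nabA s (fun y => (t y).2) x
      - nabA (fun y => (t y).1) (fun _ => 0) x = _
    rw [h0.nabA_right, h0.bracketB_left, sub_zero, zero_add]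

theorem bracket_inr (h0 : ZeroCompat 𝒜 ℬ nabA nabB) (s : ∀ x, ℬ.V x) (t : ∀ x, 𝒜.V x × ℬ.V x) :
    (bowtie 𝒜 ℬ nabA nabB).bracket (inrSec s) t
      = fun x => (nabB s (fun y => (t y).1) x,
          ℬ.bracket s (fun y => (t y).2) x - nabA (fun y => (t y).1) s x) := by
  funext x
  refine Prod.ext ?_ ?_
  · change 𝒜.bracket (fun _ => 0) (fun y => (t y).1) x + nabB s (fun y => (t y).1) x
      - nabB (fun y => (t y).2) (fun _ => 0) x = _
    rw [h0.nabB_right, h0.bracketA_left, sub_zero, zero_add]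
  · change ℬ.bracket s (fun y => (t y).2) x + nabA (fun _ => 0) (fun y => (t y).2) x
      - nabA (fun y => (t y).1) s x = _
    rw [h0.nabA_left, add_zero]

theorem bracket_inl_right (h0 : ZeroCompat 𝒜 ℬ nabA nabB) (s : ∀ x, 𝒜.V x × ℬ.V x)
    (t : ∀ x, 𝒜.V x) :
    (bowtie 𝒜 ℬ nabA nabB).bracket s (inlSec t)
      = fun x => (𝒜.bracket (fun y => (s y).1) t x + nabB (fun y => (s y).2) t x,
          -nabA t (fun y => (s y).2) x) := by
  funext x
  refine Prod.ext ?_ ?_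
  · change 𝒜.bracket (fun y => (s y).1) t x + nabB (fun y => (s y).2) t x
      - nabB (fun _ => 0) (fun y => (s y).1) x = _
    rw [h0.nabB_left, sub_zero]
  · change ℬ.bracket (fun y => (s y).2) (fun _ => 0) x + nabA (fun y => (s y).1) (fun _ => 0) x
      - nabA t (fun y => (s y).2) x = _
    rw [h0.nabA_right, h0.bracketB_right, zero_add, zero_sub]

theorem bracket_inr_right (h0 : ZeroCompat 𝒜 ℬ nabA nabB) (s : ∀ x, 𝒜.V x × ℬ.V x)
    (t : ∀ x, ℬ.V x) :
    (bowtie 𝒜 ℬ nabA nabB).bracket s (inrSec t)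
      = fun x => (-nabB t (fun y => (s y).1) x,
          ℬ.bracket (fun y => (s y).2) t x + nabA (fun y => (s y).1) t x) := by
  funext x
  refine Prod.ext ?_ ?_
  · change 𝒜.bracket (fun y => (s y).1) (fun _ => 0) x + nabB (fun y => (s y).2) (fun _ => 0) x
      - nabB t (fun y => (s y).1) x = _
    rw [h0.nabB_right, h0.bracketA_right, zero_add, zero_sub]
  · change ℬ.bracket (fun y => (s y).2) t x + nabA (fun y => (s y).1) t x
      - nabA (fun _ => 0) (fun y => (s y).2) x = _
    rw [h0.nabA_left, sub_zero]

theorem bracket_inl_inl (h0 : ZeroCompat 𝒜 ℬ nabA nabB) (s t : ∀ x, 𝒜.V x) :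
    (bowtie 𝒜 ℬ nabA nabB).bracket (inlSec s) (inlSec t) = inlSec (𝒜.bracket s t) := by
  rw [h0.bracket_inl]
  funext x
  refine Prod.ext ?_ ?_
  · change 𝒜.bracket s t x - nabB (fun _ => 0) s x = 𝒜.bracket s t x
    rw [h0.nabB_left, sub_zero]
  · change nabA s (fun _ => 0) x = 0
    rw [h0.nabA_right]

theorem bracket_inr_inr (h0 : ZeroCompat 𝒜 ℬ nabA nabB) (s t : ∀ x, ℬ.V x) :
    (bowtie 𝒜 ℬ nabA nabB).bracket (inrSec s) (inrSec t) = inrSec (ℬ.bracket s t) := by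
  rw [h0.bracket_inr]
  funext x
  refine Prod.ext ?_ ?_
  · change nabB s (fun _ => 0) x = 0
    rw [h0.nabB_right]
  · change ℬ.bracket s t x - nabA (fun _ => 0) s x = ℬ.bracket s t x
    rw [h0.nabA_left, sub_zero]

/-- A mixed bracket carries both representations, one in each component. Each axiom of a matched
pair is therefore a component of an axiom of `A ⋈ B`. -/
theorem bracket_inl_inr (h0 : ZeroCompat 𝒜 ℬ nabA nabB) (s : ∀ x, 𝒜.V x) (t : ∀ x, ℬ.V x) :
    (bowtie 𝒜 ℬ nabA nabB).bracket (inlSec s) (inrSec t)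
      = fun x => (-nabB t s x, nabA s t x) := by
  rw [h0.bracket_inl]
  funext x
  refine Prod.ext ?_ rfl
  change 𝒜.bracket s (fun _ => 0) x - nabB t s x = -nabB t s x
  rw [h0.bracketA_right, zero_sub]

theorem bracket_inr_inl (h0 : ZeroCompat 𝒜 ℬ nabA nabB) (t : ∀ x, ℬ.V x) (s : ∀ x, 𝒜.V x) :
    (bowtie 𝒜 ℬ nabA nabB).bracket (inrSec t) (inlSec s)
      = fun x => (nabB t s x, -nabA s t x) := by
  rw [h0.bracket_inr]
  funext x
  refine Prod.ext rfl ?_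
  change ℬ.bracket t (fun _ => 0) x - nabA s t x = -nabA s t x
  rw [h0.bracketB_right, zero_sub]

theorem isSection_inl (h0 : ZeroCompat 𝒜 ℬ nabA nabB) {U : Set X} (hU : IsOpen U)
    {s : ∀ x, 𝒜.V x} (hs : 𝒜.IsSection s U) :
    (bowtie 𝒜 ℬ nabA nabB).IsSection (inlSec s) U :=
  ⟨⟨hs.1, h0.smoothB hU⟩, fun x hx => ⟨hs.2 x hx, (ℬ.A x).zero_mem⟩⟩

theorem isSection_inr (h0 : ZeroCompat 𝒜 ℬ nabA nabB) {U : Set X} (hU : IsOpen U)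
    {t : ∀ x, ℬ.V x} (ht : ℬ.IsSection t U) :
    (bowtie 𝒜 ℬ nabA nabB).IsSection (inrSec t) U :=
  ⟨⟨h0.smoothA hU, ht.1⟩, fun x hx => ⟨(𝒜.A x).zero_mem, ht.2 x hx⟩⟩

end ZeroCompat

theorem bowtie_isSection_fst {U : Set X} {s : ∀ x, 𝒜.V x × ℬ.V x}
    (h : (bowtie 𝒜 ℬ nabA nabB).IsSection s U) : 𝒜.IsSection (fun x => (s x).1) U :=
  ⟨h.1.1, fun x hx => (h.2 x hx).1⟩

theorem bowtie_isSection_snd {U : Set X} {s : ∀ x, 𝒜.V x × ℬ.V x}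
    (h : (bowtie 𝒜 ℬ nabA nabB).IsSection s U) : ℬ.IsSection (fun x => (s x).2) U :=
  ⟨h.1.2, fun x hx => (h.2 x hx).2⟩

theorem bowtie_anchor_inl (s : ∀ x, 𝒜.V x) :
    (bowtie 𝒜 ℬ nabA nabB).anchorVF (inlSec s) = 𝒜.anchorVF s := by
  funext x
  change 𝒜.anchor x (s x) + ℬ.anchor x 0 = 𝒜.anchor x (s x)
  rw [map_zero, add_zero]

theorem bowtie_anchor_inr (t : ∀ x, ℬ.V x) :
    (bowtie 𝒜 ℬ nabA nabB).anchorVF (inrSec t) = ℬ.anchorVF t := by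
  funext x
  change 𝒜.anchor x 0 + ℬ.anchor x (t x) = ℬ.anchor x (t x)
  rw [map_zero, zero_add]

theorem bowtie_act_inl (s : ∀ x, 𝒜.V x) (f : X → ℂ) :
    (bowtie 𝒜 ℬ nabA nabB).act (inlSec s) f = 𝒜.act s f :=
  funext fun x => congrArg (pair (dfun f x)) (congrFun (bowtie_anchor_inl s) x)

theorem bowtie_act_inr (t : ∀ x, ℬ.V x) (f : X → ℂ) :
    (bowtie 𝒜 ℬ nabA nabB).act (inrSec t) f = ℬ.act t f :=
  funext fun x => congrArg (pair (dfun f x)) (congrFun (bowtie_anchor_inr t) x)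

theorem inlSec_add (s s' : ∀ x, 𝒜.V x) :
    inlSec (ℬ := ℬ) (s + s') = (inlSec s + inlSec s' : ∀ x, 𝒜.V x × ℬ.V x) := by
  funext x
  exact Prod.ext rfl (zero_add (0 : ℬ.V x)).symm

theorem inrSec_add (t t' : ∀ x, ℬ.V x) :
    inrSec (𝒜 := 𝒜) (t + t') = (inrSec t + inrSec t' : ∀ x, 𝒜.V x × ℬ.V x) := by
  funext x
  exact Prod.ext (zero_add (0 : 𝒜.V x)).symm rfl

theorem inlSec_smul (f : X → ℂ) (s : ∀ x, 𝒜.V x) :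
    inlSec (ℬ := ℬ) (fun y => f y • s y) = fun y => f y • inlSec s y := by
  funext x
  exact Prod.ext rfl (smul_zero (A := ℬ.V x) (f x)).symm

theorem inrSec_smul (f : X → ℂ) (t : ∀ x, ℬ.V x) :
    inrSec (𝒜 := 𝒜) (fun y => f y • t y) = fun y => f y • inrSec t y := by
  funext x
  exact Prod.ext (smul_zero (A := 𝒜.V x) (f x)).symm rfl

theorem IsRepresentation.neg_left {nab : (∀ x, 𝒜.V x) → (∀ x, ℬ.V x) → ∀ x, ℬ.V x}
    (h : IsRepresentation 𝒜 ℬ nab) {U : Set X} {s t} (hU : IsOpen U) (hs : 𝒜.IsSection s U)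
    (ht : ℬ.IsSection t U) {x : X} (hx : x ∈ U) :
    nab (fun y => -s y) t x = -nab s t x := by
  have h1 := h.smul_left hU hs ht (smoothFun_const (-1)) x hx
  rw [neg_one_smul] at h1
  rw [← h1]
  congr 1
  funext y
  exact (neg_one_smul ℂ (s y)).symm

end MatchedPairs

end HolPoisson

end

noncomputable section

namespace HolPoisson

/-! ### A matched pair recovered from the Lie algebroid `A ⋈ B`. -/

section MatchedPairs

variable {E : Type*} [NormedAddCommGroup E] [NormedSpace ℂ E]
variable {X : Type*} [TopologicalSpace X] [ChartedSpace E X] [IsManifold 𝓘(ℂ, E) ω X]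

open LieAlgebroidData

variable {𝒜 ℬ : LieAlgebroidData E X}
variable {nabA : (∀ x, 𝒜.V x) → (∀ x, ℬ.V x) → ∀ x, ℬ.V x}
variable {nabB : (∀ x, ℬ.V x) → (∀ x, 𝒜.V x) → ∀ x, 𝒜.V x}

namespace ZeroCompat

/-- `s ↦ (s, 0)` is compatible with anchors and brackets, so each bracket axiom is the first
component of the same axiom for `A ⋈ B`. -/
theorem isLieAlgebroid_left (h0 : ZeroCompat 𝒜 ℬ nabA nabB) (h𝒜 : 𝒜.IsVectorBundle)
    (h : (bowtie 𝒜 ℬ nabA nabB).IsLieAlgebroid) : 𝒜.IsLieAlgebroid := by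
  have hbr := h0.bracket_inl_inl
  have sec : ∀ {U : Set X} {s}, IsOpen U → 𝒜.IsSection s U →
    (bowtie 𝒜 ℬ nabA nabB).IsSection (inlSec s) U := fun hU hs => h0.isSection_inl hU hs
  have fst : ∀ {x} {v w : 𝒜.V x × ℬ.V x}, v = w → v.1 = w.1 := fun h => congrArg Prod.fst h
  refine ⟨h𝒜, ?_, ?_, ?_, ?_, ?_, ?_, ?_, ?_⟩
  · intro U s hU hs
    have := h.anchor_smooth hU (sec hU hs)
    rwa [bowtie_anchor_inl] at this
  · intro U s t hU hs ht
    have := h.bracket_mem hU (sec hU hs) (sec hU ht)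
    rw [hbr] at this
    exact bowtie_isSection_fst this
  · intro U s s' t t' hU hs ht hss htt x hx
    have := h.bracket_congr (s' := inlSec s') (t' := inlSec t') hU (sec hU hs) (sec hU ht)
      (fun y hy => Prod.ext (hss y hy) rfl) (fun y hy => Prod.ext (htt y hy) rfl) x hx
    rw [hbr, hbr] at this
    exact fst this
  · intro U s t u hU hs ht hu x hx
    have := h.bracket_add hU (sec hU hs) (sec hU ht) (sec hU hu) x hx
    erw [← inlSec_add] at this
    rw [hbr, hbr, hbr] at this
    exact fst this
  · intro U s t hU hs ht x hx
    have := h.bracket_skew hU (sec hU hs) (sec hU ht) x hx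
    rw [hbr, hbr] at this
    exact fst this
  · intro U s t f hU hs ht hf x hx
    have := h.leibniz hU (sec hU hs) (sec hU ht) hf x hx
    erw [← inlSec_smul] at this
    rw [hbr, hbr, bowtie_act_inl] at this
    exact fst this
  · intro U s t u hU hs ht hu x hx
    have := h.jacobi hU (sec hU hs) (sec hU ht) (sec hU hu) x hx
    rw [hbr, hbr, hbr, hbr, hbr, hbr] at this
    exact fst this
  · intro U s t hU hs ht x hx
    have := h.anchor_bracket hU (sec hU hs) (sec hU ht) x hx
    rw [hbr, bowtie_anchor_inl, bowtie_anchor_inl] at this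
    rw [← this]
    exact (congrFun (bowtie_anchor_inl (𝒜.bracket s t)) x).symm

theorem isLieAlgebroid_right (h0 : ZeroCompat 𝒜 ℬ nabA nabB) (hℬ : ℬ.IsVectorBundle)
    (h : (bowtie 𝒜 ℬ nabA nabB).IsLieAlgebroid) : ℬ.IsLieAlgebroid := by
  have hbr := h0.bracket_inr_inr
  have sec : ∀ {U : Set X} {s}, IsOpen U → ℬ.IsSection s U →
    (bowtie 𝒜 ℬ nabA nabB).IsSection (inrSec s) U := fun hU hs => h0.isSection_inr hU hs
  have snd : ∀ {x} {v w : 𝒜.V x × ℬ.V x}, v = w → v.2 = w.2 := fun h => congrArg Prod.snd h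
  refine ⟨hℬ, ?_, ?_, ?_, ?_, ?_, ?_, ?_, ?_⟩
  · intro U s hU hs
    have := h.anchor_smooth hU (sec hU hs)
    rwa [bowtie_anchor_inr] at this
  · intro U s t hU hs ht
    have := h.bracket_mem hU (sec hU hs) (sec hU ht)
    rw [hbr] at this
    exact bowtie_isSection_snd this
  · intro U s s' t t' hU hs ht hss htt x hx
    have := h.bracket_congr (s' := inrSec s') (t' := inrSec t') hU (sec hU hs) (sec hU ht)
      (fun y hy => Prod.ext rfl (hss y hy)) (fun y hy => Prod.ext rfl (htt y hy)) x hx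
    rw [hbr, hbr] at this
    exact snd this
  · intro U s t u hU hs ht hu x hx
    have := h.bracket_add hU (sec hU hs) (sec hU ht) (sec hU hu) x hx
    erw [← inrSec_add] at this
    rw [hbr, hbr, hbr] at this
    exact snd this
  · intro U s t hU hs ht x hx
    have := h.bracket_skew hU (sec hU hs) (sec hU ht) x hx
    rw [hbr, hbr] at this
    exact snd this
  · intro U s t f hU hs ht hf x hx
    have := h.leibniz hU (sec hU hs) (sec hU ht) hf x hx
    erw [← inrSec_smul] at this
    rw [hbr, hbr, bowtie_act_inr] at this
    exact snd this
  · intro U s t u hU hs ht hu x hx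
    have := h.jacobi hU (sec hU hs) (sec hU ht) (sec hU hu) x hx
    rw [hbr, hbr, hbr, hbr, hbr, hbr] at this
    exact snd this
  · intro U s t hU hs ht x hx
    have := h.anchor_bracket hU (sec hU hs) (sec hU ht) x hx
    rw [hbr, bowtie_anchor_inr, bowtie_anchor_inr] at this
    rw [← this]
    exact (congrFun (bowtie_anchor_inr (ℬ.bracket s t)) x).symm

/-- These are second components of axioms of `A ⋈ B` for `(s, 0)` and `(0, t)`. Rules in the
argument `s` use `(0, t)` as left entry of the bracket; flatness is the Jacobi identity for `(s,
0)`, `(s', 0)`, `(0, t)`. -/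
theorem isRepresentation_left (h0 : ZeroCompat 𝒜 ℬ nabA nabB)
    (h : (bowtie 𝒜 ℬ nabA nabB).IsLieAlgebroid) : IsRepresentation 𝒜 ℬ nabA := by
  have snd : ∀ {x} {v w : 𝒜.V x × ℬ.V x}, v = w → v.2 = w.2 := fun h => congrArg Prod.snd h
  refine ⟨?_, ?_, ?_, ?_, ?_, ?_, ?_⟩
  · intro U s t hU hs ht
    have := h.bracket_mem hU (h0.isSection_inl hU hs) (h0.isSection_inr hU ht)
    rw [h0.bracket_inl_inr] at this
    exact bowtie_isSection_snd this
  · intro U s s' t t' hU hs ht hss htt x hx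
    have := h.bracket_congr (s' := inlSec s') (t' := inrSec t') hU (h0.isSection_inl hU hs)
      (h0.isSection_inr hU ht)
      (fun y hy => Prod.ext (hss y hy) rfl) (fun y hy => Prod.ext rfl (htt y hy)) x hx
    rw [h0.bracket_inl_inr, h0.bracket_inl_inr] at this
    exact snd this
  · intro U s s' t hU hs hs' ht x hx
    have := h.bracket_add hU (h0.isSection_inr hU ht) (h0.isSection_inl hU hs)
      (h0.isSection_inl hU hs') x hx
    erw [← inlSec_add] at this
    rw [h0.bracket_inr_inl, h0.bracket_inr_inl, h0.bracket_inr_inl] at this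
    have h2 : -nabA (s + s') t x = -nabA s t x + -nabA s' t x := snd this
    rw [← neg_add] at h2
    exact neg_injective h2
  · intro U s t t' hU hs ht ht' x hx
    have := h.bracket_add hU (h0.isSection_inl hU hs) (h0.isSection_inr hU ht)
      (h0.isSection_inr hU ht') x hx
    erw [← inrSec_add] at this
    rw [h0.bracket_inl_inr, h0.bracket_inl_inr, h0.bracket_inl_inr] at this
    exact snd this
  · intro U s t f hU hs ht hf x hx
    have := h.leibniz hU (h0.isSection_inr hU ht) (h0.isSection_inl hU hs) hf x hx
    erw [← inlSec_smul] at this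
    rw [h0.bracket_inr_inl, h0.bracket_inr_inl] at this
    -- The derivative of `f` multiplies `(s, 0)`, whose second component is zero. This is why `nabA`
    -- is linear over functions in `s`.
    have h2 : -nabA (fun y => f y • s y) t x
      = (bowtie 𝒜 ℬ nabA nabB).act (inrSec t) f x • (0 : ℬ.V x) + f x • -nabA s t x := snd this
    rw [smul_zero, zero_add, smul_neg] at h2
    exact neg_injective h2
  · intro U s t f hU hs ht hf x hx
    have := h.leibniz hU (h0.isSection_inl hU hs) (h0.isSection_inr hU ht) hf x hx
    erw [← inrSec_smul] at this
    rw [h0.bracket_inl_inr, h0.bracket_inl_inr, bowtie_act_inl] at this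
    exact snd this
  · intro U s s' t hU hs hs' ht x hx
    have := h.bracket_leibniz hU (h0.isSection_inl hU hs) (h0.isSection_inl hU hs')
      (h0.isSection_inr hU ht) hx
    rw [h0.bracket_inl_inl, h0.bracket_inl_inr, h0.bracket_inl_inr, h0.bracket_inl_inr,
      h0.bracket_inl, h0.bracket_inl] at this
    exact eq_sub_of_add_eq (snd this).symm

theorem isRepresentation_right (h0 : ZeroCompat 𝒜 ℬ nabA nabB)
    (h : (bowtie 𝒜 ℬ nabA nabB).IsLieAlgebroid) : IsRepresentation ℬ 𝒜 nabB := by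
  have fst : ∀ {x} {v w : 𝒜.V x × ℬ.V x}, v = w → v.1 = w.1 := fun h => congrArg Prod.fst h
  refine ⟨?_, ?_, ?_, ?_, ?_, ?_, ?_⟩
  · intro U s t hU hs ht
    have := h.bracket_mem hU (h0.isSection_inr hU hs) (h0.isSection_inl hU ht)
    rw [h0.bracket_inr_inl] at this
    exact bowtie_isSection_fst this
  · intro U s s' t t' hU hs ht hss htt x hx
    have := h.bracket_congr (s' := inrSec s') (t' := inlSec t') hU (h0.isSection_inr hU hs)
      (h0.isSection_inl hU ht)
      (fun y hy => Prod.ext rfl (hss y hy)) (fun y hy => Prod.ext (htt y hy) rfl) x hx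
    rw [h0.bracket_inr_inl, h0.bracket_inr_inl] at this
    exact fst this
  · intro U s s' t hU hs hs' ht x hx
    have := h.bracket_add hU (h0.isSection_inl hU ht) (h0.isSection_inr hU hs)
      (h0.isSection_inr hU hs') x hx
    erw [← inrSec_add] at this
    rw [h0.bracket_inl_inr, h0.bracket_inl_inr, h0.bracket_inl_inr] at this
    have h2 : -nabB (s + s') t x = -nabB s t x + -nabB s' t x := fst this
    rw [← neg_add] at h2
    exact neg_injective h2
  · intro U s t t' hU hs ht ht' x hx
    have := h.bracket_add hU (h0.isSection_inr hU hs) (h0.isSection_inl hU ht)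
      (h0.isSection_inl hU ht') x hx
    erw [← inlSec_add] at this
    rw [h0.bracket_inr_inl, h0.bracket_inr_inl, h0.bracket_inr_inl] at this
    exact fst this
  · intro U s t f hU hs ht hf x hx
    have := h.leibniz hU (h0.isSection_inl hU ht) (h0.isSection_inr hU hs) hf x hx
    erw [← inrSec_smul] at this
    rw [h0.bracket_inl_inr, h0.bracket_inl_inr] at this
    have h2 : -nabB (fun y => f y • s y) t x
      = (bowtie 𝒜 ℬ nabA nabB).act (inlSec t) f x • (0 : 𝒜.V x) + f x • -nabB s t x := fst this
    rw [smul_zero, zero_add, smul_neg] at h2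
    exact neg_injective h2
  · intro U s t f hU hs ht hf x hx
    have := h.leibniz hU (h0.isSection_inr hU hs) (h0.isSection_inl hU ht) hf x hx
    erw [← inlSec_smul] at this
    rw [h0.bracket_inr_inl, h0.bracket_inr_inl, bowtie_act_inr] at this
    exact fst this
  · intro U s s' t hU hs hs' ht x hx
    have := h.bracket_leibniz hU (h0.isSection_inr hU hs) (h0.isSection_inr hU hs')
      (h0.isSection_inl hU ht) hx
    rw [h0.bracket_inr_inr, h0.bracket_inr_inl, h0.bracket_inr_inl, h0.bracket_inr_inl,
      h0.bracket_inr, h0.bracket_inr] at this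
    exact eq_sub_of_add_eq (fst this).symm

end ZeroCompat

/-- Two Lie algebroids form a matched pair as soon as the bracket on their direct sum is a Lie
algebroid bracket. -/
theorem ZeroCompat.isMatchedPair (h0 : ZeroCompat 𝒜 ℬ nabA nabB) (h𝒜 : 𝒜.IsVectorBundle)
    (hℬ : ℬ.IsVectorBundle) (h : (bowtie 𝒜 ℬ nabA nabB).IsLieAlgebroid) :
    IsMatchedPair 𝒜 ℬ nabA nabB := by
  have hA := h0.isRepresentation_left h
  have hB := h0.isRepresentation_right h
  refine ⟨h0.isLieAlgebroid_left h𝒜 h, h0.isLieAlgebroid_right hℬ h, hA, hB, ?_, ?_, ?_⟩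
  · intro U s t hU hs ht x hx
    have := h.anchor_bracket hU (h0.isSection_inl hU hs) (h0.isSection_inr hU ht) x hx
    rw [h0.bracket_inl_inr, bowtie_anchor_inl, bowtie_anchor_inr] at this
    rw [← this]
    change 𝒜.anchor x (-nabB t s x) + ℬ.anchor x (nabA s t x) = _
    rw [map_neg]
  · intro U s t t' hU hs ht ht' x hx
    -- The condition is the second component of the Jacobi identity for `(s, 0)`, `(0, t)`, `(0,
    -- t')`.
    have := h.bracket_leibniz hU (h0.isSection_inl hU hs) (h0.isSection_inr hU ht)
      (h0.isSection_inr hU ht') hx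
    rw [h0.bracket_inr_inr, h0.bracket_inl_inr, h0.bracket_inl_inr, h0.bracket_inl_inr,
      h0.bracket_inr, h0.bracket_inr_right] at this
    have h2 : nabA s (ℬ.bracket t t') x
      = ℬ.bracket (nabA s t) t' x + nabA (fun y => -nabB t s y) t' x
        + (ℬ.bracket t (nabA s t') x - nabA (fun y => -nabB t' s y) t x) := congrArg Prod.snd this
    rw [h2, hA.neg_left hU (hB.mem hU ht hs) ht' hx, hA.neg_left hU (hB.mem hU ht' hs) ht hx]
    abel
  · intro U s s' t hU hs hs' ht x hx
    -- The condition is the first component of the Jacobi identity for `(0, t)`, `(s, 0)`, `(s',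
    -- 0)`.
    have := h.bracket_leibniz hU (h0.isSection_inr hU ht) (h0.isSection_inl hU hs)
      (h0.isSection_inl hU hs') hx
    rw [h0.bracket_inl_inl, h0.bracket_inr_inl, h0.bracket_inr_inl, h0.bracket_inr_inl,
      h0.bracket_inl, h0.bracket_inl_right] at this
    have h2 : nabB t (𝒜.bracket s s') x
      = 𝒜.bracket (nabB t s) s' x + nabB (fun y => -nabA s t y) s' x
        + (𝒜.bracket s (nabB t s') x - nabB (fun y => -nabA s' t y) s x) := congrArg Prod.fst this
    rw [h2, hB.neg_left hU (hA.mem hU hs ht) hs' hx, hB.neg_left hU (hA.mem hU hs' ht) hs hx]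
    abel

end MatchedPairs

end HolPoisson

end

noncomputable section

namespace HolPoisson

/-! ### Linear algebra of `𝒥_{4π}` and of its `-i`-eigenbundle. -/

section Pointwise

variable {E : Type*} [NormedAddCommGroup E] [NormedSpace ℂ E]
variable {X : Type*} [TopologicalSpace X] [ChartedSpace E X]
variable {x : X} {U : Set X}

theorem pair_JCdual (ξ : CoTC E x) (Z : TC E x) : pair (JCdual x ξ) Z = pair ξ (JC x Z) := rfl

theorem JC_of_mem_T10 {Z : TC E x} (h : Z ∈ T10 x) : JC x Z = Complex.I • Z :=
  Module.End.mem_eigenspace_iff.1 h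

theorem J_im_of_mem_T10 {Z : TC E x} (h : Z ∈ T10 x) : J x Z.im = Z.re := by
  rw [← neg_neg Z.im, ← mem_T10_iff.1 h, map_neg, J_J, neg_neg]

variable [IsManifold 𝓘(ℂ, E) ω X]

theorem vector_ext {Z W : TC E x} (h : ∀ η : CoTC E x, pair η Z = pair η W) : Z = W :=
  vector_ext_chartLin (mem_chart_source E x) fun _ => h _

namespace HolPoissonStructure

variable (π : HolPoissonStructure E X)

/-- Skewness moves `J` onto `π^♯ η`, an eigenvector of `J` for `i`. -/
theorem sharp_JCdual (ξ : CoTC E x) : π.sharp x (JCdual x ξ) = Complex.I • π.sharp x ξ := by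
  refine vector_ext fun η => ?_
  rw [π.skew, pair_JCdual, JC_of_mem_T10 (π.type20 x η), pair_smul_right, pair_smul_right,
    π.skew x ξ η, mul_neg]

/-- By `sharp_JCdual` the vector `π^♯(J^* ξ)` is `i π^♯ ξ`, while the hypothesis makes it `-i π^♯
ξ`: forms of type (0,1) are killed. -/
theorem sharp_eq_zero {ξ : CoTC E x} (h : JCdual x ξ = -Complex.I • ξ) : π.sharp x ξ = 0 := by
  have h1 := π.sharp_JCdual ξ
  rw [h, map_smul] at h1
  refine vector_ext fun η => ?_
  have h2 := congrArg (pair η) h1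
  rw [pair_smul_right, pair_smul_right] at h2
  rw [pair_zero_right]
  have h3 : Complex.I * pair η (π.sharp x ξ) = 0 := by linear_combination (-1 / 2 : ℂ) * h2
  exact (mul_eq_zero.1 h3).resolve_left Complex.I_ne_zero

theorem pair_sharp_self (ξ η : CoTC E x) :
    pair ξ (π.sharp x η) + pair η (π.sharp x ξ) = 0 := by
  rw [π.skew x η ξ]; ring

/-- The left side is the complex linear extension of `π_I^♯` evaluated at `ξ`. With `π_I = (π -
π̄)/(2i)` and `π̄^♯ ξ = 0` for `ξ` of type (1,0), this gives the constant `1/(2i) = -i/2`. -/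
theorem sharp_of_mem {ξ : CoTC E x} (h : ξ ∈ T10dual x) :
    (⟨(π.sharp x (ofRealForm (reForm ξ))).im, (π.sharp x (ofRealForm (imForm ξ))).im⟩ : TC E x)
      = (-Complex.I / 2) • π.sharp x ξ := by
  have e1 : ξ = ofRealForm (reForm ξ) + Complex.I • ofRealForm (imForm ξ) := by
    ext v
    simp [ofRealForm, reForm, imForm, Complex.ext_iff]
  have h' := mem_T10dual_iff.1 h
  -- The argument is the complex conjugate of `ξ`, hence of type (0,1).
  have e2 : π.sharp x (ofRealForm (reForm ξ) - Complex.I • ofRealForm (imForm ξ)) = 0 := by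
    refine π.sharp_eq_zero ?_
    ext v
    have h2 := h' v
    simp [Complex.ext_iff] at h2
    simp [JCdual, ofRealForm, reForm, imForm, Complex.ext_iff, h2]
  rw [map_sub, map_smul, sub_eq_zero] at e2
  have e3 : π.sharp x ξ = π.sharp x (ofRealForm (reForm ξ))
      + Complex.I • π.sharp x (ofRealForm (imForm ξ)) := by
    rw [← map_smul, ← map_add, ← e1]
  rw [← e2] at e3
  have e4 := congrArg Cplx.re e2
  rw [e3]
  ext
  · simp
    module
  · simp at e4 ⊢
    rw [e4]
    module

theorem complexify_J4 (A : GTC E x) : complexify (π.J4 x) A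
    = (JC x A.1 + (4 : ℂ) • ⟨(π.sharp x (ofRealForm (reForm A.2))).im,
        (π.sharp x (ofRealForm (imForm A.2))).im⟩, -JCdual x A.2) := by
  refine Prod.ext ?_ ?_
  · ext <;> simp [complexify, J4, genEndo, JC]
  · ext v
    simp [complexify, J4, genEndo, JCdual, ofRealForm, reForm, imForm, Complex.ext_iff]

/-- The covector part of the eigenvector equation says that `ξ` is of type (1,0). The vector part is
then `J X - 2i π^♯ ξ = -i X`, since `4 · (-i/2) = -2i`. Because `J π^♯ ξ = i π^♯ ξ`, and `2i` is the
difference of the two eigenvalues of `J`, this says precisely that `X - π^♯ ξ` is of type (0,1).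
This explains the factor 4. -/
theorem mem_L4_iff {A : GTC E x} :
    A ∈ π.L4 x ↔ A.2 ∈ T10dual x ∧ A.1 - π.sharp x A.2 ∈ T01 x := by
  have h1 : A ∈ π.L4 x ↔ complexify (π.J4 x) A = -Complex.I • A := Module.End.mem_eigenspace_iff
  have h2 : A.2 ∈ T10dual x ↔ (complexify (π.J4 x) A).2 = -Complex.I • A.2 := by
    rw [complexify_J4, T10dual, Module.End.mem_eigenspace_iff]
    constructor
    · intro h
      exact (congrArg Neg.neg h).trans (neg_smul Complex.I A.2).symm
    · intro h
      exact neg_injective (h.trans (neg_smul Complex.I A.2))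
  rw [h1, h2, Prod.ext_iff, and_comm]
  refine and_congr_right fun h => ?_
  replace h : A.2 ∈ T10dual x := h2.2 h
  have h3 : JC x (π.sharp x A.2) = Complex.I • π.sharp x A.2 := JC_of_mem_T10 (π.type20 x A.2)
  rw [T01, Module.End.mem_eigenspace_iff, complexify_J4, π.sharp_of_mem h, map_sub, h3]
  change JC x A.1 + (4 : ℂ) • (-Complex.I / 2) • π.sharp x A.2 = -Complex.I • A.1 ↔ _
  constructor
  · intro h
    rw [eq_sub_of_add_eq h]
    module
  · intro h
    rw [sub_eq_iff_eq_add.1 h]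
    module

theorem phi_mem_L4_iff (v : TC E x × CoTC E x) :
    π.phi x v ∈ π.L4 x ↔ v ∈ (T01 x).prod (T10dual x) := by
  rw [mem_L4_iff, Submodule.mem_prod, and_comm]
  change v.1 + π.sharp x v.2 - π.sharp x v.2 ∈ T01 x ∧ _ ↔ _
  rw [add_sub_cancel_right]
  rfl

/-- The map `(Z, ξ) ↦ (Z + π^♯ ξ, ξ)` as a linear equivalence. -/
def phiEquiv (x : X) : (TC E x × CoTC E x) ≃ₗ[ℂ] GTC E x where
  __ := π.phi x
  invFun A := (A.1 - π.sharp x A.2, A.2)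
  left_inv v := Prod.ext (add_sub_cancel_right v.1 (π.sharp x v.2)) rfl
  right_inv A := Prod.ext (sub_add_cancel A.1 (π.sharp x A.2)) rfl

/-- The off-diagonal terms cancel because `J π_I^♯` and `π_I^♯ J^*` both equal `π_R^♯` on real
covectors. -/
theorem J4_J4 (a : GT E x) : π.J4 x (π.J4 x a) = -a := by
  have h1 : ofRealForm (-(a.2.comp (J x))) = -JCdual x (ofRealForm a.2) := by
    ext v
    simp [ofRealForm, JCdual]
  refine Prod.ext ?_ ?_
  · change J x (J x a.1 + ((4 : ℂ) • π.sharp x (ofRealForm a.2)).im)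
      + ((4 : ℂ) • π.sharp x (ofRealForm (-(a.2.comp (J x))))).im = -a.1
    have h3 := J_im_of_mem_T10 (π.type20 x (ofRealForm a.2))
    rw [h1, map_neg, sharp_JCdual, map_add, J_J]
    simp [h3]
  · change -((-(a.2.comp (J x))).comp (J x)) = -a.2
    ext v
    simp [J_J]

/-- The off-diagonal contribution is `-4 α(π_R^♯ β)`, which is skew in the two covectors. -/
theorem J4_orthogonal (a b : GT E x) :
    (π.J4 x a).2 (π.J4 x b).1 + (π.J4 x b).2 (π.J4 x a).1 = a.2 b.1 + b.2 a.1 := by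
  have h3 := fun a : GT E x => J_im_of_mem_T10 (π.type20 x (ofRealForm a.2))
  have h4 : ∀ a b : GT E x, (π.J4 x a).2 (π.J4 x b).1
      = a.2 b.1 - 4 * a.2 (π.sharp x (ofRealForm b.2)).re := by
    intro a b
    change -(a.2 (J x (J x b.1 + ((4 : ℂ) • π.sharp x (ofRealForm b.2)).im))) = _
    simp [J_J, h3]
    ring
  have h5 := congrArg Complex.re (π.pair_sharp_self (ofRealForm a.2) (ofRealForm b.2))
  simp [pair, ofRealForm] at h5
  rw [h4, h4]
  simp only [ofRealForm] at *
  linear_combination -4 * h5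

theorem L4_isotropic {A B : GTC E x} (hA : A ∈ π.L4 x) (hB : B ∈ π.L4 x) :
    pair A.2 B.1 + pair B.2 A.1 = 0 := by
  rw [mem_L4_iff] at hA hB
  have h1 := pair_eq_zero_of_mem hA.1 hB.2
  have h2 := pair_eq_zero_of_mem hB.1 hA.2
  rw [pair_sub_right] at h1 h2
  linear_combination h1 + h2 + π.pair_sharp_self A.2 B.2

/-- For maximality, two kinds of test elements suffice: `(Z, 0)` with `Z` of type (0,1) forces the
covector to be of type (1,0), and `(π^♯ dzᵢ, dzᵢ)` forces `X - π^♯ ξ` to be of type (0,1). -/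
theorem mem_L4_iff_symPair [FiniteDimensional ℂ E] (A : GTC E x) :
    A ∈ π.L4 x ↔ ∀ B ∈ π.L4 x, symPair A B = 0 := by
  constructor
  · intro hA B hB
    rw [symPair, π.L4_isotropic hA hB, mul_zero]
  · intro h
    have h' : ∀ B ∈ π.L4 x, pair A.2 B.1 + pair B.2 A.1 = 0 := fun B hB =>
      (mul_eq_zero.1 (h B hB)).resolve_left (by norm_num)
    rw [mem_L4_iff]
    refine ⟨mem_T10dual_of_pair fun Z hZ => ?_, ?_⟩
    · have h1 := h' (Z, 0) (π.mem_L4_iff.2 ⟨Submodule.zero_mem _, by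
        change Z - π.sharp x 0 ∈ T01 x
        rwa [map_zero, sub_zero]⟩)
      change pair A.2 Z + pair 0 A.1 = 0 at h1
      rwa [pair_zero_left, add_zero] at h1
    · refine mem_T01_of_pair_dhcoord (mem_chart_source E x) fun i => ?_
      have h1 := h' (π.sharp x (dfun (hcoord x i) x), dfun (hcoord x i) x) (π.mem_L4_iff.2
        ⟨dhcoord_mem (mem_chart_source E x) i, by
          change π.sharp x _ - π.sharp x _ ∈ T01 x
          rw [sub_self]; exact Submodule.zero_mem _⟩)
      rw [pair_sub_right]
      have h2 := π.pair_sharp_self A.2 (dfun (hcoord x i) x)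
      linear_combination h1 - h2

theorem smoothGTC_phi_iff (hU : IsOpen U)
    {s : ∀ x : X, TC E x × CoTC E x} :
    SmoothGTC (fun x => π.phi x (s x)) U
      ↔ SmoothVF (fun x => (s x).1) U ∧ SmoothForm (fun x => (s x).2) U := by
  constructor
  · intro h
    refine ⟨(h.1.sub hU (π.smooth hU h.2)).congr fun x _ => ?_, h.2⟩
    exact (add_sub_cancel_right (s x).1 (π.sharp x (s x).2)).symm
  · intro h
    exact ⟨h.1.add hU (π.smooth hU h.2), h.2⟩

end HolPoissonStructure

end Pointwise

end HolPoisson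

end

noncomputable section

namespace HolPoisson

/-! ### Smoothness of `𝒥_{4π}`. -/

section Smoothness

variable {E : Type*} [NormedAddCommGroup E] [NormedSpace ℂ E] [FiniteDimensional ℂ E]
variable {X : Type*} [TopologicalSpace X] [ChartedSpace E X] [IsManifold 𝓘(ℂ, E) ω X]
variable {U : Set X} {ξ : ∀ x : X, CoTC E x}

theorem SmoothForm.reForm (hU : IsOpen U) (hξ : SmoothForm ξ U) :
    SmoothForm (fun x => ofRealForm (HolPoisson.reForm (ξ x))) U := by
  refine smoothForm_of_pair hU fun V hVU hV Z hZ => ?_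
  have hre : ∀ {f : X → ℂ}, SmoothFun (E := E) f V →
      SmoothFun (E := E) (fun y => ((f y).re : ℂ)) V := fun hf =>
    (Complex.ofRealCLM.contDiff.comp Complex.reCLM.contDiff).contMDiff.comp_contMDiffOn hf
  have h1 := hre ((hξ.mono hVU).pair hV (Z := fun y => ⟨(Z y).re, 0⟩) ⟨hZ.1, smoothVF_zero.1⟩)
  have h2 := hre ((hξ.mono hVU).pair hV (Z := fun y => ⟨(Z y).im, 0⟩) ⟨hZ.2, smoothVF_zero.1⟩)
  refine smoothFun_congr (h1.add ((smoothFun_const Complex.I).mul h2)) fun y _ => ?_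
  rw [pair_real, pair_real]
  rfl

theorem SmoothForm.imForm (hU : IsOpen U) (hξ : SmoothForm ξ U) :
    SmoothForm (fun x => ofRealForm (HolPoisson.imForm (ξ x))) U := by
  refine ((hξ.const_smul hU (-Complex.I)).reForm hU).congr fun x _ => ?_
  ext v
  simp [ofRealForm, HolPoisson.imForm, HolPoisson.reForm]

namespace HolPoissonStructure

variable (π : HolPoissonStructure E X)

theorem smooth_J4 {A : ∀ x : X, GTC E x} (hU : IsOpen U) (hA : SmoothGTC A U) :
    SmoothGTC (fun x => complexify (π.J4 x) (A x)) U := by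
  simp only [complexify_J4]
  refine ⟨(hA.1.JC hU).add hU (SmoothVF.const_smul hU 4 ?_), (hA.2.JCdual hU).neg hU⟩
  exact ⟨(π.smooth hU (hA.2.reForm hU)).2, (π.smooth hU (hA.2.imForm hU)).2⟩

end HolPoissonStructure

end Smoothness

/-! ### Vector bundle structures on the summands, their direct sum and `L_{4π}`. -/

section VectorBundles

variable {E : Type*} [NormedAddCommGroup E] [NormedSpace ℂ E] [FiniteDimensional ℂ E]
variable {X : Type*} [TopologicalSpace X] [ChartedSpace E X] [IsManifold 𝓘(ℂ, E) ω X]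

open LieAlgebroidData

theorem isVectorBundle_tangent01 : (tangent01 : LieAlgebroidData E X).IsVectorBundle := by
  refine ⟨?_, ?_, ?_⟩
  · intro U s t hU h hs
    exact ⟨SmoothVF.congr hs.1 fun x hx => (h x hx).symm, fun x hx => h x hx ▸ hs.2 x hx⟩
  · intro U s hU
    constructor
    · intro h x hx
      exact ⟨U, Subset.rfl, hU, hx, h⟩
    · intro h
      refine ⟨smoothVF_of_at fun x hx => ?_, fun x hx => ?_⟩
      · obtain ⟨W, hW, hO, hxW, hs⟩ := h x hx
        exact ⟨SmoothVF.re_at hs.1 hO hxW, SmoothVF.im_at hs.1 hO hxW⟩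
      · obtain ⟨W, hW, hO, hxW, hs⟩ := h x hx
        exact hs.2 x hxW
  · intro x
    -- Recovering the coefficients by pairing with `½ dz̄ⱼ` yields both the linear independence of
    -- the frame and the smoothness of the coefficients.
    have hco : ∀ {y}, y ∈ (chartAt E x).source → ∀ (c : Fin (Module.finrank ℂ E) → ℂ) j,
        (1 / 2 : ℂ) * pair (dfun (hcoordBar x j) y : CoTC E y) (∑ i, c i • dbar x i y) = c j := by
      intro y hy c j
      rw [pair_sum_right, Finset.sum_eq_single j]
      · rw [pair_smul_right, pair_dhcoordBar_dbar hy, if_pos rfl]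
        ring
      · intro i _ hi
        rw [pair_smul_right, pair_dhcoordBar_dbar hy, if_neg hi, mul_zero]
      · intro h
        exact absurd (Finset.mem_univ j) h
    refine ⟨(chartAt E x).source, Module.finrank ℂ E, dbar x, (chartAt E x).open_source,
      mem_chart_source E x, fun y hy => ⟨?_, ?_⟩, fun W hW hO c => ⟨fun h j => ?_, fun h => ?_⟩⟩
    · refine Fintype.linearIndependent_iff.2 fun g hg j => ?_
      rw [← hco hy g j]
      refine (congrArg (fun Z => (1 / 2 : ℂ) * pair (dfun (hcoordBar x j) y : CoTC E y) Z) hg).trans ?_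
      exact (congrArg _ (pair_zero_right _)).trans (mul_zero _)
    · refine le_antisymm (Submodule.span_le.2 ?_) fun Z hZ => ?_
      · rintro _ ⟨i, rfl⟩
        exact dbar_mem hy i
      · rw [T01_eq_sum hy hZ]
        exact Submodule.sum_mem _ fun i _ => Submodule.smul_mem _ _ (Submodule.subset_span ⟨i, rfl⟩)
    · have h1 := ((smoothForm_dhcoordBar x j).mono hW).pair hO h.1
      exact smoothFun_congr ((smoothFun_const (1 / 2)).mul h1) fun y hy => (hco (hW hy) (fun i => c i y) j).symm
    · refine ⟨SmoothVF.sum hO fun i _ => ((smoothVF_dbar x i).mono hW).smul hO (h i), fun y hy => ?_⟩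
      exact Submodule.sum_mem _ fun i _ => Submodule.smul_mem _ _ (dbar_mem (hW hy) i)

theorem isVectorBundle_cotangent10 (π : HolPoissonStructure E X) :
    π.cotangent10.IsVectorBundle := by
  refine ⟨?_, ?_, ?_⟩
  · intro U s t hU h hs
    exact ⟨SmoothForm.congr hs.1 fun x hx => (h x hx).symm, fun x hx => h x hx ▸ hs.2 x hx⟩
  · intro U s hU
    constructor
    · intro h x hx
      exact ⟨U, Subset.rfl, hU, hx, h⟩
    · intro h
      refine ⟨smoothForm_of_at fun x hx => ?_, fun x hx => ?_⟩
      · obtain ⟨W, hW, hO, hxW, hs⟩ := h x hx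
        exact SmoothForm.at hs.1 hO hxW
      · obtain ⟨W, hW, hO, hxW, hs⟩ := h x hx
        exact hs.2 x hxW
  · intro x
    let b : Fin (Module.finrank ℂ E) → ∀ y : X, TC E y := fun i =>
      constVF x ⟨Module.finBasis ℂ E i, 0⟩
    have hb : ∀ i, SmoothVF (b i) (chartAt E x).source := fun i => smoothVF_constVF x _
    have hbi : ∀ {y} (ξ : CoTC E y) i,
        pair ξ (b i y) = ξ (chartDerivInv x y (Module.finBasis ℂ E i)) := by
      intro y ξ i
      change ξ (chartDerivInv x y _) + Complex.I * ξ (chartDerivInv x y 0) = _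
      rw [map_zero, map_zero, mul_zero, add_zero]
    have hco : ∀ {y}, y ∈ (chartAt E x).source → ∀ (c : Fin (Module.finrank ℂ E) → ℂ) j,
        pair (∑ i, c i • (dfun (hcoord x i) y : CoTC E y)) (b j y) = c j := by
      intro y hy c j
      rw [pair_sum_left, Finset.sum_eq_single j]
      · rw [pair_smul_left, hbi, dhcoord_chartDerivInv hy, coordForm_basis, if_pos rfl, mul_one]
      · intro i _ hi
        rw [pair_smul_left, hbi, dhcoord_chartDerivInv hy, coordForm_basis, if_neg hi.symm, mul_zero]
      · intro h
        exact absurd (Finset.mem_univ j) h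
    refine ⟨(chartAt E x).source, Module.finrank ℂ E, fun i => dfun (hcoord x i),
      (chartAt E x).open_source, mem_chart_source E x, fun y hy => ⟨?_, ?_⟩,
      fun W hW hO c => ⟨fun h j => ?_, fun h => ?_⟩⟩
    · refine Fintype.linearIndependent_iff.2 fun g hg j => ?_
      rw [← hco hy g j]
      exact (congrArg (fun ξ : CoTC E y => pair ξ (b j y)) hg).trans (pair_zero_left _)
    · refine le_antisymm (Submodule.span_le.2 ?_) fun ξ hξ => ?_
      · rintro _ ⟨i, rfl⟩
        exact dhcoord_mem hy i
      · rw [T10dual_eq_sum hy hξ]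
        exact Submodule.sum_mem _ fun i _ => Submodule.smul_mem _ _ (Submodule.subset_span ⟨i, rfl⟩)
    · have h1 := SmoothForm.pair hO h.1 ((hb j).mono hW)
      exact smoothFun_congr h1 fun y hy => (hco (hW hy) (fun i => c i y) j).symm
    · refine ⟨SmoothForm.sum hO fun i _ => ((smoothForm_dhcoord x i).mono hW).smul hO (h i),
        fun y hy => ?_⟩
      exact Submodule.sum_mem _ fun i _ => Submodule.smul_mem _ _ (dhcoord_mem (hW hy) i)

theorem isVectorBundle_bowtie01 (π : HolPoissonStructure E X) : π.bowtie01.IsVectorBundle :=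
  isVectorBundle_bowtie isVectorBundle_tangent01 (isVectorBundle_cotangent10 π) _ _

theorem isVectorBundle_L4 (π : HolPoissonStructure E X) :
    (courantData π.L4).IsVectorBundle :=
  (isVectorBundle_bowtie01 π).of_equiv (ℬ := courantData π.L4) π.phiEquiv
    (fun _ v => π.phi_mem_L4_iff v) fun hU _ => π.smoothGTC_phi_iff hU

end VectorBundles

end HolPoisson

end

noncomputable section

namespace HolPoisson

/-! ### The Courant bracket on orthogonal sections. -/

section Courant

variable {E : Type*} [NormedAddCommGroup E] [NormedSpace ℂ E]
variable {X : Type*} [TopologicalSpace X] [ChartedSpace E X] [IsManifold 𝓘(ℂ, E) ω X]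
variable {U : Set X} {x : X} {Z₁ Z₂ Z₃ W : ∀ x : X, TC E x} {ξ₁ ξ₂ ξ₃ : ∀ x : X, CoTC E x}
variable {f : X → ℂ}

/-- The covector component of the Courant bracket of `Z₁ + ξ₁` and `Z₂ + ξ₂`. -/
def courantForm (Z₁ : ∀ x : X, TC E x) (ξ₁ : ∀ x : X, CoTC E x) (Z₂ : ∀ x : X, TC E x)
    (ξ₂ : ∀ x : X, CoTC E x) (x : X) : CoTC E x :=
  lieD Z₁ ξ₂ x - lieD Z₂ ξ₁ x
    + (1 / 2 : ℂ) • dfun (fun y => pair (ξ₁ y) (Z₂ y) - pair (ξ₂ y) (Z₁ y)) x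

theorem courant_congr {A A' B B' : ∀ x : X, GTC E x} (hU : IsOpen U) (hx : x ∈ U)
    (hA : ∀ y ∈ U, A y = A' y) (hB : ∀ y ∈ U, B y = B' y) : courant A B x = courant A' B' x := by
  have hA1 : ∀ y ∈ U, (A y).1 = (A' y).1 := fun y hy => congrArg Prod.fst (hA y hy)
  have hA2 : ∀ y ∈ U, (A y).2 = (A' y).2 := fun y hy => congrArg Prod.snd (hA y hy)
  have hB1 : ∀ y ∈ U, (B y).1 = (B' y).1 := fun y hy => congrArg Prod.fst (hB y hy)
  have hB2 : ∀ y ∈ U, (B y).2 = (B' y).2 := fun y hy => congrArg Prod.snd (hB y hy)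
  refine Prod.ext (lieBr_congr hU hx hA1 hB1) ?_
  change courantForm _ _ _ _ x = courantForm _ _ _ _ x
  rw [courantForm, courantForm, lieD_congr hU hx hA1 hB2, lieD_congr hU hx hB1 hA2,
    dfun_congr hU hx fun y hy => by rw [hA2 y hy, hB1 y hy, hB2 y hy, hA1 y hy]]

variable [FiniteDimensional ℂ E]

theorem lieBr_add_left (hU : IsOpen U) (hx : x ∈ U) (h₁ : SmoothVF Z₁ U) (h₂ : SmoothVF Z₂ U)
    (h₃ : SmoothVF Z₃ U) :
    lieBr (fun y => Z₁ y + Z₂ y) Z₃ x = lieBr Z₁ Z₃ x + lieBr Z₂ Z₃ x := by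
  rw [lieBr_skew, lieBr_add_right hU hx h₃ h₁ h₂, lieBr_skew Z₁, lieBr_skew Z₂, neg_add]

theorem lieBr_smul_left (hU : IsOpen U) (hx : x ∈ U) (hf : SmoothFun (E := E) f U)
    (h₁ : SmoothVF Z₁ U) (h₂ : SmoothVF Z₂ U) :
    lieBr (fun y => f y • Z₁ y) Z₂ x = f x • lieBr Z₁ Z₂ x - vfAct Z₂ f x • Z₁ x := by
  rw [lieBr_skew, lieBr_smul_right hU hx hf h₂ h₁, lieBr_skew Z₁, smul_neg]
  abel

theorem SmoothForm.courantForm (hU : IsOpen U) (hZ₁ : SmoothVF Z₁ U) (hξ₁ : SmoothForm ξ₁ U)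
    (hZ₂ : SmoothVF Z₂ U) (hξ₂ : SmoothForm ξ₂ U) :
    SmoothForm (HolPoisson.courantForm Z₁ ξ₁ Z₂ ξ₂) U :=
  ((hξ₂.lieD hU hZ₁).sub hU (hξ₁.lieD hU hZ₂)).add hU
    ((((hξ₁.pair hU hZ₂).sub (hξ₂.pair hU hZ₁)).dfun hU).const_smul hU _)

theorem SmoothGTC.courant {A B : ∀ x : X, GTC E x} (hU : IsOpen U) (hA : SmoothGTC A U)
    (hB : SmoothGTC B U) : SmoothGTC (HolPoisson.courant A B) U :=
  ⟨hA.1.lieBr hU hB.1, SmoothForm.courantForm hU hA.1 hA.2 hB.1 hB.2⟩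

theorem courant_skew {A B : ∀ x : X, GTC E x} (hU : IsOpen U) (hx : x ∈ U) (hA : SmoothGTC A U)
    (hB : SmoothGTC B U) : courant A B x = -courant B A x := by
  refine Prod.ext (lieBr_skew _ _ x) ?_
  change courantForm _ _ _ _ x = -courantForm _ _ _ _ x
  have h1 := (hA.2.pair hU hB.1).sub (hB.2.pair hU hA.1)
  have h2 := dfun_neg hU hx h1
  simp only [neg_sub] at h2
  rw [courantForm, courantForm, h2]
  refine covector_ext fun W => ?_
  simp only [pair_add_left, pair_sub_left, pair_neg_left, pair_smul_left]
  ring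

/-- The covector component of the Courant bracket of two sections that are orthogonal to
each other. -/
theorem pair_courantForm (hU : IsOpen U) (hx : x ∈ U) (hZ₁ : SmoothVF Z₁ U)
    (hξ₁ : SmoothForm ξ₁ U) (hZ₂ : SmoothVF Z₂ U) (hξ₂ : SmoothForm ξ₂ U) (hW : SmoothVF W U)
    (h : ∀ y ∈ U, pair (ξ₁ y) (Z₂ y) + pair (ξ₂ y) (Z₁ y) = 0) :
    pair (courantForm Z₁ ξ₁ Z₂ ξ₂ x) (W x) = vfAct Z₁ (fun y => pair (ξ₂ y) (W y)) x
      - vfAct Z₂ (fun y => pair (ξ₁ y) (W y)) x + vfAct W (fun y => pair (ξ₁ y) (Z₂ y)) x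
      - pair (ξ₂ x) (lieBr Z₁ W x) + pair (ξ₁ x) (lieBr Z₂ W x) := by
  have h1 : (dfun (fun y => pair (ξ₁ y) (Z₂ y) - pair (ξ₂ y) (Z₁ y)) x : CoTC E x)
      = (2 : ℂ) • dfun (fun y => pair (ξ₁ y) (Z₂ y)) x := by
    rw [← dfun_const_mul hU hx (hξ₁.pair hU hZ₂)]
    exact dfun_congr hU hx fun y hy => by linear_combination -h y hy
  rw [courantForm, h1, pair_add_left, pair_sub_left, pair_smul_left, pair_smul_left,
    pair_lieD hU hx hξ₂ hZ₁ hW, pair_lieD hU hx hξ₁ hZ₂ hW, vfAct, vfAct, vfAct]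
  ring

/-- One summand of the Jacobi identity, expanded so that the cyclic sum can be cancelled. The
formula `pair_courantForm` is applied to the outer bracket, and to the inner one tested both on `W`
and on `[Z₁, W]`. The hypotheses are the orthogonality relations needed for these uses. -/
theorem pair_courantForm_courantForm (hU : IsOpen U) (hx : x ∈ U) (hZ₁ : SmoothVF Z₁ U)
    (hξ₁ : SmoothForm ξ₁ U) (hZ₂ : SmoothVF Z₂ U) (hξ₂ : SmoothForm ξ₂ U) (hZ₃ : SmoothVF Z₃ U)
    (hξ₃ : SmoothForm ξ₃ U) (hW : SmoothVF W U)
    (h : ∀ y ∈ U, pair (ξ₂ y) (Z₃ y) + pair (ξ₃ y) (Z₂ y) = 0)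
    (h' : ∀ y ∈ U, pair (ξ₁ y) (lieBr Z₂ Z₃ y) + pair (courantForm Z₂ ξ₂ Z₃ ξ₃ y) (Z₁ y) = 0) :
    pair (courantForm Z₁ ξ₁ (lieBr Z₂ Z₃) (courantForm Z₂ ξ₂ Z₃ ξ₃) x) (W x)
      = vfAct Z₁ (vfAct Z₂ fun y => pair (ξ₃ y) (W y)) x
        - vfAct Z₁ (vfAct Z₃ fun y => pair (ξ₂ y) (W y)) x
        - vfAct Z₁ (fun y => pair (ξ₃ y) (lieBr Z₂ W y)) x
        + vfAct Z₁ (fun y => pair (ξ₂ y) (lieBr Z₃ W y)) x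
        - vfAct Z₂ (vfAct Z₃ fun y => pair (ξ₁ y) (W y)) x
        + vfAct Z₃ (vfAct Z₂ fun y => pair (ξ₁ y) (W y)) x
        + vfAct W (fun y => vfAct Z₁ (fun y => pair (ξ₂ y) (Z₃ y)) y
            + pair (ξ₁ y) (lieBr Z₂ Z₃ y)) x
        - vfAct Z₂ (fun y => pair (ξ₃ y) (lieBr Z₁ W y)) x
        + vfAct Z₃ (fun y => pair (ξ₂ y) (lieBr Z₁ W y)) x
        + pair (ξ₃ x) (lieBr Z₂ (lieBr Z₁ W) x) - pair (ξ₂ x) (lieBr Z₃ (lieBr Z₁ W) x)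
        - pair (ξ₁ x) (lieBr W (lieBr Z₂ Z₃) x) := by
  have b12 := hZ₁.lieBr hU hW
  have a1 := hZ₂.act hU (hξ₃.pair hU hW)
  have a2 := hZ₃.act hU (hξ₂.pair hU hW)
  have a3 := hW.act hU (hξ₂.pair hU hZ₃)
  have a4 := hξ₃.pair hU (hZ₂.lieBr hU hW)
  have a5 := hξ₂.pair hU (hZ₃.lieBr hU hW)
  rw [pair_courantForm hU hx hZ₁ hξ₁ (hZ₂.lieBr hU hZ₃)
      (SmoothForm.courantForm hU hZ₂ hξ₂ hZ₃ hξ₃) hW h',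
    pair_courantForm hU hx hZ₂ hξ₂ hZ₃ hξ₃ b12 h,
    vfAct_congr hU hx fun y hy => pair_courantForm hU hy hZ₂ hξ₂ hZ₃ hξ₃ hW h,
    vfAct_add hU hx (((a1.sub a2).add a3).sub a4) a5, vfAct_sub hU hx ((a1.sub a2).add a3) a4,
    vfAct_add hU hx (a1.sub a2) a3, vfAct_sub hU hx a1 a2,
    vfAct_lieBr hU hx (hξ₁.pair hU hW) hZ₂ hZ₃, vfAct_lieBr hU hx (hξ₂.pair hU hZ₃) hZ₁ hW,
    vfAct_add hU hx (hZ₁.act hU (hξ₂.pair hU hZ₃)) (hξ₁.pair hU (hZ₂.lieBr hU hZ₃)),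
    lieBr_skew W (lieBr Z₂ Z₃), pair_neg_right]
  ring

/-- The Jacobi identity for the Courant bracket of sections of an isotropic and involutive
subbundle. -/
theorem courantForm_jacobi (hU : IsOpen U) (hx : x ∈ U) (hZ₁ : SmoothVF Z₁ U)
    (hξ₁ : SmoothForm ξ₁ U) (hZ₂ : SmoothVF Z₂ U) (hξ₂ : SmoothForm ξ₂ U) (hZ₃ : SmoothVF Z₃ U)
    (hξ₃ : SmoothForm ξ₃ U)
    (h₁₂ : ∀ y ∈ U, pair (ξ₁ y) (Z₂ y) + pair (ξ₂ y) (Z₁ y) = 0)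
    (h₂₃ : ∀ y ∈ U, pair (ξ₂ y) (Z₃ y) + pair (ξ₃ y) (Z₂ y) = 0)
    (h₃₁ : ∀ y ∈ U, pair (ξ₃ y) (Z₁ y) + pair (ξ₁ y) (Z₃ y) = 0)
    (h₁ : ∀ y ∈ U, pair (ξ₁ y) (lieBr Z₂ Z₃ y) + pair (courantForm Z₂ ξ₂ Z₃ ξ₃ y) (Z₁ y) = 0)
    (h₂ : ∀ y ∈ U, pair (ξ₂ y) (lieBr Z₃ Z₁ y) + pair (courantForm Z₃ ξ₃ Z₁ ξ₁ y) (Z₂ y) = 0)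
    (h₃ : ∀ y ∈ U, pair (ξ₃ y) (lieBr Z₁ Z₂ y) + pair (courantForm Z₁ ξ₁ Z₂ ξ₂ y) (Z₃ y) = 0) :
    courantForm Z₁ ξ₁ (lieBr Z₂ Z₃) (courantForm Z₂ ξ₂ Z₃ ξ₃) x
      + courantForm Z₂ ξ₂ (lieBr Z₃ Z₁) (courantForm Z₃ ξ₃ Z₁ ξ₁) x
      + courantForm Z₃ ξ₃ (lieBr Z₁ Z₂) (courantForm Z₁ ξ₁ Z₂ ξ₂) x = 0 := by
  refine covector_ext_smooth hU hx fun V hVU hV hxV W hW => ?_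
  replace hZ₁ := hZ₁.mono hVU
  replace hZ₂ := hZ₂.mono hVU
  replace hZ₃ := hZ₃.mono hVU
  replace hξ₁ := hξ₁.mono hVU
  replace hξ₂ := hξ₂.mono hVU
  replace hξ₃ := hξ₃.mono hVU
  have t1 := (hZ₁.act hV (hξ₂.pair hV hZ₃)).add (hξ₁.pair hV (hZ₂.lieBr hV hZ₃))
  have t2 := (hZ₂.act hV (hξ₃.pair hV hZ₁)).add (hξ₂.pair hV (hZ₃.lieBr hV hZ₁))
  have t3 := (hZ₃.act hV (hξ₁.pair hV hZ₂)).add (hξ₃.pair hV (hZ₁.lieBr hV hZ₂))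
  -- The function under `W` is, up to a factor, the pairing of the bracket of the first two sections
  -- with the third. This is the anomaly in the Jacobi identity of the Courant bracket, and `h₃`
  -- makes it vanish identically.
  have hT : vfAct W (fun y => (vfAct Z₁ (fun y => pair (ξ₂ y) (Z₃ y)) y
        + pair (ξ₁ y) (lieBr Z₂ Z₃ y)) + (vfAct Z₂ (fun y => pair (ξ₃ y) (Z₁ y)) y
        + pair (ξ₂ y) (lieBr Z₃ Z₁ y)) + (vfAct Z₃ (fun y => pair (ξ₁ y) (Z₂ y)) y
        + pair (ξ₃ y) (lieBr Z₁ Z₂ y))) x = 0 := by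
    rw [← vfAct_const (Z := W) (x := x) 0]
    refine vfAct_congr hV hxV fun y hy => ?_
    have e1 := pair_courantForm hV hy hZ₁ hξ₁ hZ₂ hξ₂ hZ₃ fun y hy => h₁₂ y (hVU hy)
    have e2 := h₃ y (hVU hy)
    have e3 : vfAct Z₂ (fun y => pair (ξ₃ y) (Z₁ y)) y
        = -vfAct Z₂ (fun y => pair (ξ₁ y) (Z₃ y)) y := by
      rw [← vfAct_neg hV hy (hξ₁.pair hV hZ₃)]
      exact vfAct_congr hV hy fun y hy => eq_neg_of_add_eq_zero_left (h₃₁ y (hVU hy))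
    rw [lieBr_skew Z₁ Z₃, pair_neg_right] at e1
    linear_combination e2 - e1 + e3
  rw [vfAct_add hV hxV (t1.add t2) t3, vfAct_add hV hxV t1 t2] at hT
  -- The terms with nested brackets, grouped by covector, are instances of the Jacobi identity of
  -- vector fields.
  have jac : ∀ {Y₁ Y₂ : ∀ x : X, TC E x} {ξ : ∀ x : X, CoTC E x}, SmoothVF Y₁ V → SmoothVF Y₂ V →
      pair (ξ x) (lieBr Y₁ (lieBr Y₂ W) x) - pair (ξ x) (lieBr Y₂ (lieBr Y₁ W) x)
        + pair (ξ x) (lieBr W (lieBr Y₁ Y₂) x) = 0 := by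
    intro Y₁ Y₂ ξ hY₁ hY₂
    have e1 := congrArg (pair (ξ x)) (lieBr_jacobi hV hxV hY₁ hY₂ hW)
    have e2 : lieBr Y₂ (lieBr W Y₁) x = -lieBr Y₂ (lieBr Y₁ W) x := by
      have e3 := lieBr_smul_right hV hxV (smoothFun_const (-1)) hY₂ (hY₁.lieBr hV hW)
      rw [vfAct_const, zero_smul, zero_add, neg_one_smul] at e3
      rw [← e3]
      refine lieBr_congr hV hxV (fun _ _ => rfl) fun y _ => ?_
      rw [lieBr_skew, neg_one_smul]
    rw [e2, pair_add_right, pair_add_right, pair_neg_right, pair_zero_right] at e1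
    linear_combination e1
  rw [pair_add_left, pair_add_left, pair_zero_left,
    pair_courantForm_courantForm hV hxV hZ₁ hξ₁ hZ₂ hξ₂ hZ₃ hξ₃ hW
      (fun y hy => h₂₃ y (hVU hy)) fun y hy => h₁ y (hVU hy),
    pair_courantForm_courantForm hV hxV hZ₂ hξ₂ hZ₃ hξ₃ hZ₁ hξ₁ hW
      (fun y hy => h₃₁ y (hVU hy)) fun y hy => h₂ y (hVU hy),
    pair_courantForm_courantForm hV hxV hZ₃ hξ₃ hZ₁ hξ₁ hZ₂ hξ₂ hW
      (fun y hy => h₁₂ y (hVU hy)) fun y hy => h₃ y (hVU hy)]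
  linear_combination hT - jac (ξ := ξ₁) hZ₂ hZ₃ - jac (ξ := ξ₂) hZ₃ hZ₁ - jac (ξ := ξ₃) hZ₁ hZ₂

theorem courantForm_add_right (hU : IsOpen U) (hx : x ∈ U) (hZ₁ : SmoothVF Z₁ U)
    (hξ₁ : SmoothForm ξ₁ U) (hZ₂ : SmoothVF Z₂ U) (hξ₂ : SmoothForm ξ₂ U) (hZ₃ : SmoothVF Z₃ U)
    (hξ₃ : SmoothForm ξ₃ U)
    (h₁₂ : ∀ y ∈ U, pair (ξ₁ y) (Z₂ y) + pair (ξ₂ y) (Z₁ y) = 0)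
    (h₁₃ : ∀ y ∈ U, pair (ξ₁ y) (Z₃ y) + pair (ξ₃ y) (Z₁ y) = 0) :
    courantForm Z₁ ξ₁ (fun y => Z₂ y + Z₃ y) (fun y => ξ₂ y + ξ₃ y) x
      = courantForm Z₁ ξ₁ Z₂ ξ₂ x + courantForm Z₁ ξ₁ Z₃ ξ₃ x := by
  refine covector_ext_smooth hU hx fun V hVU hV hxV W hW => ?_
  replace hZ₁ := hZ₁.mono hVU
  replace hZ₂ := hZ₂.mono hVU
  replace hZ₃ := hZ₃.mono hVU
  replace hξ₁ := hξ₁.mono hVU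
  replace hξ₂ := hξ₂.mono hVU
  replace hξ₃ := hξ₃.mono hVU
  rw [pair_add_left, pair_courantForm hV hxV hZ₁ hξ₁ hZ₂ hξ₂ hW fun y hy => h₁₂ y (hVU hy),
    pair_courantForm hV hxV hZ₁ hξ₁ hZ₃ hξ₃ hW fun y hy => h₁₃ y (hVU hy),
    pair_courantForm hV hxV hZ₁ hξ₁ (hZ₂.add hV hZ₃) (hξ₂.add hV hξ₃) hW fun y hy => by
      rw [pair_add_left, pair_add_right]
      linear_combination h₁₂ y (hVU hy) + h₁₃ y (hVU hy)]
  simp only [pair_add_left, pair_add_right]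
  rw [vfAct_add hV hxV (hξ₂.pair hV hW) (hξ₃.pair hV hW),
    vfAct_add hV hxV (hξ₁.pair hV hZ₂) (hξ₁.pair hV hZ₃), lieBr_add_left hV hxV hZ₂ hZ₃ hW,
    pair_add_right]
  simp only [vfAct, pair_add_right]
  ring

/-- For general sections the Leibniz rule fails by a multiple of `df` whose coefficient is the
symmetric pairing; `h₁₂` removes it. -/
theorem courantForm_smul_right (hU : IsOpen U) (hx : x ∈ U) (hf : SmoothFun (E := E) f U)
    (hZ₁ : SmoothVF Z₁ U) (hξ₁ : SmoothForm ξ₁ U) (hZ₂ : SmoothVF Z₂ U) (hξ₂ : SmoothForm ξ₂ U)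
    (h₁₂ : ∀ y ∈ U, pair (ξ₁ y) (Z₂ y) + pair (ξ₂ y) (Z₁ y) = 0) :
    courantForm Z₁ ξ₁ (fun y => f y • Z₂ y) (fun y => f y • ξ₂ y) x
      = vfAct Z₁ f x • ξ₂ x + f x • courantForm Z₁ ξ₁ Z₂ ξ₂ x := by
  refine covector_ext_smooth hU hx fun V hVU hV hxV W hW => ?_
  replace hZ₁ := hZ₁.mono hVU
  replace hZ₂ := hZ₂.mono hVU
  replace hξ₁ := hξ₁.mono hVU
  replace hξ₂ := hξ₂.mono hVU
  replace hf := hf.mono hVU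
  rw [pair_add_left, pair_smul_left, pair_smul_left,
    pair_courantForm hV hxV hZ₁ hξ₁ hZ₂ hξ₂ hW fun y hy => h₁₂ y (hVU hy),
    pair_courantForm hV hxV hZ₁ hξ₁ (hZ₂.smul hV hf) (hξ₂.smul hV hf) hW fun y hy => by
      rw [pair_smul_left, pair_smul_right]
      linear_combination f y * h₁₂ y (hVU hy)]
  simp only [pair_smul_left, pair_smul_right]
  rw [vfAct_mul hV hxV hf (hξ₂.pair hV hW), vfAct_mul hV hxV hf (hξ₁.pair hV hZ₂),
    lieBr_smul_left hV hxV hf hZ₂ hW, pair_sub_right, pair_smul_right, pair_smul_right]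
  simp only [vfAct, pair_smul_right]
  ring

end Courant

/-! ### Dirac structures as Lie algebroids. -/

section Dirac

variable {E : Type*} [NormedAddCommGroup E] [NormedSpace ℂ E] [FiniteDimensional ℂ E]
variable {X : Type*} [TopologicalSpace X] [ChartedSpace E X] [IsManifold 𝓘(ℂ, E) ω X]

open LieAlgebroidData

/-- A Dirac structure is a Lie algebroid. -/
theorem IsDirac.isLieAlgebroid {L : ∀ x : X, Submodule ℂ (GTC E x)} (h : IsDirac L) :
    (courantData L).IsLieAlgebroid := by
  have iso : ∀ {y : X} {A B : GTC E y}, A ∈ L y → B ∈ L y → pair A.2 B.1 + pair B.2 A.1 = 0 :=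
    fun hA hB => (mul_eq_zero.1 ((h.maximal_isotropic _ _).1 hA _ hB)).resolve_left (by norm_num)
  have mem : ∀ {U : Set X} {s t : ∀ x : X, GTC E x}, IsOpen U → (courantData L).IsSection s U →
      (courantData L).IsSection t U → (courantData L).IsSection (courant s t) U :=
    fun hU hs ht => ⟨SmoothGTC.courant hU hs.1 ht.1, h.involutive hU hs.1 ht.1 hs.2 ht.2⟩
  refine ⟨h.vectorBundle, ?_, mem, ?_, ?_, ?_, ?_, ?_, ?_⟩
  · intro U s hU hs
    exact hs.1.1
  · intro U s s' t t' hU hs ht hss htt x hx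
    exact courant_congr hU hx hss htt
  · intro U s t u hU hs ht hu x hx
    exact Prod.ext (lieBr_add_right hU hx hs.1.1 ht.1.1 hu.1.1)
      (courantForm_add_right hU hx hs.1.1 hs.1.2 ht.1.1 ht.1.2 hu.1.1 hu.1.2
        (fun y hy => iso (hs.2 y hy) (ht.2 y hy)) fun y hy => iso (hs.2 y hy) (hu.2 y hy))
  · intro U s t hU hs ht x hx
    exact courant_skew hU hx hs.1 ht.1
  · intro U s t f hU hs ht hf x hx
    exact Prod.ext (lieBr_smul_right hU hx hf hs.1.1 ht.1.1)
      (courantForm_smul_right hU hx hf hs.1.1 hs.1.2 ht.1.1 ht.1.2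
        fun y hy => iso (hs.2 y hy) (ht.2 y hy))
  · intro U s t u hU hs ht hu x hx
    exact Prod.ext (lieBr_jacobi hU hx hs.1.1 ht.1.1 hu.1.1)
      (courantForm_jacobi hU hx hs.1.1 hs.1.2 ht.1.1 ht.1.2 hu.1.1 hu.1.2
        (fun y hy => iso (hs.2 y hy) (ht.2 y hy)) (fun y hy => iso (ht.2 y hy) (hu.2 y hy))
        (fun y hy => iso (hu.2 y hy) (hs.2 y hy))
        (fun y hy => iso (hs.2 y hy) ((mem hU ht hu).2 y hy))
        (fun y hy => iso (ht.2 y hy) ((mem hU hu hs).2 y hy))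
        fun y hy => iso (hu.2 y hy) ((mem hU hs ht).2 y hy))
  · intro U s t hU hs ht x hx
    rfl

end Dirac

end HolPoisson

end

noncomputable section

namespace HolPoisson

/-! ### Involutivity of `L_{4π}`. -/

section Involutive

variable {E : Type*} [NormedAddCommGroup E] [NormedSpace ℂ E]
variable {X : Type*} [TopologicalSpace X] [ChartedSpace E X]
variable {U : Set X} {x : X}

theorem HolFun.mono {f : X → ℂ} {V : Set X} (hf : HolFun (E := E) f U) (h : V ⊆ U) :
    HolFun (E := E) f V :=
  ContMDiffOn.mono hf h

variable [IsManifold 𝓘(ℂ, E) ω X]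

namespace HolPoissonStructure

variable (π : HolPoissonStructure E X)

theorem poisson_eq (f g : X → ℂ) (y : X) :
    π.poisson f g y = pair (dfun g y) (π.sharp y (dfun f y)) := rfl

theorem poisson_skew (f g : X → ℂ) (y : X) : π.poisson f g y = -π.poisson g f y :=
  π.skew y _ _

theorem holFun_poisson {f g : X → ℂ} (hU : IsOpen U) (hf : HolFun (E := E) f U)
    (hg : HolFun (E := E) g U) : HolFun (E := E) (π.poisson f g) U :=
  π.holomorphic hU hf hg

/-- `Z` differs from the Hamiltonian field of `f` by a vector of type (0,1), which kills holomorphic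
functions. -/
theorem vfAct_eq_poisson {f g : X → ℂ} {Z : ∀ x : X, TC E x} (hU : IsOpen U) (hx : x ∈ U)
    (hg : HolFun (E := E) g U) (hZ : Z x - π.sharp x (dfun f x) ∈ T01 x) :
    vfAct Z g x = π.poisson f g x := by
  have h := pair_eq_zero_of_mem (hg.dfun_mem hU hx) hZ
  rw [pair_sub_right, sub_eq_zero] at h
  exact h

/-- Since `dg` and `df` are closed, `L_Z dg` and `-L_W df` are both `d{f, g}`, and the last term of
the bracket subtracts one copy. -/
theorem courantForm_dfun {f g : X → ℂ} {Z W : ∀ x : X, TC E x} (hU : IsOpen U) (hx : x ∈ U)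
    (hf : HolFun (E := E) f U) (hg : HolFun (E := E) g U)
    (hZf : ∀ y ∈ U, Z y - π.sharp y (dfun f y) ∈ T01 y)
    (hWg : ∀ y ∈ U, W y - π.sharp y (dfun g y) ∈ T01 y) :
    courantForm Z (fun y => dfun f y) W (fun y => dfun g y) x = dfun (π.poisson f g) x := by
  have hfg := (π.holFun_poisson hU hf hg).smoothFun hU
  have h1 : ∀ y ∈ U, pair (dfun g y) (Z y) = π.poisson f g y := fun y hy =>
    π.vfAct_eq_poisson hU hy hg (hZf y hy)
  have h2 : ∀ y ∈ U, pair (dfun f y) (W y) = -π.poisson f g y := fun y hy => by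
    rw [← π.poisson_skew]
    exact π.vfAct_eq_poisson hU hy hf (hWg y hy)
  rw [courantForm, lieD, lieD, iotaD_dfun hU hx (hg.smoothFun hU),
    iotaD_dfun hU hx (hf.smoothFun hU), dfun_congr hU hx h1, dfun_congr hU hx h2,
    dfun_congr hU hx (f := fun y => pair (dfun f y) (W y) - pair (dfun g y) (Z y))
      (g := fun y => (-2) * π.poisson f g y) fun y hy => by rw [h1 y hy, h2 y hy]; ring,
    dfun_neg hU hx hfg, dfun_const_mul hU hx hfg]
  refine covector_ext fun V => ?_
  simp only [pair_add_left, pair_sub_left, pair_smul_left, pair_neg_left, pair_zero_left]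
  ring

variable [FiniteDimensional ℂ E]

/-- Here the Jacobi identity of the Poisson bracket enters: tested on a holomorphic coordinate `h`,
the vector part of the bracket gives `{f, {g, h}} - {g, {f, h}}`, and membership in `L4` demands
`{{f, g}, h}`. -/
theorem courant_mem_of_holFun {f g : X → ℂ} {Z W : ∀ x : X, TC E x} (hU : IsOpen U) (hx : x ∈ U)
    (hf : HolFun (E := E) f U) (hg : HolFun (E := E) g U) (hZ : SmoothVF Z U) (hW : SmoothVF W U)
    (hZf : ∀ y ∈ U, Z y - π.sharp y (dfun f y) ∈ T01 y)
    (hWg : ∀ y ∈ U, W y - π.sharp y (dfun g y) ∈ T01 y) :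
    courant (fun y => (Z y, dfun f y)) (fun y => (W y, dfun g y)) x ∈ π.L4 x := by
  have h1 : (courant (fun y => (Z y, dfun f y)) (fun y => (W y, dfun g y)) x).2
      = dfun (π.poisson f g) x := π.courantForm_dfun hU hx hf hg hZf hWg
  rw [mem_L4_iff, h1]
  refine ⟨(π.holFun_poisson hU hf hg).dfun_mem hU hx, ?_⟩
  refine mem_T01_of_pair_dhcoord (mem_chart_source E x) fun i => ?_
  set V := U ∩ (chartAt E x).source
  have hV : IsOpen V := hU.inter (chartAt E x).open_source
  have hxV : x ∈ V := ⟨hx, mem_chart_source E x⟩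
  have hVU : V ⊆ U := inter_subset_left
  have hh : HolFun (E := E) (hcoord x i) V := (holFun_hcoord x i).mono inter_subset_right
  generalize hcoord x i = h at hh
  replace hf := hf.mono hVU
  replace hg := hg.mono hVU
  have hfh := π.holFun_poisson hV hf hh
  have hgh := π.holFun_poisson hV hg hh
  have e1 : vfAct (lieBr Z W) h x
      = π.poisson f (π.poisson g h) x - π.poisson g (π.poisson f h) x := by
    rw [vfAct_lieBr hV hxV (hh.smoothFun hV) (hZ.mono hVU) (hW.mono hVU),
      vfAct_congr hV hxV fun y hy => π.vfAct_eq_poisson hV hy hh (hWg y (hVU hy)),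
      vfAct_congr (Z := W) hV hxV fun y hy => π.vfAct_eq_poisson hV hy hh (hZf y (hVU hy)),
      π.vfAct_eq_poisson hV hxV hgh (hZf x hx), π.vfAct_eq_poisson hV hxV hfh (hWg x hx)]
  have e2 : π.poisson f (π.poisson g h) x + π.poisson g (π.poisson h f) x
      + π.poisson h (π.poisson f g) x = 0 := π.jacobi hV hf hg hh x hxV
  have e3 : π.poisson g (π.poisson h f) x = -π.poisson g (π.poisson f h) x := by
    have : π.poisson h f = fun y => -π.poisson f h y := funext fun y => π.poisson_skew h f y
    rw [this, poisson_eq, dfun_neg hV hxV (hfh.smoothFun hV), pair_neg_left]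
    rfl
  have e4 := π.poisson_skew h (π.poisson f g) x
  rw [pair_sub_right]
  change vfAct (lieBr Z W) h x - π.poisson (π.poisson f g) h x = 0
  linear_combination e1 + e2 - e3 - e4

/-- The sections `∂/∂z̄ᵢ` and `π^♯ dzᵢ + dzᵢ` of `L_{4π}`. -/
def L4frame (x₀ : X) : Fin (Module.finrank ℂ E) ⊕ Fin (Module.finrank ℂ E) → ∀ y : X, GTC E y :=
  Sum.elim (fun i y => (dbar x₀ i y, dfun (fun _ => 0) y))
    (fun i y => (π.sharp y (dfun (hcoord x₀ i) y), dfun (hcoord x₀ i) y))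

/-- Both kinds of frame sections have the shape required by `courant_mem_of_holFun`. For this reason
the zero covector in `L4frame` is written as the differential of the function `0`. -/
theorem L4frame_spec (x₀ : X) (i : Fin (Module.finrank ℂ E) ⊕ Fin (Module.finrank ℂ E)) :
    ∃ (f : X → ℂ) (Z : ∀ y : X, TC E y), π.L4frame x₀ i = (fun y => (Z y, dfun f y)) ∧
      HolFun (E := E) f (chartAt E x₀).source ∧ SmoothVF Z (chartAt E x₀).source ∧
      ∀ y ∈ (chartAt E x₀).source, Z y - π.sharp y (dfun f y) ∈ T01 y := by
  rcases i with i | i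
  · refine ⟨fun _ => 0, dbar x₀ i, rfl, contMDiffOn_const, smoothVF_dbar x₀ i, fun y hy => ?_⟩
    rw [dfun_const]
    have h := dbar_mem hy i
    rwa [← sub_zero (dbar x₀ i y), ← map_zero (π.sharp y)] at h
  · refine ⟨hcoord x₀ i, _, rfl, holFun_hcoord x₀ i,
      π.smooth (chartAt E x₀).open_source (smoothForm_dhcoord x₀ i), fun y _ => ?_⟩
    rw [sub_self]
    exact Submodule.zero_mem _

theorem L4frame_smooth (x₀ : X) (i) : SmoothGTC (π.L4frame x₀ i) (chartAt E x₀).source := by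
  obtain ⟨f, Z, h, hf, hZ, -⟩ := π.L4frame_spec x₀ i
  rw [h]
  exact ⟨hZ, (hf.smoothFun (chartAt E x₀).open_source).dfun (chartAt E x₀).open_source⟩

theorem L4frame_mem {x₀ y : X} (hy : y ∈ (chartAt E x₀).source) (i) :
    π.L4frame x₀ i y ∈ π.L4 y := by
  obtain ⟨f, Z, h, hf, hZ, h'⟩ := π.L4frame_spec x₀ i
  rw [h]
  exact π.mem_L4_iff.2 ⟨hf.dfun_mem (chartAt E x₀).open_source hy, h' y hy⟩

theorem courant_L4frame_mem {x₀ y : X} (hy : y ∈ (chartAt E x₀).source) (i j) :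
    courant (π.L4frame x₀ i) (π.L4frame x₀ j) y ∈ π.L4 y := by
  obtain ⟨f, Z, h, hf, hZ, hZf⟩ := π.L4frame_spec x₀ i
  obtain ⟨g, W, h', hg, hW, hWg⟩ := π.L4frame_spec x₀ j
  rw [h, h']
  exact π.courant_mem_of_holFun (chartAt E x₀).open_source hy hf hg hZ hW hZf hWg

theorem courant_add_right {A B C : ∀ x : X, GTC E x} (hU : IsOpen U) (hx : x ∈ U)
    (hA : SmoothGTC A U) (hB : SmoothGTC B U) (hC : SmoothGTC C U) (hA' : ∀ y ∈ U, A y ∈ π.L4 y)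
    (hB' : ∀ y ∈ U, B y ∈ π.L4 y) (hC' : ∀ y ∈ U, C y ∈ π.L4 y) :
    courant A (fun y => B y + C y) x = courant A B x + courant A C x :=
  Prod.ext (lieBr_add_right hU hx hA.1 hB.1 hC.1)
    (courantForm_add_right hU hx hA.1 hA.2 hB.1 hB.2 hC.1 hC.2
      (fun y hy => π.L4_isotropic (hA' y hy) (hB' y hy))
      fun y hy => π.L4_isotropic (hA' y hy) (hC' y hy))

theorem courant_smul_right {A B : ∀ x : X, GTC E x} {f : X → ℂ} (hU : IsOpen U) (hx : x ∈ U)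
    (hf : SmoothFun (E := E) f U) (hA : SmoothGTC A U) (hB : SmoothGTC B U)
    (hA' : ∀ y ∈ U, A y ∈ π.L4 y) (hB' : ∀ y ∈ U, B y ∈ π.L4 y) :
    courant A (fun y => f y • B y) x
      = vfAct (fun y => (A y).1) f x • B x + f x • courant A B x :=
  Prod.ext (lieBr_smul_right hU hx hf hA.1 hB.1)
    (courantForm_smul_right hU hx hf hA.1 hA.2 hB.1 hB.2
      fun y hy => π.L4_isotropic (hA' y hy) (hB' y hy))

/-- By the Leibniz rule, the bracket with a combination of sections of `L4` differs from the
combination of the brackets by sections of `L4`. -/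
theorem courant_sum_mem {A : ∀ x : X, GTC E x} {ι : Type*} (s : Finset ι)
    {B : ι → ∀ x : X, GTC E x} {f : ι → X → ℂ} (hU : IsOpen U) (hx : x ∈ U)
    (hf : ∀ i, SmoothFun (E := E) (f i) U) (hA : SmoothGTC A U) (hB : ∀ i, SmoothGTC (B i) U)
    (hA' : ∀ y ∈ U, A y ∈ π.L4 y) (hB' : ∀ i, ∀ y ∈ U, B i y ∈ π.L4 y)
    (hAB : ∀ i, courant A (B i) x ∈ π.L4 x) :
    courant A (fun y => ∑ i ∈ s, f i y • B i y) x ∈ π.L4 x := by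
  classical
  have hsm : ∀ i, SmoothGTC (fun y => f i y • B i y) U := fun i =>
    ⟨(hB i).1.smul hU (hf i), (hB i).2.smul hU (hf i)⟩
  have hmem : ∀ i, ∀ y ∈ U, f i y • B i y ∈ π.L4 y := fun i y hy =>
    Submodule.smul_mem _ _ (hB' i y hy)
  induction s using Finset.induction_on with
  | empty =>
    -- The empty sum is treated as `0 • A`, so that the Leibniz rule shows its bracket with `A` to
    -- be zero.
    have h := π.courant_smul_right hU hx (smoothFun_const 0) hA hA hA' hA'
    rw [vfAct_const] at h
    replace h := h.trans ((congrArg₂ (· + ·) (zero_smul ℂ (A x)) (zero_smul ℂ _)).trans (add_zero _))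
    have h' : (fun y => ∑ i ∈ ∅, f i y • B i y) = fun y => (0 : ℂ) • A y := by
      funext y
      exact Finset.sum_empty.trans (zero_smul ℂ (A y)).symm
    rw [h', h]
    exact Submodule.zero_mem _
  | insert j s hj ih =>
    have h' : (fun y => ∑ i ∈ insert j s, f i y • B i y)
        = fun y => f j y • B j y + ∑ i ∈ s, f i y • B i y :=
      funext fun y => Finset.sum_insert hj
    have hs : SmoothGTC (fun y => ∑ i ∈ s, f i y • B i y) U := by
      refine ⟨(SmoothVF.sum (s := s) hU fun i _ => (hsm i).1).congr fun y _ => ?_,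
        (SmoothForm.sum (s := s) hU fun i _ => (hsm i).2).congr fun y _ => ?_⟩
      · exact Prod.fst_sum
      · exact Prod.snd_sum
    rw [h', π.courant_add_right hU hx hA (hsm j) hs hA' (hmem j)
      fun y hy => Submodule.sum_mem _ fun i _ => hmem i y hy,
      π.courant_smul_right hU hx (hf j) hA (hB j) hA' (hB' j)]
    exact Submodule.add_mem _ (Submodule.add_mem _ (Submodule.smul_mem _ _ (hB' j x hx))
      (Submodule.smul_mem _ _ (hAB j))) ih

theorem exists_L4frame_coeff {A : ∀ x : X, GTC E x} {x₀ : X} (hU : IsOpen U)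
    (hUx : U ⊆ (chartAt E x₀).source) (hA : SmoothGTC A U) (hA' : ∀ y ∈ U, A y ∈ π.L4 y) :
    ∃ c : Fin (Module.finrank ℂ E) ⊕ Fin (Module.finrank ℂ E) → X → ℂ,
      (∀ i, SmoothFun (E := E) (c i) U) ∧
      ∀ y ∈ U, A y = ∑ i, c i y • π.L4frame x₀ i y := by
  let b : Fin (Module.finrank ℂ E) → ∀ y : X, TC E y := fun i =>
    constVF x₀ ⟨Module.finBasis ℂ E i, 0⟩
  have hbi : ∀ {y} (ξ : CoTC E y) i,
      pair ξ (b i y) = ξ (chartDerivInv x₀ y (Module.finBasis ℂ E i)) := by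
    intro y ξ i
    change ξ (chartDerivInv x₀ y _) + Complex.I * ξ (chartDerivInv x₀ y 0) = _
    rw [map_zero, map_zero, mul_zero, add_zero]
  refine ⟨Sum.elim (fun i y => (1 / 2 : ℂ) * pair (dfun (hcoordBar x₀ i) y)
    ((A y).1 - π.sharp y (A y).2)) (fun i y => pair (A y).2 (b i y)), ?_, fun y hy => ?_⟩
  · rintro (i | i)
    · exact (smoothFun_const _).mul (((smoothForm_dhcoordBar x₀ i).mono hUx).pair hU
        (hA.1.sub hU (π.smooth hU hA.2)))
    · exact hA.2.pair hU ((smoothVF_constVF x₀ _).mono hUx)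
  · have h := π.mem_L4_iff.1 (hA' y hy)
    have h1 := T01_eq_sum (hUx hy) h.2
    have h2 := T10dual_eq_sum (hUx hy) h.1
    rw [Fintype.sum_sum_type]
    simp only [Sum.elim_inl, Sum.elim_inr, hbi, L4frame]
    refine Prod.ext ?_ ?_
    · rw [Prod.fst_add, Prod.fst_sum, Prod.fst_sum]
      simp only [Prod.smul_fst]
      refine (sub_add_cancel _ (π.sharp y (A y).2)).symm.trans (congrArg₂ (· + ·) h1 ?_)
      refine (congrArg (π.sharp y) h2).trans ?_
      rw [map_sum]
      simp only [map_smul]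
    · rw [Prod.snd_add, Prod.snd_sum, Prod.snd_sum]
      simp only [Prod.smul_snd]
      rw [← h2, dfun_const]
      refine (zero_add (A y).2).symm.trans (congrArg (· + (A y).2) ?_)
      exact (Finset.sum_eq_zero fun i _ => smul_zero _).symm

theorem L4_involutive {A B : ∀ x : X, GTC E x} (hU : IsOpen U) (hA : SmoothGTC A U)
    (hB : SmoothGTC B U) (hA' : ∀ y ∈ U, A y ∈ π.L4 y) (hB' : ∀ y ∈ U, B y ∈ π.L4 y)
    (hx : x ∈ U) : courant A B x ∈ π.L4 x := by
  set V := U ∩ (chartAt E x).source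
  have hV : IsOpen V := hU.inter (chartAt E x).open_source
  have hxV : x ∈ V := ⟨hx, mem_chart_source E x⟩
  have hVU : V ⊆ U := inter_subset_left
  have hVx : V ⊆ (chartAt E x).source := inter_subset_right
  have mono : ∀ {A : ∀ x : X, GTC E x} {U : Set X}, SmoothGTC A U → V ⊆ U → SmoothGTC A V :=
    fun h hVU => ⟨h.1.mono hVU, h.2.mono hVU⟩
  replace hA := mono hA hVU
  replace hB := mono hB hVU
  replace hA' := fun y (hy : y ∈ V) => hA' y (hVU hy)
  replace hB' := fun y (hy : y ∈ V) => hB' y (hVU hy)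
  have he := fun i => mono (π.L4frame_smooth x i) hVx
  have he' := fun i y (hy : y ∈ V) => π.L4frame_mem (hVx hy) i
  obtain ⟨a, ha, hAa⟩ := π.exists_L4frame_coeff hV hVx hA hA'
  obtain ⟨b, hb, hBb⟩ := π.exists_L4frame_coeff hV hVx hB hB'
  rw [courant_congr hV hxV (fun _ _ => rfl) hBb]
  refine π.courant_sum_mem _ hV hxV hb hA he hA' he' fun j => ?_
  -- The expansion works only in the second argument; skewness makes it available for `A` as well.
  rw [courant_skew hV hxV hA (he j)]
  refine Submodule.neg_mem _ ?_
  rw [courant_congr hV hxV (fun _ _ => rfl) hAa]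
  exact π.courant_sum_mem _ hV hxV ha (he j) he (he' j) he' fun i =>
    π.courant_L4frame_mem (hVx hxV) j i

end HolPoissonStructure

end Involutive

end HolPoisson

end

noncomputable section

namespace HolPoisson

/-! ### Vanishing on zero sections, and Lie derivatives along (0,1)-fields. -/

section Zero

variable {E : Type*} [NormedAddCommGroup E] [NormedSpace ℂ E]
variable {X : Type*} [TopologicalSpace X] [ChartedSpace E X]

theorem extD_zero (x : X) : extD (fun y : X => (0 : CoTC E y)) x = 0 := by
  have h : inChart (fun y : X => (0 : CoTC E y)) x = fun _ => 0 := by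
    funext y
    exact ContinuousLinearMap.zero_comp _
  simp only [extD, h]
  ext v w
  rw [fderiv_fun_const]
  exact sub_self (0 : ℂ)

theorem iotaD_zero_left (ξ : ∀ x : X, CoTC E x) (x : X) : iotaD (fun _ => 0) ξ x = 0 := by
  ext v
  simp [iotaD]

theorem iotaD_zero_right (Z : ∀ x : X, TC E x) (x : X) :
    iotaD Z (fun _ => 0) x = 0 := by
  ext v
  simp [iotaD, extD_zero]

theorem lieD_zero_left (ξ : ∀ x : X, CoTC E x) (x : X) : lieD (fun _ => 0) ξ x = 0 := by
  simp only [lieD, iotaD_zero_left, pair_zero_right, dfun_const]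
  exact add_zero _

theorem lieD_zero_right (Z : ∀ x : X, TC E x) (x : X) : lieD Z (fun _ => 0) x = 0 := by
  simp only [lieD, iotaD_zero_right, pair_zero_left, dfun_const]
  exact add_zero _

theorem iotaD_add_left (Z W : ∀ x : X, TC E x) (ξ : ∀ x : X, CoTC E x) (x : X) :
    iotaD (fun y => Z y + W y) ξ x = iotaD Z ξ x + iotaD W ξ x := by
  ext v
  simp [iotaD]
  ring

/-- A (1,0)-form vanishes on (0,1)-fields, so `d(η(Z))` drops out of `L_Z η` and only `ι_Z dη`
remains, which is the representation `nab01`. -/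
theorem lieD_add_of_mem {Z W : ∀ x : X, TC E x} {η : ∀ x : X, CoTC E x} {U : Set X} {x : X}
    (hU : IsOpen U)
    (hx : x ∈ U) (hZ : ∀ y ∈ U, Z y ∈ T01 y) (hη : ∀ y ∈ U, η y ∈ T10dual y) :
    lieD (fun y => Z y + W y) η x = iotaD Z η x + lieD W η x := by
  rw [lieD, lieD, iotaD_add_left,
    dfun_congr hU hx (f := fun y => pair (η y) (Z y + W y)) (g := fun y => pair (η y) (W y))
      fun y hy => by rw [pair_add_right, pair_eq_zero_of_mem (hη y hy) (hZ y hy), zero_add]]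
  exact add_assoc _ _ _

theorem lieBr_zero_right (Z : ∀ x : X, TC E x) (x : X) : lieBr Z (fun _ => 0) x = 0 := by
  have h : ∀ V : ∀ x : X, TangentSpace 𝓘(ℝ, E) x,
      VectorField.mlieBracket 𝓘(ℝ, E) V (fun _ => 0) x = 0 := fun V =>
    congrFun VectorField.mlieBracket_zero_right x
  ext <;> simp [lieBr, h]

theorem lieBr_zero_left (Z : ∀ x : X, TC E x) (x : X) : lieBr (fun _ => 0) Z x = 0 := by
  have h : ∀ V : ∀ x : X, TangentSpace 𝓘(ℝ, E) x,
      VectorField.mlieBracket 𝓘(ℝ, E) (fun _ => 0) V x = 0 := fun V =>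
    congrFun VectorField.mlieBracket_zero_left x
  ext <;> simp [lieBr, h]

theorem pr01_zero (x : X) : pr01 (0 : TC E x) = 0 := by
  rw [pr01, map_zero, smul_zero, add_zero, smul_zero]

variable [IsManifold 𝓘(ℂ, E) ω X]

/-- The Lie bracket of 1-forms on a holomorphic Poisson manifold. -/
def HolPoissonStructure.formBr (π : HolPoissonStructure E X) (ξ η : ∀ x : X, CoTC E x) (x : X) :
    CoTC E x :=
  lieD (π.sharpVF ξ) η x - lieD (π.sharpVF η) ξ x - dfun (π.biv ξ η) x

theorem HolPoissonStructure.sharpVF_zero (π : HolPoissonStructure E X) :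
    π.sharpVF (fun _ => 0) = fun _ => 0 := funext fun x => map_zero (π.sharp x)

theorem HolPoissonStructure.formBr_zero_left (π : HolPoissonStructure E X)
    (η : ∀ x : X, CoTC E x) (x : X) : π.formBr (fun _ => 0) η x = 0 := by
  have h : π.biv (fun _ => 0) η = fun _ => 0 := by
    funext y
    rw [HolPoissonStructure.biv, map_zero, pair_zero_right]
  rw [formBr, sharpVF_zero, lieD_zero_left, lieD_zero_right, h, dfun_const]
  exact (sub_zero _).trans (sub_zero (0 : CoTC E x))

theorem HolPoissonStructure.formBr_zero_right (π : HolPoissonStructure E X)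
    (ξ : ∀ x : X, CoTC E x) (x : X) : π.formBr ξ (fun _ => 0) x = 0 := by
  have h : π.biv ξ (fun _ => 0) = fun _ => 0 := by
    funext y
    rw [HolPoissonStructure.biv, pair_zero_left]
  rw [formBr, sharpVF_zero, lieD_zero_left, lieD_zero_right, h, dfun_const]
  exact (sub_zero _).trans (sub_zero (0 : CoTC E x))

theorem HolPoissonStructure.nab10_zero_left (π : HolPoissonStructure E X)
    (Z : ∀ x : X, TC E x) (x : X) : π.nab10 (fun _ => 0) Z x = 0 := by
  rw [nab10, sharpVF_zero, lieBr_zero_left, pr01_zero]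

theorem HolPoissonStructure.nab10_zero_right (π : HolPoissonStructure E X)
    (ξ : ∀ x : X, CoTC E x) (x : X) : π.nab10 ξ (fun _ => 0) x = 0 := by
  rw [nab10, lieBr_zero_right, pr01_zero]

theorem HolPoissonStructure.phi_mem_of_isSection (π : HolPoissonStructure E X) {U : Set X}
    {s : ∀ x : X, TC E x × CoTC E x} (hU : IsOpen U)
    (hs : π.bowtie01.IsSection s U) :
    SmoothGTC (fun x => π.phi x (s x)) U ∧ ∀ y ∈ U, π.phi y (s y) ∈ π.L4 y :=
  ⟨(π.smoothGTC_phi_iff hU).2 hs.1, fun y hy => (π.phi_mem_L4_iff _).2 (hs.2 y hy)⟩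

theorem zeroCompat_tangent01_cotangent10 (π : HolPoissonStructure E X) :
    ZeroCompat tangent01 π.cotangent10 HolPoissonStructure.nab01 π.nab10 := by
  refine ⟨fun _ => smoothVF_zero, fun _ => smoothForm_zero, fun s => funext fun x => ?_,
    fun s => funext fun x => ?_, fun t => funext fun x => ?_, fun t => funext fun x => ?_,
    fun t => funext fun x => ?_, fun s => funext fun x => ?_, fun s => funext fun x => ?_,
    fun t => funext fun x => ?_⟩
  · exact lieBr_zero_left _ x
  · exact lieBr_zero_right _ x
  · exact π.formBr_zero_left t x
  · exact π.formBr_zero_right t x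
  · exact iotaD_zero_left t x
  · exact iotaD_zero_right s x
  · exact π.nab10_zero_left s x
  · exact π.nab10_zero_right t x

end Zero

/-! ### Integrability of `T^{0,1}X` and `T^{1,0}X`. -/

section TypeInvolutive

variable {E : Type*} [NormedAddCommGroup E] [NormedSpace ℂ E] [FiniteDimensional ℂ E]
variable {X : Type*} [TopologicalSpace X] [ChartedSpace E X] [IsManifold 𝓘(ℂ, E) ω X]
variable {U : Set X} {x : X} {Z W : ∀ x : X, TC E x}

theorem pair_dhcoordBar {x₀ y : X} (hy : y ∈ (chartAt E x₀).source)
    (i : Fin (Module.finrank ℂ E)) (Z : TC E y) :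
    pair (dfun (hcoordBar x₀ i) y : CoTC E y) Z
      = (starRingEnd ℂ) (pair (dfun (hcoord x₀ i) y : CoTC E y) (conjTC Z)) := by
  rw [hcoordBar, hcoord, pair_dfun_chartLin _ hy, pair_dfun_chartLin _ hy]
  simp [conjTC]

theorem pair_dhcoordBar_of_mem_T10 {x₀ y : X} (hy : y ∈ (chartAt E x₀).source)
    (i : Fin (Module.finrank ℂ E)) {Z : TC E y} (hZ : Z ∈ T10 y) :
    pair (dfun (hcoordBar x₀ i) y : CoTC E y) Z = 0 := by
  rw [pair_dhcoordBar hy, pair_eq_zero_of_mem (dhcoord_mem hy i) (conjTC_mem_T01.2 hZ), map_zero]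

theorem mem_T10_of_pair_dhcoordBar {x₀ y : X} (hy : y ∈ (chartAt E x₀).source) {Z : TC E y}
    (h : ∀ i, pair (dfun (hcoordBar (E := E) x₀ i) y : CoTC E y) Z = 0) : Z ∈ T10 y := by
  refine conjTC_mem_T01.1 (mem_T01_of_pair_dhcoord hy fun i => ?_)
  have h1 := h i
  rw [pair_dhcoordBar hy] at h1
  exact (map_eq_zero _).1 h1

/-- With `f` running through the coordinates `zᵢ`, respectively `z̄ᵢ`, this gives the involutivity
of the two type distributions. -/
theorem pair_dfun_lieBr_eq_zero {f : X → ℂ} (hU : IsOpen U) (hx : x ∈ U)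
    (hf : SmoothFun (E := E) f U) (hZ : SmoothVF Z U) (hW : SmoothVF W U)
    (hZ' : ∀ y ∈ U, pair (dfun f y) (Z y) = 0) (hW' : ∀ y ∈ U, pair (dfun f y) (W y) = 0) :
    pair (dfun f x) (lieBr Z W x) = 0 := by
  have h := vfAct_lieBr hU hx hf hZ hW
  rw [vfAct_congr (f := vfAct W f) hU hx (g := fun _ => 0) hW',
    vfAct_congr (f := vfAct Z f) hU hx (g := fun _ => 0) hZ',
    vfAct_const, vfAct_const, sub_zero] at h
  exact h

theorem lieBr_mem_T01 (hU : IsOpen U) (hx : x ∈ U) (hZ : SmoothVF Z U) (hW : SmoothVF W U)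
    (hZ' : ∀ y ∈ U, Z y ∈ T01 y) (hW' : ∀ y ∈ U, W y ∈ T01 y) : lieBr Z W x ∈ T01 x := by
  refine mem_T01_of_pair_dhcoord (mem_chart_source E x) fun i => ?_
  exact pair_dfun_lieBr_eq_zero (hU.inter (chartAt E x).open_source) ⟨hx, mem_chart_source E x⟩
    (((holFun_hcoord x i).smoothFun (chartAt E x).open_source).mono inter_subset_right)
    (hZ.mono inter_subset_left) (hW.mono inter_subset_left)
    (fun y hy => pair_eq_zero_of_mem (dhcoord_mem hy.2 i) (hZ' y hy.1))
    fun y hy => pair_eq_zero_of_mem (dhcoord_mem hy.2 i) (hW' y hy.1)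

theorem lieBr_mem_T10 (hU : IsOpen U) (hx : x ∈ U) (hZ : SmoothVF Z U) (hW : SmoothVF W U)
    (hZ' : ∀ y ∈ U, Z y ∈ T10 y) (hW' : ∀ y ∈ U, W y ∈ T10 y) : lieBr Z W x ∈ T10 x := by
  refine mem_T10_of_pair_dhcoordBar (mem_chart_source E x) fun i => ?_
  exact pair_dfun_lieBr_eq_zero (hU.inter (chartAt E x).open_source) ⟨hx, mem_chart_source E x⟩
    ((smoothFun_chartLin x _).mono inter_subset_right)
    (hZ.mono inter_subset_left) (hW.mono inter_subset_left)
    (fun y hy => pair_dhcoordBar_of_mem_T10 hy.2 i (hZ' y hy.1))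
    fun y hy => pair_dhcoordBar_of_mem_T10 hy.2 i (hW' y hy.1)

end TypeInvolutive

/-! ### Compatibility of `phi` with brackets, and the resulting structures. -/

section Main

variable {E : Type*} [NormedAddCommGroup E] [NormedSpace ℂ E]
variable {X : Type*} [TopologicalSpace X] [ChartedSpace E X] [IsManifold 𝓘(ℂ, E) ω X]
variable {U : Set X} {x : X}

namespace HolPoissonStructure

variable (π : HolPoissonStructure E X)

/-- By type, pairings of (1,0)-forms with (0,1)-fields vanish, so the last Courant term is half of
`d(-2 π(ξ, η))`, the exact term in the bracket of forms. -/
theorem phi_bracket_snd {Z W : ∀ x : X, TC E x} {ξ η : ∀ x : X, CoTC E x} (hU : IsOpen U)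
    (hx : x ∈ U) (hξ : SmoothForm ξ U) (hη : SmoothForm η U)
    (hZ : ∀ y ∈ U, Z y ∈ T01 y) (hW : ∀ y ∈ U, W y ∈ T01 y) (hξ' : ∀ y ∈ U, ξ y ∈ T10dual y)
    (hη' : ∀ y ∈ U, η y ∈ T10dual y) :
    courantForm (fun y => Z y + π.sharp y (ξ y)) ξ (fun y => W y + π.sharp y (η y)) η x
      = π.formBr ξ η x + nab01 Z η x - nab01 W ξ x := by
  have h : (dfun (fun y => pair (ξ y) (W y + π.sharp y (η y))
      - pair (η y) (Z y + π.sharp y (ξ y))) x : CoTC E x) = (-2 : ℂ) • dfun (π.biv ξ η) x := by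
    have h1 : SmoothFun (E := E) (π.biv ξ η) U := hη.pair hU (π.smooth hU hξ)
    rw [← dfun_const_mul hU hx h1]
    refine dfun_congr hU hx fun y hy => ?_
    rw [pair_add_right, pair_add_right, pair_eq_zero_of_mem (hξ' y hy) (hW y hy),
      pair_eq_zero_of_mem (hη' y hy) (hZ y hy), π.skew, biv, π.skew]
    ring
  have h2 := lieD_add_of_mem (W := π.sharpVF ξ) hU hx hZ hη'
  have h3 := lieD_add_of_mem (W := π.sharpVF η) hU hx hW hξ'
  change lieD (fun y => Z y + π.sharpVF ξ y) η x - lieD (fun y => W y + π.sharpVF η y) ξ x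
    + (1 / 2 : ℂ) • dfun (fun y => pair (ξ y) (W y + π.sharp y (η y))
      - pair (η y) (Z y + π.sharp y (ξ y))) x
    = lieD (π.sharpVF ξ) η x - lieD (π.sharpVF η) ξ x - dfun (π.biv ξ η) x
      + iotaD Z η x - iotaD W ξ x
  rw [h, h2, h3]
  refine covector_ext fun V => ?_
  simp only [pair_add_left, pair_sub_left, pair_smul_left]
  ring

theorem bracket_dfun {f g : X → ℂ} (hU : IsOpen U) (hx : x ∈ U) (hf : HolFun (E := E) f U)
    (hg : HolFun (E := E) g U) :
    π.formBr (dfun f) (dfun g) x = dfun (π.poisson f g) x := by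
  have hfg := (π.holFun_poisson hU hf hg).smoothFun hU
  change lieD (π.sharpVF (dfun f)) (fun y => dfun g y) x
    - lieD (π.sharpVF (dfun g)) (fun y => dfun f y) x - dfun (π.poisson f g) x = _
  have h1 : (fun y => pair (dfun g y) (π.sharpVF (dfun f) y)) = π.poisson f g := rfl
  have h2 : (fun y => pair (dfun f y) (π.sharpVF (dfun g) y)) = fun y => -π.poisson f g y :=
    funext fun y => π.poisson_skew g f y
  rw [lieD, lieD, iotaD_dfun hU hx (hg.smoothFun hU), iotaD_dfun hU hx (hf.smoothFun hU), h1, h2,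
    dfun_neg hU hx hfg]
  refine covector_ext fun V => ?_
  simp only [pair_add_left, pair_sub_left, pair_neg_left, pair_zero_left]
  ring

variable [FiniteDimensional ℂ E]

/-- By involutivity, the vector part of the Courant bracket minus `π^♯` of its covector part is of
type (0,1), so it equals its own (0,1)-projection. That projection kills the image of `π^♯` and
`[π^♯ ξ, π^♯ η]`, fixes `[Z, W]`, and turns the mixed brackets into `nab10`. -/
theorem phi_bracket {s t : ∀ x : X, TC E x × CoTC E x} (hU : IsOpen U) (hx : x ∈ U)
    (hs : π.bowtie01.IsSection s U) (ht : π.bowtie01.IsSection t U) :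
    π.phi x (π.bowtie01.bracket s t x)
      = courant (fun y => π.phi y (s y)) (fun y => π.phi y (t y)) x := by
  have hs' := π.phi_mem_of_isSection hU hs
  have ht' := π.phi_mem_of_isSection hU ht
  have hL := π.mem_L4_iff.1 (π.L4_involutive hU hs'.1 ht'.1 hs'.2 ht'.2 hx)
  set Z : ∀ x : X, TC E x := fun y => (s y).1
  set W : ∀ x : X, TC E x := fun y => (t y).1
  set ξ : ∀ x : X, CoTC E x := fun y => (s y).2
  set η : ∀ x : X, CoTC E x := fun y => (t y).2
  have hZ : SmoothVF Z U := hs.1.1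
  have hW : SmoothVF W U := ht.1.1
  have hξ : SmoothForm ξ U := hs.1.2
  have hη : SmoothForm η U := ht.1.2
  have hZ' : ∀ y ∈ U, Z y ∈ T01 y := fun y hy => (hs.2 y hy).1
  have hW' : ∀ y ∈ U, W y ∈ T01 y := fun y hy => (ht.2 y hy).1
  have hξ' : ∀ y ∈ U, ξ y ∈ T10dual y := fun y hy => (hs.2 y hy).2
  have hη' : ∀ y ∈ U, η y ∈ T10dual y := fun y hy => (ht.2 y hy).2
  have hP : SmoothVF (π.sharpVF ξ) U := π.smooth hU hξ
  have hQ : SmoothVF (π.sharpVF η) U := π.smooth hU hη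
  have h2 := π.phi_bracket_snd hU hx hξ hη hZ' hW' hξ' hη'
  change courantForm (fun y => Z y + π.sharp y (ξ y)) ξ (fun y => W y + π.sharp y (η y)) η x
      ∈ T10dual x ∧ lieBr (fun y => Z y + π.sharpVF ξ y) (fun y => W y + π.sharpVF η y) x
      - π.sharp x (courantForm (fun y => Z y + π.sharp y (ξ y)) ξ
        (fun y => W y + π.sharp y (η y)) η x) ∈ T01 x at hL
  rw [h2] at hL
  have h3 := pr01_of_mem_T01 hL.2
  rw [pr01_sub, pr01_of_mem_T10 (π.type20 x _), sub_zero,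
    lieBr_add_left hU hx hZ hP (hW.add hU hQ), lieBr_add_right hU hx hZ hW hQ,
    lieBr_add_right hU hx hP hW hQ, lieBr_skew Z (π.sharpVF η), pr01_add, pr01_add, pr01_add,
    pr01_neg, pr01_of_mem_T01 (lieBr_mem_T01 hU hx hZ hW hZ' hW'),
    pr01_of_mem_T10 (lieBr_mem_T10 hU hx hP hQ (fun y _ => π.type20 y _) fun y _ => π.type20 y _),
    add_zero] at h3
  refine Prod.ext ?_ h2.symm
  change lieBr Z W x + π.nab10 ξ W x - π.nab10 η Z x
    + π.sharp x (π.formBr ξ η x + nab01 Z η x - nab01 W ξ x)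
    = lieBr (fun y => Z y + π.sharpVF ξ y) (fun y => W y + π.sharpVF η y) x
  rw [lieBr_add_left hU hx hZ hP (hW.add hU hQ), lieBr_add_right hU hx hZ hW hQ,
    lieBr_add_right hU hx hP hW hQ, lieBr_skew Z (π.sharpVF η), ← eq_sub_iff_add_eq, ← h3]
  simp only [nab10]
  abel

theorem isLieAlgebroidIso_phi :
    IsLieAlgebroidIso π.bowtie01 (courantData π.L4) π.phi := by
  refine ⟨fun x => ⟨?_, ?_, ?_⟩, ?_, ?_, ?_⟩
  · intro v hv
    exact (π.phi_mem_L4_iff v).2 hv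
  · intro v _ w _ h
    exact (π.phiEquiv x).injective h
  · intro A hA
    refine ⟨(π.phiEquiv x).symm A, ?_, (π.phiEquiv x).apply_symm_apply A⟩
    refine (π.phi_mem_L4_iff _).1 ?_
    have h : π.phi x ((π.phiEquiv x).symm A) = A := (π.phiEquiv x).apply_symm_apply A
    rw [h]
    exact hA
  · intro U s hU _
    exact (π.smoothGTC_phi_iff hU).symm
  · intro x v _
    rfl
  · intro U s t hU hs ht x hx
    exact π.phi_bracket hU hx hs ht

theorem isDirac_L4 : IsDirac π.L4 where
  vectorBundle := isVectorBundle_L4 π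
  maximal_isotropic _ := π.mem_L4_iff_symPair
  involutive hU hA hB hA' hB' _ hx := π.L4_involutive hU hA hB hA' hB' hx

theorem isGenComplex_J4 : IsGenComplex π.J4 where
  smooth := π.smooth_J4
  sq_eq _ := π.J4_J4
  orthogonal _ := π.J4_orthogonal
  integrable := π.isDirac_L4.involutive

theorem isLieAlgebroid_bowtie01 : π.bowtie01.IsLieAlgebroid := by
  refine π.isLieAlgebroidIso_phi.isLieAlgebroid π.isDirac_L4.isLieAlgebroid
    (isVectorBundle_bowtie01 π) ?_ ?_ ?_
  · intro U s t hU hs ht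
    exact ⟨⟨SmoothVF.add hU hs.1.1 ht.1.1, SmoothForm.add hU hs.1.2 ht.1.2⟩,
      fun x hx => Submodule.add_mem _ (hs.2 x hx) (ht.2 x hx)⟩
  · intro U s f hU hf hs
    exact ⟨⟨SmoothVF.smul hU hf hs.1.1, SmoothForm.smul hU hf hs.1.2⟩,
      fun x hx => Submodule.smul_mem _ _ (hs.2 x hx)⟩
  · intro U s t hU hs ht x hx
    have hs' := π.phi_mem_of_isSection hU hs
    have ht' := π.phi_mem_of_isSection hU ht
    refine (π.phi_mem_L4_iff _).1 ?_
    rw [π.phi_bracket hU hx hs ht]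
    exact π.L4_involutive hU hs'.1 ht'.1 hs'.2 ht'.2 hx

end HolPoissonStructure

end Main

end HolPoisson

end

theorem mainTheorem3 {E : Type*} [NormedAddCommGroup E] [NormedSpace ℂ E] [FiniteDimensional ℂ E]
    {X : Type*} [TopologicalSpace X] [ChartedSpace E X] [IsManifold 𝓘(ℂ, E) ω X]
    (π : HolPoisson.HolPoissonStructure E X) :
    HolPoisson.IsMatchedPair HolPoisson.tangent01 π.cotangent10
        HolPoisson.HolPoissonStructure.nab01 π.nab10 ∧
      (∀ (U : Set X) (f g : X → ℂ), IsOpen U → HolPoisson.HolFun (E := E) f U →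
        HolPoisson.HolFun (E := E) g U →
        (∀ Z : ∀ x : X, HolPoisson.TC E x, HolPoisson.tangent01.IsSection Z U → ∀ x ∈ U,
          HolPoisson.HolPoissonStructure.nab01 Z (HolPoisson.dfun f) x = 0) ∧
        ∀ x ∈ U, π.cotangent10.bracket (HolPoisson.dfun f) (HolPoisson.dfun g) x
          = HolPoisson.dfun (π.poisson f g) x) ∧
      π.bowtie01.IsLieAlgebroid ∧
      HolPoisson.IsGenComplex π.J4 ∧
      HolPoisson.IsDirac π.L4 ∧
      (HolPoisson.courantData π.L4).IsLieAlgebroid ∧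
      HolPoisson.IsLieAlgebroidIso π.bowtie01 (HolPoisson.courantData π.L4) π.phi := by
  have hb := π.isLieAlgebroid_bowtie01
  have h0 := HolPoisson.zeroCompat_tangent01_cotangent10 π
  refine ⟨h0.isMatchedPair HolPoisson.isVectorBundle_tangent01
    (HolPoisson.isVectorBundle_cotangent10 π) hb, fun U f g hU hf hg => ⟨fun Z _ x hx => ?_,
    fun x hx => π.bracket_dfun hU hx hf hg⟩, hb, π.isGenComplex_J4, π.isDirac_L4,
    π.isDirac_L4.isLieAlgebroid, π.isLieAlgebroidIso_phi⟩
  -- `∇_Z(df)` is `ι_Z d(df)`, which vanishes for any smooth `f`.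
  exact HolPoisson.iotaD_dfun hU hx (hf.smoothFun hU)
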